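/- Let $R$ be a commutative ring and $I\subset R$ a proper ideal such that, for $R_0=R/I$, both maps $R_0\to R_0\otimes\mathbb{Q}$ and $R_0\to\left(\prod_{p}R_0/pR_0\right)/\bigoplus_{p}R_0/pR_0$ ($p$ running over all primes) are injective. Let $S=\hat R_I\hat\otimes\mathbb{Q}=\varprojlim_K (R/I^K)\otimes\mathbb{Q}$, and let $J$ be the kernel of $S\to (R/I)\otimes\mathbb{Q}$. Let $l_1,\dots,l_n\in\mathbb{Z}$, $m\in\mathbb{N}$, and let $B(\varepsilon)=(b_{ij}(\varepsilon))_{i,j\in\mathbb{Z}}$ be a matrix with entries in $R[\varepsilon]$ such that: $b_{ij}=0$ if $j-i>m$; $b_{ij}(\varepsilon)=q_{j-i}(\varepsilon+j)$ if $j-i\le m$, where $q_i\in R[\varepsilon]$ and $q_i\in I[\varepsilon]$ for $0<i\le m$; and $b_{ii}(\varepsilon)\equiv\prod_{s=1}^n(i+\varepsilon-l_s)$ modulo $I[\varepsilon]$ for all $i$. Put $B_{ab}=(b_{ij})_{a\le i,j\le b}$, $a_{ij}(\varepsilon)=b_{ij}(\varepsilon)/\prod_{s=1}^n(j+\varepsilon-l_s)$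 and $A_{ab}=(a_{ij})_{a\le i,j\le b}$. Let $T_\varepsilon$ be the linear operator, defined on the rings $\big((R/I^K)\otimes\mathbb{Q}\big)[\varepsilon,\frac1\varepsilon,\frac1{\varepsilon\pm1},\frac1{\varepsilon\pm2},\dots]$ and by continuity on their inverse limit over $K$, with $T_\varepsilon(\varepsilon^i)=0$ for $i\ge0$ and $T_\varepsilon\big((\varepsilon-c)^{-j}\big)=\varepsilon^{-j}$ for $c\in\mathbb{Z}$, $j\ge1$. Rational functions with integer poles are also regarded as elements of $\varprojlim_K\big((R/I^K)\otimes\mathbb{Q}\big)((\varepsilon))$ by expansion at $\varepsilon=0$. All limits below are $I$-adic, i.e. modulo each $I^K$ the sequence is eventually constant. A Weierstrass polynomial of a power series $q\in S[[\varepsilon]]$ is a monic polynomial with all lower coefficients in $J$ that divides $q$ with quotient a unit of $S[[\varepsilon]]$. (1) For all large $M,N$ the series $\det B_{-M,N}(\varepsilon)$ has a unique Weierstrass polynomial $w_{-M,N}(\varepsilon)=\varepsilon^n-w_{1,-M,N}\varepsilon^{n-1}+\dots+(-1)^nw_{n,-M,N}$, and the $I$-adic limit $w(\varepsilon)=\lim_{M,N\to\infty}w_{-M,N}(\varepsilon)$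 exists; it is monic of degree $n$ with lower coefficients in $J$. (2) For every $b\in\mathbb{Z}$ the limit below exists and $$\varepsilon^n\exp T_\varepsilon\Big(\lim_{N\to\infty}\operatorname{tr}\big(\log A_{-N,-b}(\varepsilon)-\log A_{-N,-b-1}(\varepsilon)\big)\Big)=w(\varepsilon).$$ (3) Let $a,b\in\mathbb{Z}$ with $a+b>0$. The limit $$\rho(\varepsilon)=\lim_{M,N\to\infty}\frac{\det B_{-M,-b}(\varepsilon)\,\det B_{a,N}(\varepsilon)}{\det B_{-M,N}(\varepsilon)}$$ exists, and $F=(-1)^nw(\varepsilon)\rho(\varepsilon)$ lies in $S[[\varepsilon]]$. If moreover the degrees of the $q_i$ grow at most linearly, i.e. there is $d$ with $\deg q_i\le d(1+|i|)$ for all $i\le m$, then there is a real $C>0$ such that for all sufficiently large primes $p$ $$\det B_{a,p-b}(\varepsilon)\equiv F(\varepsilon)\quad\text{modulo } p,\ I^{\lceil Cp\rceil},\ \varepsilon^{\lceil Cp\rceil},$$ that is, for each $e<\lceil Cp\rceil$ the coefficients of $\varepsilon^e$ on both sides differ, in $(R/I^{\lceil Cp\rceil})\otimes\mathbb{Q}$,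 by an element of the form $p\,r/s$ with $r\in R$ and $s$ an integer prime to $p$. -/

import Mathlib

open Polynomial
open scoped TensorProduct

noncomputable section

namespace PDet

/-! ### Partial fractions with integer poles and the operator `T` -/

section PartialFractions

variable (A : Type*) [CommRing A]

/-- The multiplicative set of `A[ε]` generated by all `ε - c`, `c ∈ ℤ`. -/
def linearFactors : Submonoid A[X] :=
  Submonoid.closure (Set.range fun c : ℤ => (X - C (c : A) : A[X]))

/-- The ring `A[ε, 1/ε, 1/(ε ± 1), 1/(ε ± 2), …]`. -/
abbrev PartialFractions : Type _ := Localization (linearFactors A)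

variable {A}

theorem X_sub_mem (c : ℤ) : (X - C (c : A) : A[X]) ∈ linearFactors A :=
  Submonoid.subset_closure ⟨c, rfl⟩

variable (A) in
/-- A polynomial in `ε` as a Laurent series in `ε`. -/
def polyToLaurent : A[X] →+* LaurentSeries A :=
  (HahnSeries.ofPowerSeries ℤ A).comp Polynomial.coeToPowerSeries.ringHom

variable (A) in
/-- Taylor expansion of polynomials at `ε = c`, in the local coordinate `ε - c`. -/
def polyExpandAt (c : ℤ) : A[X] →+* LaurentSeries A :=
  (polyToLaurent A).comp (Polynomial.compRingHom (X + C (c : A)))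

theorem isUnit_polyToLaurent {f : A[X]} (h : IsUnit (f.coeff 0)) :
    IsUnit (polyToLaurent A f) := by
  refine IsUnit.map (HahnSeries.ofPowerSeries ℤ A) ?_
  rw [PowerSeries.isUnit_iff_constantCoeff]
  simpa using h

theorem polyToLaurent_X : polyToLaurent A X = HahnSeries.single 1 1 := by
  simp [polyToLaurent]

/-- The part of a Laurent series with negative exponents. -/
def principalPart : LaurentSeries A →ₗ[A] LaurentSeries A :=
  HahnSeries.truncLTLinearMap A 0

theorem principalPart_ofPowerSeries (f : PowerSeries A) :
    principalPart (HahnSeries.ofPowerSeries ℤ A f) = 0 := by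
  ext k
  simp only [principalPart, HahnSeries.coe_truncLTLinearMap, HahnSeries.coeff_truncLT,
    HahnSeries.coeff_zero, ite_eq_right_iff]
  intro hk
  rw [HahnSeries.ofPowerSeries_apply]
  refine HahnSeries.embDomain_of_notMem_range ?_
  rintro ⟨j, rfl⟩
  simp at hk
  omega

variable [Algebra ℚ A]

theorem isUnit_intCast {c : ℤ} (hc : c ≠ 0) : IsUnit (c : A) := by
  have h : IsUnit ((c : ℚ)) := IsUnit.mk0 _ (by exact_mod_cast hc)
  simpa using h.map (algebraMap ℚ A)

theorem isUnit_polyExpandAt (c : ℤ) (s : linearFactors A) :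
    IsUnit (polyExpandAt A c s) := by
  obtain ⟨s, hs⟩ := s
  induction hs using Submonoid.closure_induction with
  | mem x hx =>
    obtain ⟨d, rfl⟩ := hx
    have h : polyExpandAt A c (X - C (d : A)) = polyToLaurent A (X + C ((c - d : ℤ) : A)) := by
      simp [polyExpandAt, add_sub_assoc]
    simp only [h]
    by_cases hcd : c - d = 0
    · rw [hcd, Int.cast_zero, C_0, add_zero, polyToLaurent_X]
      exact IsUnit.of_mul_eq_one (HahnSeries.single (-1) 1) (by
        rw [HahnSeries.single_mul_single]; simp)
    · exact isUnit_polyToLaurent (by simpa using isUnit_intCast (A := A) hcd)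
  | one => simp
  | mul x y _ _ hx hy => simpa using hx.mul hy

/-- Laurent expansion of a partial fraction at `ε = c`, in the local coordinate `ε - c`. -/
def expandAt (c : ℤ) : PartialFractions A →+* LaurentSeries A :=
  IsLocalization.lift (M := linearFactors A) (isUnit_polyExpandAt c)

theorem expandAt_algebraMap (c : ℤ) (f : A[X]) :
    expandAt c (algebraMap A[X] (PartialFractions A) f) = polyExpandAt A c f :=
  IsLocalization.lift_eq _ _

theorem finite_nonunits (s : A[X]) (hs : s ∈ linearFactors A) :
    {c : ℤ | ¬ IsUnit (s.eval (c : A))}.Finite := by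
  induction hs using Submonoid.closure_induction with
  | mem x hx =>
    obtain ⟨d, rfl⟩ := hx
    refine (Set.finite_singleton d).subset fun c hc => ?_
    by_contra hcd
    refine hc ?_
    have := isUnit_intCast (A := A) (sub_ne_zero.mpr hcd)
    simpa using this
  | one => simp
  | mul x y _ _ hx hy =>
    refine (hx.union hy).subset fun c hc => ?_
    by_contra h
    simp only [Set.mem_union, Set.mem_ofPred_eq, not_or, not_not] at h
    exact hc (by simpa using h.1.mul h.2)

theorem principalPart_expandAt_finite (f : PartialFractions A) :
    (Function.support fun c : ℤ => principalPart (expandAt c f)).Finite := by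
  obtain ⟨g, s, rfl⟩ := IsLocalization.exists_mk'_eq (linearFactors A) f
  refine (finite_nonunits s.1 s.2).subset fun c hc hu => hc ?_
  have h0 : IsUnit (((compRingHom (X + C (c : A)) s.1 : A[X]) : PowerSeries A)) := by
    rw [PowerSeries.isUnit_iff_constantCoeff]
    simpa [Polynomial.coeff_zero_eq_eval_zero, Polynomial.eval_comp] using hu
  obtain ⟨u, hu⟩ := h0
  have h1 : expandAt c (IsLocalization.mk' (PartialFractions A) g s) =
      HahnSeries.ofPowerSeries ℤ A
        ((compRingHom (X + C (c : A)) g : A[X]) * ((u⁻¹ : (PowerSeries A)ˣ) : PowerSeries A)) := by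
    rw [expandAt, IsLocalization.lift_mk'_spec]
    simp only [polyExpandAt, polyToLaurent, RingHom.comp_apply, ← map_mul,
      Polynomial.coeToPowerSeries.ringHom_apply]
    rw [← hu, mul_comm, mul_assoc, Units.inv_mul, mul_one]
  simp only [h1, principalPart_ofPowerSeries]

theorem expandAt_smul (c : ℤ) (r : A) (f : PartialFractions A) :
    expandAt c (r • f) = r • expandAt c f := by
  have h : r • f = algebraMap A[X] (PartialFractions A) (C r) * f := by
    rw [← Algebra.smul_def, ← Polynomial.algebraMap_eq, algebraMap_smul]
  rw [h, map_mul, expandAt_algebraMap, ← HahnSeries.C_mul_eq_smul]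
  congr 1
  simp [polyExpandAt, polyToLaurent]

/-- The operator `T`: the sum over all `c ∈ ℤ` of the principal parts at `ε = c`, each of them
translated to `ε = 0`. By linearity and partial fractions it is determined by its values
`T (ε ^ i) = 0` and `T (1 / (ε - c) ^ j) = 1 / ε ^ j`, see `T_X_pow` and `T_inv_pow`. -/
def T : PartialFractions A →ₗ[A] LaurentSeries A where
  toFun f := ∑ᶠ c : ℤ, principalPart (expandAt c f)
  map_add' f g := by
    simp only [map_add]
    exact finsum_add_distrib (principalPart_expandAt_finite f) (principalPart_expandAt_finite g)
  map_smul' r f := by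
    simp only [expandAt_smul, map_smul, RingHom.id_apply]
    exact (smul_finsum' r (principalPart_expandAt_finite f)).symm

theorem T_X_pow (i : ℕ) : T (algebraMap A[X] (PartialFractions A) (X ^ i)) = 0 := by
  change ∑ᶠ c : ℤ, principalPart (expandAt c (algebraMap A[X] (PartialFractions A) (X ^ i))) = 0
  refine (finsum_congr fun c => ?_).trans finsum_zero
  rw [expandAt_algebraMap]
  exact principalPart_ofPowerSeries _

theorem T_inv_pow (c : ℤ) (j : ℕ) (hj : 0 < j) :
    T (Localization.mk 1 ⟨(X - C (c : A)) ^ j, pow_mem (X_sub_mem c) j⟩) =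
      HahnSeries.single (-(j : ℤ)) 1 := by
  set s : linearFactors A := ⟨(X - C (c : A)) ^ j, pow_mem (X_sub_mem c) j⟩ with hs
  have hmul : ∀ d : ℤ, expandAt d (Localization.mk 1 s) * polyExpandAt A d s = 1 := fun d => by
    rw [← expandAt_algebraMap, ← map_mul, ← Localization.mk_one_eq_algebraMap, Localization.mk_mul]
    simpa using (map_one (expandAt (A := A) d)) ▸ congrArg (expandAt d) (Localization.mk_self s)
  have hc : expandAt c (Localization.mk 1 s) = HahnSeries.single (-(j : ℤ)) (1 : A) := by
    have h2 : polyExpandAt A c s = HahnSeries.single (j : ℤ) 1 := by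
      rw [hs, polyExpandAt]
      simp [polyToLaurent_X]
    have h1 := hmul c
    rw [h2] at h1
    calc _ = expandAt c (Localization.mk 1 s) *
        (HahnSeries.single (j : ℤ) 1 * HahnSeries.single (-(j : ℤ)) (1 : A)) := by
          rw [HahnSeries.single_mul_single]; simp
      _ = _ := by rw [← mul_assoc, h1, one_mul]
  change ∑ᶠ d : ℤ, principalPart (expandAt d (Localization.mk 1 s)) = _
  rw [finsum_eq_single _ c]
  · rw [hc]
    ext k
    simp only [principalPart, HahnSeries.coe_truncLTLinearMap, HahnSeries.coeff_truncLT,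
      HahnSeries.coeff_single]
    split_ifs <;> first | rfl | omega
  · intro d hd
    have h0 : IsUnit (((compRingHom (X + C (d : A)) s.1 : A[X]) : PowerSeries A)) := by
      rw [PowerSeries.isUnit_iff_constantCoeff]
      have := (isUnit_intCast (A := A) (sub_ne_zero.mpr hd)).pow j
      simpa [hs, Polynomial.coeff_zero_eq_eval_zero, Polynomial.eval_comp] using this
    obtain ⟨u, hu⟩ := h0
    have h1 : polyExpandAt A d s = HahnSeries.ofPowerSeries ℤ A u := by
      rw [hu]; rfl
    have h2 : expandAt d (Localization.mk 1 s) =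
        HahnSeries.ofPowerSeries ℤ A ((u⁻¹ : (PowerSeries A)ˣ) : PowerSeries A) := by
      calc _ = expandAt d (Localization.mk 1 s) * (HahnSeries.ofPowerSeries ℤ A u *
          HahnSeries.ofPowerSeries ℤ A ((u⁻¹ : (PowerSeries A)ˣ) : PowerSeries A)) := by
            rw [← map_mul, Units.mul_inv, map_one, mul_one]
        _ = _ := by rw [← mul_assoc, ← h1, hmul, one_mul]
    rw [h2, principalPart_ofPowerSeries]

end PartialFractions

/-! ### The completed coefficient ring -/

section Completion

variable {R : Type*} [CommRing R] (I : Ideal R)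

/-- The assumption on `R₀ = R / I`: the maps `R₀ → R₀ ⊗ ℚ` and
`R₀ → (∏ₚ R₀ / p R₀) / ⨁ₚ R₀ / p R₀` are injective. An element is in the kernel of the second
map iff it lies in `p R₀` for all but finitely many primes `p`. -/
structure ResidueAssumption : Prop where
  injective_rat : Function.Injective
    (Algebra.TensorProduct.includeRight : (R ⧸ I) →ₐ[ℤ] ℚ ⊗[ℤ] (R ⧸ I))
  injective_primes : ∀ x : R ⧸ I,
    {p : ℕ | p.Prime ∧ x ∉ Ideal.span {(p : R ⧸ I)}}.Finite → x = 0

/-- The extension of the ideal `I` to `ℚ ⊗ R`. -/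
def ratIdeal : Ideal (ℚ ⊗[ℤ] R) :=
  I.map (Algebra.TensorProduct.includeRight : R →ₐ[ℤ] ℚ ⊗[ℤ] R)

/-- The completed tensor product of the `I`-adic completion of `R` with `ℚ`, i.e. the inverse
limit of the rings `ℚ ⊗ (R / I ^ K)`. -/
abbrev Completion : Type _ := AdicCompletion (ratIdeal I) (ℚ ⊗[ℤ] R)

/-- `ℚ ⊗ (R / I ^ K)`, written as the quotient of `ℚ ⊗ R` by the `K`-th power of the extension
of `I`. -/
def Level (K : ℕ) : Type _ := (ℚ ⊗[ℤ] R) ⧸ ratIdeal I ^ K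

instance (K : ℕ) : CommRing (Level I K) :=
  inferInstanceAs (CommRing ((ℚ ⊗[ℤ] R) ⧸ ratIdeal I ^ K))

instance (K : ℕ) : Algebra ℚ (Level I K) :=
  inferInstanceAs (Algebra ℚ ((ℚ ⊗[ℤ] R) ⧸ ratIdeal I ^ K))

/-- Reduction of the completed ring modulo `I ^ K`. -/
def evalLevel (K : ℕ) : Completion I →+* Level I K :=
  (AdicCompletion.evalₐ (ratIdeal I) K).toRingHom

/-- The canonical map `R → ℚ ⊗ R → ℚ ⊗ (R / I ^ K)`. -/
def toLevel (K : ℕ) : R →+* Level I K :=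
  (Ideal.Quotient.mk (ratIdeal I ^ K)).comp
    (Algebra.TensorProduct.includeRight : R →ₐ[ℤ] ℚ ⊗[ℤ] R).toRingHom

/-- The canonical map from `R` to the completed ring. -/
def toCompletion : R →+* Completion I :=
  (algebraMap (ℚ ⊗[ℤ] R) (Completion I)).comp
    (Algebra.TensorProduct.includeRight : R →ₐ[ℤ] ℚ ⊗[ℤ] R).toRingHom

/-- The (closed) ideal of the completed ring generated by `I`: the kernel of the reduction
modulo `I`. -/
def augIdeal : Ideal (Completion I) := RingHom.ker (evalLevel I 1)

/-- Convergence in an inverse limit over `K` of rings `F K` with the `I`-adic topology, `F K`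
being the reduction modulo `I ^ K`. Elements are given by their reductions modulo all `I ^ K`;
`u` converges to `x` iff for each `K` the reduction of `u` modulo `I ^ K` is eventually equal to
that of `x`. -/
def IsAdicLimit {ι : Type*} {F : ℕ → Type*} (f : Filter ι) (u : ι → ∀ K, F K) (x : ∀ K, F K) :
    Prop :=
  ∀ K, ∀ᶠ i in f, u i K = x K

/-- `P = εⁿ - w₁ εⁿ⁻¹ + ⋯` is a Weierstrass polynomial of the power series `F`: it is monic, its
lower coefficients lie in (the closed ideal generated by) `I`, and `F = P * (unit)`. -/
def IsWeierstrassPolynomial (F : PowerSeries (Completion I)) (P : (Completion I)[X]) : Prop :=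
  ∃ h : PowerSeries (Completion I), F.IsWeierstrassFactorizationAt P h (augIdeal I)

/-- `F ≡ G` modulo `p`, `I ^ K` and `ε ^ K`: for `e < K` the coefficients of `ε ^ e` in `F` and `G`
differ, modulo `I ^ K`, by an element `p r / s` with `r ∈ R` and `s` an integer prime to `p`. -/
def CongrMod (p K : ℕ) (F G : PowerSeries (Completion I)) : Prop :=
  ∀ e < K, ∃ (r : R) (s : ℕ), ¬ p ∣ s ∧
    (s : Level I K) * evalLevel I K (PowerSeries.coeff e F - PowerSeries.coeff e G) =
      (p : Level I K) * toLevel I K r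

end Completion

/-! ### Infinite matrices -/

section Matrices

/-- The finite submatrix with rows and columns in `{a, …, b}`. -/
def sect {S : Type*} (B : Matrix ℤ ℤ S) (a b : ℤ) : Matrix (Finset.Icc a b) (Finset.Icc a b) S :=
  B.submatrix (fun i => (i : ℤ)) (fun i => (i : ℤ))

/-- `log Y = ∑_{k ≥ 1} (-1)^(k-1) / k * (Y - 1)^k` for a matrix `Y` such that `Y - 1` is
nilpotent. -/
def matLog {ι S : Type*} [Fintype ι] [DecidableEq ι] [CommRing S] [Algebra ℚ S]
    (Y : Matrix ι ι S) : Matrix ι ι S :=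
  ∑ k ∈ Finset.Ico 1 (nilpotencyClass (Y - 1)), ((-1 : ℚ) ^ (k - 1) / (k : ℚ)) • (Y - 1) ^ k

variable {R : Type*} [CommRing R] (I : Ideal R) {n : ℕ}

/-- The assumptions on the infinite matrix `B(ε)`. -/
structure IsAdmissible (m : ℕ) (l : Fin n → ℤ) (q : ℤ → R[X]) (B : Matrix ℤ ℤ R[X]) : Prop where
  band : ∀ i j : ℤ, (m : ℤ) < j - i → B i j = 0
  diag : ∀ i : ℤ, ∀ k : ℕ, (B i i - ∏ s, (X + C ((i - l s : ℤ) : R))).coeff k ∈ I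
  entry : ∀ i j : ℤ, j - i ≤ m → B i j = (q (j - i)).comp (X + C (j : R))
  upper : ∀ i : ℤ, 0 < i → i ≤ m → ∀ k : ℕ, (q i).coeff k ∈ I

/-- `det B_{a,b}(ε)` as a power series in `ε` over the completed ring. -/
def detSeries (B : Matrix ℤ ℤ R[X]) (a b : ℤ) : PowerSeries (Completion I) :=
  (((sect B a b).det.map (toCompletion I) : (Completion I)[X]) : PowerSeries (Completion I))

/-- `det B_{a,b}(ε)` as a Laurent series in `ε` modulo `I ^ K`. -/
def detLaurent (B : Matrix ℤ ℤ R[X]) (a b : ℤ) (K : ℕ) : LaurentSeries (Level I K) :=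
  polyToLaurent (Level I K) ((sect B a b).det.map (toLevel I K))

/-- The matrix `A(ε)`, `a_{ij}(ε) = b_{ij}(ε) / ∏ₛ (j + ε - lₛ)`, modulo `I ^ K`. -/
def normalized (l : Fin n → ℤ) (B : Matrix ℤ ℤ R[X]) (K : ℕ) :
    Matrix ℤ ℤ (PartialFractions (Level I K)) := fun i j =>
  Localization.mk ((B i j).map (toLevel I K))
    ⟨∏ s, (X - C ((l s - j : ℤ) : Level I K)), prod_mem fun s _ => X_sub_mem (l s - j)⟩

end Matrices

end PDet

end

noncomputable section

namespace PDet

/-! ### Exponentials of nilpotent elements. -/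

section Exponential

variable {A : Type*} [CommRing A] [Algebra ℚ A]

/-! Modulo `I ^ K` one works over a ring with an ideal `𝔫` such that `𝔫 ^ K = 0`, and `B` is a band
matrix, lower triangular modulo `𝔫`. Write `D(a,b)` for the determinant of the section over `{a, …,
b}`. The solution of the section's linear system with right-hand side the last basis vector gains a
factor from `𝔫` every `m` steps away from `b`. Far from `b` it vanishes, so it also solves the
systems of longer sections. By Cramer's rule `D(a,b-1) / D(a,b)` is independent of `a` for distant
`a`. This is the cross relation `D(a,b) D(a',b') = D(a',b) D(a,b')` (`idet_local`, `Banded.cross`),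
from which all limits follow.

Weierstrass polynomials: sections that avoid all `lₛ` have unit determinant in power series. The
cross relation therefore changes `D(μ,ν)` only by units when the end points move, and the
Weierstrass polynomial is stable (`Banded.wFact_eq`). The same relations stabilize the ratio that
defines `ρ` (`Banded.ratio_eq`). If `D(μ,ν) = W h` with `h` a unit, then `F` is `(-1)ⁿ D(μ,-b)
D(a,ν) / h`, which is visibly a power series.

Logarithms: `exp tr log = det` for unipotent matrices, so the cross relation holds additively for
`tr log`. The translation `ε ↦ ε + j` shifts sections. Hence the principal parts collected by `T`
are principal parts at `0` of shifted sections, and their sum telescopes to that of one long section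
(`Banded.T_trLog_sub`). The exponential of a principal part has no positive exponents, so `εⁿ` times
it is distinguished and differs from `D(μ,ν)` by a unit: it is the Weierstrass polynomial
(`Banded.single_mul_exp_principalPart`).

Congruence: after inverting the integers prime to `p` and reducing modulo `p`, the matrix is
`p`-periodic. Each quotient `D(a,j) / D(a,j-1)` can be read off a window of fixed length ending at
`j` (`Banded.telescope`). Over `p` consecutive `j` the product is a quotient of norms over the
translations by `𝔽_p`. Such norms are polynomials in `y = ε^p - ε`, and the linear degree bound
forces them to be monic of the expected degree (`monic_fpNorm_add`, `Banded.exists_fpNorm_idet`).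
The quotient of the norms is thus `U(y)` with `U` monic of degree `n`, and also `W η` for a power
series `η`. Since `y ≡ -ε` modulo `ε^p`, uniqueness of Weierstrass factorizations gives `η = (-1)ⁿ`
up to high powers of `ε` (`Distinguished.eq_of_comp_artinSchreier`). Substituting this into the
telescoped formula for `D(a,p-b)` yields `F` (`Banded.exists_eq_mul_of_charP`). -/

theorem eq_zero_of_exp_eq_one {z : A} (hz : IsNilpotent z) (h : IsNilpotent.exp z = 1) :
    z = 0 := by
  obtain ⟨k, hk⟩ := hz
  have hk1 : z ^ (k + 2) = 0 := by rw [pow_add, hk, zero_mul]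
  rw [IsNilpotent.exp_eq_sum hk1, Finset.sum_range_succ', Finset.sum_range_succ'] at h
  set y := ∑ i ∈ Finset.range k, (((i + 1 + 1).factorial : ℚ)⁻¹) • z ^ i with hy
  -- `exp z - 1` is `z` times a unit.
  have h1 : z * (1 + z * y) = 0 := by
    have h2 : ∑ i ∈ Finset.range k, (((i + 1 + 1).factorial : ℚ)⁻¹) • z ^ (i + 1 + 1) =
        z * (z * y) := by
      rw [hy, Finset.mul_sum, Finset.mul_sum]
      exact Finset.sum_congr rfl fun i _ => by
        rw [mul_smul_comm, mul_smul_comm, pow_succ, pow_succ, mul_comm, mul_comm (z ^ i)]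
    rw [h2] at h
    simp only [zero_add, Nat.factorial_one, Nat.cast_one, inv_one, pow_one, one_smul,
      Nat.factorial_zero, pow_zero] at h
    linear_combination h
  have hu : IsUnit (1 + z * y) :=
    IsNilpotent.isUnit_one_add ((Commute.all z y).isNilpotent_mul_right ⟨k, hk⟩)
  exact (hu.mul_left_eq_zero).1 h1

theorem exp_injOn {x y : A} (hx : IsNilpotent x) (hy : IsNilpotent y)
    (h : IsNilpotent.exp x = IsNilpotent.exp y) : x = y := by
  refine sub_eq_zero.1 (eq_zero_of_exp_eq_one ((Commute.all x y).isNilpotent_sub hx hy) ?_)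
  rw [sub_eq_add_neg, IsNilpotent.exp_add_of_commute (Commute.all _ _) hx hy.neg, h,
    IsNilpotent.exp_mul_exp_neg_self hy]

theorem derivation_exp (D : Derivation ℚ A A) {x : A} (hx : IsNilpotent x) :
    D (IsNilpotent.exp x) = IsNilpotent.exp x * D x := by
  obtain ⟨k, hk⟩ := hx
  have hk1 : x ^ (k + 1) = 0 := by rw [pow_succ, hk, zero_mul]
  conv_lhs => rw [IsNilpotent.exp_eq_sum hk1]
  rw [IsNilpotent.exp_eq_sum hk, Finset.sum_range_succ', map_add, map_sum, Finset.sum_mul,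
    pow_zero, D.map_smul, D.map_one_eq_zero, smul_zero, add_zero]
  refine Finset.sum_congr rfl fun i _ => ?_
  rw [D.map_smul, Derivation.leibniz_pow, Nat.add_sub_cancel, ← Nat.cast_smul_eq_nsmul ℚ, smul_smul,
    smul_eq_mul, smul_mul_assoc]
  congr 1
  rw [Nat.factorial_succ]
  have : (i.factorial : ℚ) ≠ 0 := by exact_mod_cast i.factorial_ne_zero
  push_cast
  field_simp

end Exponential

/-! ### Jacobi's formula and `exp tr log = det`. -/

section DetDerivative

variable {A ι : Type*} [CommRing A] [Fintype ι] [DecidableEq ι]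

/-- Jacobi's formula. The Leibniz expansion is differentiated column by column, and Cramer's rule
identifies each determinant with a differentiated column as a diagonal entry of the product. -/
theorem derivative_det (M : Matrix ι ι A[X]) :
    derivative M.det = (M.adjugate * M.map derivative).trace := by
  have h1 : ∀ i, (M.adjugate * M.map derivative) i i =
      (M.updateCol i fun j => derivative (M j i)).det := by
    intro i
    rw [← Matrix.cramer_apply, Matrix.cramer_eq_adjugate_mulVec]
    rfl
  simp only [Matrix.trace, Matrix.diag_apply, h1]
  simp only [Matrix.det_apply', map_sum]
  rw [Finset.sum_comm]
  refine Finset.sum_congr rfl fun σ _ => ?_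
  rw [← Finset.mul_sum, ← Polynomial.C_eq_intCast, derivative_C_mul, derivative_prod_finset]
  congr 1
  refine Finset.sum_congr rfl fun i _ => ?_
  rw [← Finset.prod_erase_mul _ _ (Finset.mem_univ i)]
  congr 1
  · refine Finset.prod_congr rfl fun j hj => ?_
    rw [Matrix.updateCol_ne (Finset.ne_of_mem_erase hj)]
  · rw [Matrix.updateCol_self]

theorem eq_C_of_derivative_eq_zero [Algebra ℚ A] {f : A[X]} (h : derivative f = 0) :
    f = C (f.coeff 0) := by
  ext (_ | i)
  · simp
  · rw [coeff_C_succ]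
    have h1 : (derivative f).coeff i = 0 := by rw [h, coeff_zero]
    rw [coeff_derivative] at h1
    have hu : IsUnit ((i : A) + 1) := by
      simpa using isUnit_intCast (A := A) (c := (i : ℤ) + 1) (by omega)
    exact (hu.mul_left_eq_zero).1 h1

variable [Algebra ℚ A]

theorem trace_matLog {N : Matrix ι ι A} {Y : Matrix ι ι A} (hY : Y - 1 = N) {k : ℕ}
    (hk : N ^ k = 0) :
    (matLog Y).trace = ∑ i ∈ Finset.range k, ((-1 : ℚ) ^ i / ((i + 1 : ℕ) : ℚ)) •
      (N ^ (i + 1)).trace := by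
  rw [matLog, hY]
  have h1 : N ^ nilpotencyClass N = 0 := pow_nilpotencyClass ⟨k, hk⟩
  have h2 : nilpotencyClass N ≤ k + 1 := (csInf_le' (s := {k | N ^ k = 0}) hk : _ ≤ k).trans (Nat.le_succ k)
  have h3 : ∑ i ∈ Finset.Ico 1 (nilpotencyClass N), ((-1 : ℚ) ^ (i - 1) / (i : ℚ)) • N ^ i =
      ∑ i ∈ Finset.Ico 1 (k + 1), ((-1 : ℚ) ^ (i - 1) / (i : ℚ)) • N ^ i := by
    refine Finset.sum_subset (Finset.Ico_subset_Ico le_rfl h2) fun i hi hi' => ?_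
    rw [pow_eq_zero_of_le _ h1, smul_zero]
    simp only [Finset.mem_Ico, not_and, not_lt] at hi hi'
    exact hi' hi.1
  rw [h3, Finset.sum_Ico_eq_sum_range, Matrix.trace_sum, Nat.add_sub_cancel]
  refine Finset.sum_congr rfl fun i _ => ?_
  rw [Matrix.trace_smul, Nat.add_sub_cancel_left, add_comm 1 i]

theorem isNilpotent_trace_matLog {Y : Matrix ι ι A} (h : IsNilpotent (Y - 1)) :
    IsNilpotent (matLog Y).trace := by
  obtain ⟨k, hk⟩ := h
  rw [trace_matLog rfl hk]
  refine isNilpotent_sum fun i _ => ?_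
  refine IsNilpotent.smul (Matrix.isNilpotent_trace_of_isNilpotent ?_) _
  exact IsNilpotent.pow_succ _ ⟨k, hk⟩

/-- Interpolate along `1 + X N`, `N = Y - 1`: its determinant `D` and `l`, the trace of its
logarithm, satisfy `D' = D l'`, so `D exp(-l)` is constant. Comparing `X = 0` with `X = 1` gives the
claim. -/
theorem exp_trace_matLog {Y : Matrix ι ι A} (h : IsNilpotent (Y - 1)) :
    IsNilpotent.exp (matLog Y).trace = Y.det := by
  obtain ⟨k, hk⟩ := h
  set N := Y - 1 with hN
  have hY : Y = 1 + N := by rw [hN]; abel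
  set M : Matrix ι ι A[X] := N.map C with hM
  have hMpow : ∀ i, M ^ i = (N ^ i).map C := fun i => (map_pow (C (R := A)).mapMatrix N i).symm
  have hMtr : ∀ i, (M ^ i).trace = C (N ^ i).trace := fun i => by
    rw [hMpow]; exact (AddMonoidHom.map_trace (C (R := A)).toAddMonoidHom (N ^ i)).symm
  have hMk : M ^ k = 0 := by rw [hMpow, hk]; ext; simp
  set D : A[X] := (1 + (X : A[X]) • M).det with hD
  set l : A[X] := ∑ i ∈ Finset.range k, ((-1 : ℚ) ^ i / ((i + 1 : ℕ) : ℚ)) •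
    (X ^ (i + 1) * C (N ^ (i + 1)).trace) with hl
  set G : Matrix ι ι A[X] := ∑ i ∈ Finset.range k, (-((X : A[X]) • M)) ^ i with hG
  have hlnil : IsNilpotent l := by
    refine isNilpotent_sum fun i _ => IsNilpotent.smul ?_ _
    refine (Commute.all _ _).isNilpotent_mul_left ?_
    exact IsNilpotent.map (Matrix.isNilpotent_trace_of_isNilpotent
      (IsNilpotent.pow_succ _ ⟨k, hk⟩)) C
  -- The finite geometric series inverts `1 + X N`; the adjugate in Jacobi's formula thereby becomes
  -- `D` times that series.
  have hinv : (1 + (X : A[X]) • M) * G = 1 := by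
    have h1 := mul_neg_geom_sum (-((X : A[X]) • M)) k
    rw [sub_neg_eq_add] at h1
    rw [hG, h1, ← neg_one_smul A[X], smul_smul, _root_.smul_pow, hMk, smul_zero, sub_zero]
  have hadj : (1 + (X : A[X]) • M).adjugate = D • G := by
    calc _ = (1 + (X : A[X]) • M).adjugate * ((1 + (X : A[X]) • M) * G) := by
          rw [hinv, mul_one]
      _ = _ := by rw [← mul_assoc, Matrix.adjugate_mul, Matrix.smul_mul, one_mul]
  have hder : (1 + (X : A[X]) • M).map derivative = M := by
    ext1 i j
    simp only [Matrix.map_apply, Matrix.add_apply, Matrix.smul_apply, smul_eq_mul, map_add,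
      derivative_mul, derivative_X, one_mul, hM, derivative_C, mul_zero, add_zero]
    rw [Matrix.one_apply]
    split_ifs <;> simp
  have hD' : derivative D = D * derivative l := by
    rw [hD, derivative_det, hadj, hder, Matrix.smul_mul, Matrix.trace_smul, smul_eq_mul, ← hD]
    congr 1
    rw [hG, Finset.sum_mul, Matrix.trace_sum, hl, map_sum]
    refine Finset.sum_congr rfl fun i _ => ?_
    rw [← neg_one_smul A[X], smul_smul, _root_.smul_pow, Matrix.smul_mul, ← pow_succ,
      Matrix.trace_smul, hMtr, derivative_smul, derivative_mul, derivative_C, mul_zero, add_zero,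
      derivative_X_pow, Nat.add_sub_cancel, smul_eq_mul, neg_one_mul, neg_pow]
    have h2 : C ((i + 1 : ℕ) : A) = algebraMap ℚ A[X] ((i + 1 : ℕ) : ℚ) := by simp
    have h3 : ((-1 : A[X])) ^ i = algebraMap ℚ A[X] ((-1) ^ i) := by simp
    rw [h2, h3, Algebra.smul_def, ← mul_assoc, ← mul_assoc, ← map_mul, div_mul_cancel₀]
    exact_mod_cast Nat.succ_ne_zero i
  have hE : derivative (D * IsNilpotent.exp (-l)) = 0 := by
    have h1 := derivation_exp ((derivative' (R := A)).restrictScalars ℚ) hlnil.neg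
    have h2 : derivative (IsNilpotent.exp (-l)) = IsNilpotent.exp (-l) * derivative (-l) := h1
    rw [derivative_mul, h2, hD', derivative_neg]
    ring
  have hconst := eq_C_of_derivative_eq_zero hE
  have heval : ∀ x : A, D.eval x * IsNilpotent.exp (-(l.eval x)) =
      (D * IsNilpotent.exp (-l)).coeff 0 := by
    intro x
    have h1 := congrArg (evalRingHom x) hconst
    rw [map_mul, IsNilpotent.map_exp hlnil.neg, map_neg] at h1
    simpa using h1
  have hDx : ∀ x : A, D.eval x = (1 + x • N).det := by
    intro x
    rw [← coe_evalRingHom, hD, RingHom.map_det]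
    congr 1
    ext i j
    simp [hM, Matrix.one_apply, apply_ite, mul_comm x]
  have h0 := heval 0
  have h1 := heval 1
  rw [← h0, hDx, hDx] at h1
  have hl0 : l.eval 0 = 0 := by simp [hl, eval_finsetSum]
  have hl1 : l.eval 1 = (matLog Y).trace := by
    rw [trace_matLog hN.symm hk, hl, eval_finsetSum]
    exact Finset.sum_congr rfl fun i _ => by simp [eval_smul]
  rw [hl0, hl1, neg_zero, IsNilpotent.exp_zero, mul_one, zero_smul, add_zero, Matrix.det_one,
    one_smul, ← hY] at h1
  calc _ = (Y.det * IsNilpotent.exp (-(matLog Y).trace)) * IsNilpotent.exp (matLog Y).trace := by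
        rw [h1, one_mul]
    _ = _ := by
        rw [mul_assoc, IsNilpotent.exp_neg_mul_exp_self (isNilpotent_trace_matLog ⟨k, hk⟩),
          mul_one]

end DetDerivative

/-! ### Weierstrass preparation over a ring with a nilpotent ideal. -/

section WeierstrassNilpotent

variable {A : Type*} [CommRing A] {𝔫 : Ideal A} {K n : ℕ}

/-- Deletion of the terms of degree less than `n`, followed by division by `X ^ n`. -/
def dropCoeffs (n : ℕ) : PowerSeries A →ₗ[A] PowerSeries A where
  toFun f := PowerSeries.mk fun i => PowerSeries.coeff (i + n) f
  map_add' f g := by ext; simp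
  map_smul' r f := by ext; simp

theorem coeff_dropCoeffs (n i : ℕ) (f : PowerSeries A) :
    PowerSeries.coeff i (dropCoeffs n f) = PowerSeries.coeff (i + n) f := by
  simp [dropCoeffs]

theorem dropCoeffs_X_pow_mul (n : ℕ) (f : PowerSeries A) :
    dropCoeffs n (PowerSeries.X ^ n * f) = f := by
  ext i; rw [coeff_dropCoeffs, PowerSeries.coeff_X_pow_mul]

theorem eq_trunc_add_dropCoeffs (n : ℕ) (f : PowerSeries A) :
    f = ((PowerSeries.trunc n f : A[X]) : PowerSeries A) + PowerSeries.X ^ n * dropCoeffs n f := by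
  ext i
  rw [map_add, Polynomial.coeff_coe, PowerSeries.coeff_trunc, PowerSeries.coeff_X_pow_mul']
  by_cases h : i < n
  · simp [h, not_le.2 h]
  · rw [if_neg h, if_pos (not_lt.1 h), coeff_dropCoeffs, Nat.sub_add_cancel (not_lt.1 h), zero_add]

theorem coeff_mul_mem_pow {I J : Ideal A} {f g : PowerSeries A}
    (hf : ∀ i, PowerSeries.coeff i f ∈ I) (hg : ∀ i, PowerSeries.coeff i g ∈ J) (i : ℕ) :
    PowerSeries.coeff i (f * g) ∈ I * J := by
  rw [PowerSeries.coeff_mul]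
  exact Ideal.sum_mem _ fun x _ => Ideal.mul_mem_mul (hf _) (hg _)

/-- Weierstrass division. With `f = ν + X ^ n u`, where `u` is a unit and `ν` has coefficients in
`𝔫`, the map is `u (1 + L)`. Each application of `L` gains a factor from `𝔫`, so `L` is nilpotent.
-/
theorem bijective_dropCoeffs_mul (h𝔫 : 𝔫 ^ K = ⊥) {f : PowerSeries A}
    (hlow : ∀ i < n, PowerSeries.coeff i f ∈ 𝔫) (hn : IsUnit (PowerSeries.coeff n f)) :
    Function.Bijective fun φ => dropCoeffs n (f * φ) := by
  set u := dropCoeffs n f with hu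
  obtain ⟨v, hv⟩ : IsUnit u := by
    rw [PowerSeries.isUnit_iff_constantCoeff, ← PowerSeries.coeff_zero_eq_constantCoeff_apply, hu,
      coeff_dropCoeffs, zero_add]
    exact hn
  set ν : PowerSeries A := ((PowerSeries.trunc n f : A[X]) : PowerSeries A) with hν
  have hνmem : ∀ i, PowerSeries.coeff i ν ∈ 𝔫 := by
    intro i
    rw [hν, Polynomial.coeff_coe, PowerSeries.coeff_trunc]
    split_ifs with h
    · exact hlow i h
    · exact zero_mem _
  let L : Module.End A (PowerSeries A) :=
    LinearMap.mulLeft A (v⁻¹ : (PowerSeries A)ˣ).1 ∘ₗ dropCoeffs n ∘ₗ LinearMap.mulLeft A ν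
  have hL : ∀ (j : ℕ) (φ : PowerSeries A) (i : ℕ), PowerSeries.coeff i ((L ^ j) φ) ∈ 𝔫 ^ j := by
    intro j
    induction j with
    | zero => simp
    | succ j ih =>
      intro φ i
      have h0 : (L ^ (j + 1)) φ = L ((L ^ j) φ) := by rw [pow_succ', Module.End.mul_apply]
      rw [h0]
      have h1 : ∀ i, PowerSeries.coeff i (dropCoeffs n (ν * (L ^ j) φ)) ∈ 𝔫 ^ (j + 1) := by
        intro i
        rw [coeff_dropCoeffs, pow_succ']
        exact coeff_mul_mem_pow hνmem (ih φ) _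
      have h2 := coeff_mul_mem_pow (I := ⊤) (f := (v⁻¹ : (PowerSeries A)ˣ).1)
        (fun _ => Submodule.mem_top) h1 i
      rw [Ideal.top_mul] at h2
      exact h2
  have hnil : IsNilpotent L := by
    refine ⟨K, LinearMap.ext fun φ => PowerSeries.ext fun i => ?_⟩
    have := hL K φ i
    rw [h𝔫, Ideal.mem_bot] at this
    simpa using this
  have hunit : IsUnit (1 + L) := hnil.isUnit_one_add
  have hbij : Function.Bijective ⇑(1 + L) := (Module.End.isUnit_iff _).1 hunit
  have heq : (fun φ => dropCoeffs n (f * φ)) = (fun φ => v.1 * φ) ∘ ⇑(1 + L) := by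
    funext φ
    have h1 : f = ν + PowerSeries.X ^ n * u := eq_trunc_add_dropCoeffs n f
    simp only [Function.comp_apply, LinearMap.add_apply, Module.End.one_apply, mul_add]
    conv_lhs => rw [h1, add_mul, map_add, mul_assoc, dropCoeffs_X_pow_mul]
    change _ = _ + v.1 * ((v⁻¹ : (PowerSeries A)ˣ).1 * _)
    rw [← mul_assoc, Units.mul_inv, one_mul, hv, add_comm]
    rfl
  rw [heq]
  refine Function.Bijective.comp ?_ hbij
  exact v.mulLeft_bijective

/-- A monic polynomial of degree `n` with lower coefficients in `𝔫`. -/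
structure Distinguished (𝔫 : Ideal A) (n : ℕ) (P : A[X]) : Prop where
  natDegree_le : P.natDegree ≤ n
  coeff_top : P.coeff n = 1
  coeff_mem : ∀ i < n, P.coeff i ∈ 𝔫

theorem Distinguished.map {A' : Type*} [CommRing A'] (f : A →+* A') {𝔫' : Ideal A'}
    (h : 𝔫 ≤ 𝔫'.comap f) {P : A[X]} (hP : Distinguished 𝔫 n P) :
    Distinguished 𝔫' n (P.map f) where
  natDegree_le := natDegree_map_le.trans hP.natDegree_le
  coeff_top := by rw [coeff_map, hP.coeff_top, map_one]
  coeff_mem i hi := by rw [coeff_map]; exact h (hP.coeff_mem i hi)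

theorem Distinguished.bijective (h𝔫 : 𝔫 ^ K = ⊥) {P : A[X]} (hP : Distinguished 𝔫 n P) :
    Function.Bijective fun φ => dropCoeffs n ((P : PowerSeries A) * φ) :=
  bijective_dropCoeffs_mul h𝔫 (fun i hi => by rw [Polynomial.coeff_coe]; exact hP.coeff_mem i hi)
    (by rw [Polynomial.coeff_coe, hP.coeff_top]; exact isUnit_one)

theorem dropCoeffs_coe_eq_zero {P : A[X]} (h : ∀ i, n ≤ i → P.coeff i = 0) :
    dropCoeffs n (P : PowerSeries A) = 0 := by
  ext i
  rw [coeff_dropCoeffs, Polynomial.coeff_coe, h _ (Nat.le_add_left _ _), map_zero]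

theorem Distinguished.mul_cancel (h𝔫 : 𝔫 ^ K = ⊥) {P : A[X]} (hP : Distinguished 𝔫 n P)
    {φ ψ : PowerSeries A} (h : (P : PowerSeries A) * φ = P * ψ) : φ = ψ :=
  (hP.bijective h𝔫).1 (congrArg (dropCoeffs n) h)

/-- `P (u - 1) = Q - P` has degree less than `n`, so injectivity in Weierstrass division gives `u =
1`. -/
theorem Distinguished.eq_of_mul_eq (h𝔫 : 𝔫 ^ K = ⊥) {P Q : A[X]} (hP : Distinguished 𝔫 n P)
    (hQ : Distinguished 𝔫 n Q) {u : PowerSeries A} (h : (Q : PowerSeries A) = P * u) :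
    Q = P ∧ u = 1 := by
  have h1 : dropCoeffs n ((P : PowerSeries A) * (u - 1)) = 0 := by
    rw [mul_sub, mul_one, ← h, ← Polynomial.coe_sub]
    refine dropCoeffs_coe_eq_zero fun i hi => ?_
    rw [coeff_sub]
    rcases hi.eq_or_lt with rfl | hi
    · rw [hP.coeff_top, hQ.coeff_top, sub_self]
    · rw [coeff_eq_zero_of_natDegree_lt (hP.natDegree_le.trans_lt hi),
        coeff_eq_zero_of_natDegree_lt (hQ.natDegree_le.trans_lt hi), sub_zero]
  have h2 : u - 1 = 0 := (hP.bijective h𝔫).1 (by simpa using h1)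
  have h3 : u = 1 := sub_eq_zero.1 h2
  exact ⟨by rw [h3, mul_one] at h; exact Polynomial.coe_injective A h, h3⟩

theorem Distinguished.unique (h𝔫 : 𝔫 ^ K = ⊥) {P Q : A[X]} (hP : Distinguished 𝔫 n P)
    (hQ : Distinguished 𝔫 n Q) {u v : PowerSeries A} (hv : IsUnit v)
    (h : (P : PowerSeries A) * u = Q * v) : Q = P ∧ u = v := by
  obtain ⟨v, rfl⟩ := hv
  have h1 : (Q : PowerSeries A) = P * (u * (v⁻¹ : (PowerSeries A)ˣ).1) := by
    rw [← mul_assoc, h, mul_assoc, Units.mul_inv, mul_one]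
  obtain ⟨h2, h3⟩ := hP.eq_of_mul_eq h𝔫 hQ h1
  exact ⟨h2, by rw [Units.mul_inv_eq_one] at h3; exact h3⟩

theorem isUnit_of_map_mk {B : Type*} [CommRing B] {I : Ideal B} (hI : ∀ x ∈ I, IsNilpotent x)
    {x y : B} (hy : IsUnit y) (h : x - y ∈ I) : IsUnit x := by
  have := (hI _ h).isUnit_add_left_of_commute hy (Commute.all _ _)
  simpa using this

theorem exists_distinguished_factorization (h𝔫 : 𝔫 ^ K = ⊥) {f : PowerSeries A}
    (hlow : ∀ i < n, PowerSeries.coeff i f ∈ 𝔫) (hn : IsUnit (PowerSeries.coeff n f)) :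
    ∃ (P : A[X]) (h : PowerSeries A), Distinguished 𝔫 n P ∧ IsUnit h ∧ f = P * h := by
  -- The inverse of the sought unit: `f φ` equals `X ^ n` plus terms of degree less than `n`.
  obtain ⟨φ, hφ⟩ := (bijective_dropCoeffs_mul h𝔫 hlow hn).2 1
  have hφ' : dropCoeffs n (f * φ) = 1 := hφ
  have hmul := eq_trunc_add_dropCoeffs n (f * φ)
  rw [hφ', mul_one] at hmul
  set P : A[X] := PowerSeries.trunc n (f * φ) + X ^ n with hP
  have hPc : (P : PowerSeries A) = f * φ := by rw [hmul, hP]; simp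
  have hlowP : ∀ i < n, PowerSeries.coeff i (f * φ) ∈ 𝔫 := by
    intro i hi
    rw [PowerSeries.coeff_mul]
    refine Ideal.sum_mem _ fun x hx => Ideal.mul_mem_right _ _ (hlow _ ?_)
    have := Finset.HasAntidiagonal.mem_antidiagonal.1 hx
    omega
  have hdist : Distinguished 𝔫 n P := by
    refine ⟨?_, ?_, ?_⟩
    · rw [natDegree_le_iff_coeff_eq_zero]
      intro i hi
      simp [hP, PowerSeries.coeff_trunc, not_lt.2 hi.le, coeff_X_pow, hi.ne']
    · simp [hP, PowerSeries.coeff_trunc]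
    · intro i hi
      rw [← Polynomial.coeff_coe, hPc]
      exact hlowP i hi
  have hφu : IsUnit φ := by
    rw [PowerSeries.isUnit_iff_constantCoeff, ← PowerSeries.coeff_zero_eq_constantCoeff_apply]
    have h1 : PowerSeries.coeff n (f * φ) = 1 := by
      rw [← hPc, Polynomial.coeff_coe, hdist.coeff_top]
    have h0 : (n, 0) ∈ Finset.HasAntidiagonal.antidiagonal n := by simp
    rw [PowerSeries.coeff_mul, ← Finset.add_sum_erase _ _ h0] at h1
    refine isUnit_of_mul_isUnit_right (x := PowerSeries.coeff n f) ?_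
    refine isUnit_of_map_mk (I := 𝔫) (fun x hx => ⟨K, ?_⟩) isUnit_one ?_
    · have := Ideal.pow_mem_pow hx K
      rwa [h𝔫, Ideal.mem_bot] at this
    · rw [← h1, sub_add_cancel_left]
      refine neg_mem (Ideal.sum_mem _ fun x hx => Ideal.mul_mem_right _ _ (hlow _ ?_))
      obtain ⟨hne, hx⟩ := Finset.mem_erase.1 hx
      have h2 := Finset.HasAntidiagonal.mem_antidiagonal.1 hx
      by_contra h3
      refine hne (Prod.ext ?_ ?_) <;> simp only <;> omega
  obtain ⟨φ, rfl⟩ := hφu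
  exact ⟨P, (φ⁻¹ : (PowerSeries A)ˣ).1, hdist, Units.isUnit _, by
    rw [hPc, mul_assoc, Units.mul_inv, mul_one]⟩

/-- A distinguished polynomial divides a power of `X`. -/
theorem Distinguished.dvd_X_pow (h𝔫 : 𝔫 ^ K = ⊥) {P : A[X]} (hP : Distinguished 𝔫 n P) :
    P ∣ X ^ (n * K) := by
  have h1 : X ^ n - P ∈ 𝔫.map C := by
    rw [Ideal.mem_map_C_iff]
    intro i
    rw [coeff_sub, coeff_X_pow]
    rcases lt_trichotomy i n with hi | rfl | hi
    · rw [if_neg hi.ne, zero_sub]; exact neg_mem (hP.coeff_mem i hi)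
    · rw [if_pos rfl, hP.coeff_top, sub_self]; exact zero_mem _
    · rw [if_neg hi.ne', coeff_eq_zero_of_natDegree_lt (hP.natDegree_le.trans_lt hi), sub_zero]
      exact zero_mem _
  -- `P = X ^ n - (X ^ n - P)` divides the difference of the `K`-th powers, and the second power is
  -- zero.
  have h2 : (X ^ n - P) ^ K = 0 := by
    have := Ideal.pow_mem_pow h1 K
    rwa [← Ideal.map_pow, h𝔫, Ideal.map_bot, Ideal.mem_bot] at this
  have h3 := sub_dvd_pow_sub_pow (X ^ n) (X ^ n - P) K
  rwa [h2, sub_zero, sub_sub_cancel, ← pow_mul] at h3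

end WeierstrassNilpotent

/-! ### Decay of solutions and the cross relation. -/

section IntervalDeterminants

variable {S : Type*} [CommRing S]

/-- The determinant of the finite section with rows and columns in `{a, …, b}`. -/
def idet (B : Matrix ℤ ℤ S) (a b : ℤ) : S := (sect B a b).det

theorem map_idet {S' : Type*} [CommRing S'] (f : S →+* S') (B : Matrix ℤ ℤ S) (a b : ℤ) :
    f (idet B a b) = idet (B.map f) a b := by
  rw [idet, RingHom.map_det]; rfl

theorem sect_mulVec (B : Matrix ℤ ℤ S) (a b : ℤ) (v : ℤ → S) (i : Finset.Icc a b) :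
    (sect B a b).mulVec (fun j => v j) i = ∑ j ∈ Finset.Icc a b, B i j * v j := by
  rw [← Finset.sum_coe_sort]; rfl

/-- The last column of the inverse, extended by zero so that it can be tested against longer
sections. -/
theorem exists_solution {B : Matrix ℤ ℤ S} {a b : ℤ} (h : IsUnit (idet B a b)) :
    ∃ v : ℤ → S, (∀ i ∉ Finset.Icc a b, v i = 0) ∧ ∀ i ∈ Finset.Icc a b,
      ∑ j ∈ Finset.Icc a b, B i j * v j = if i = b then 1 else 0 := by
  set w := (sect B a b)⁻¹.mulVec fun i => if (i : ℤ) = b then 1 else 0 with hw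
  refine ⟨fun i => if h : i ∈ Finset.Icc a b then w ⟨i, h⟩ else 0, fun i hi => dif_neg hi,
    fun i hi => ?_⟩
  have h1 := sect_mulVec B a b (fun i => if h : i ∈ Finset.Icc a b then w ⟨i, h⟩ else 0) ⟨i, hi⟩
  rw [← h1]
  have h2 : (fun j : Finset.Icc a b => if h : (j : ℤ) ∈ Finset.Icc a b then w ⟨j, h⟩ else 0) = w := by
    funext j; simp only [dif_pos j.2]
  rw [h2, hw, Matrix.mulVec_mulVec, Matrix.mul_nonsing_inv _ h, Matrix.one_mulVec]

/-- Cramer's rule for the last coordinate: replacing the last column by the last basis vector leaves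
the determinant of the section shortened by one. -/
theorem idet_mul_solution {B : Matrix ℤ ℤ S} {a b : ℤ} (hab : a ≤ b) {v : ℤ → S}
    (hv : ∀ i ∈ Finset.Icc a b, ∑ j ∈ Finset.Icc a b, B i j * v j = if i = b then 1 else 0) :
    idet B a b * v b = idet B a (b - 1) := by
  have hb : b ∈ Finset.Icc a b := Finset.mem_Icc.2 ⟨hab, le_rfl⟩
  set M := sect B a b with hM
  set e : Finset.Icc a b → S := fun i => if (i : ℤ) = b then 1 else 0 with he
  have h1 : M.mulVec (fun j => v j) = e := by
    funext i; rw [hM, sect_mulVec, hv i i.2]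
  have h2 : M.det * v b = (M.updateCol ⟨b, hb⟩ e).det := by
    rw [← Matrix.cramer_apply, ← h1, Matrix.cramer_eq_adjugate_mulVec, Matrix.mulVec_mulVec,
      Matrix.adjugate_mul, Matrix.smul_mulVec, Matrix.one_mulVec]
    rfl
  rw [idet, ← hM, h2, Matrix.twoBlockTriangular_det _ (fun i : Finset.Icc a b => (i : ℤ) = b)]
  · have h3 : ((M.updateCol ⟨b, hb⟩ e).toSquareBlockProp fun i : Finset.Icc a b => (i : ℤ) = b).det = 1 := by
      have : Unique {i : Finset.Icc a b // (i : ℤ) = b} :=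
        ⟨⟨⟨⟨b, hb⟩, rfl⟩⟩, fun x => Subtype.ext (Subtype.ext x.2)⟩
      rw [Matrix.det_unique]
      have h4 := (default : {i : Finset.Icc a b // (i : ℤ) = b}).2
      have h5 : (default : {i : Finset.Icc a b // (i : ℤ) = b}).1 = ⟨b, hb⟩ := Subtype.ext h4
      simp [Matrix.toSquareBlockProp, h5, he]
    rw [h3, one_mul]
    let σ : Finset.Icc a (b - 1) ≃ {i : Finset.Icc a b // ¬ (i : ℤ) = b} :=
      { toFun := fun i => ⟨⟨i, by have := Finset.mem_Icc.1 i.2; exact Finset.mem_Icc.2 (by omega)⟩,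
          by have := Finset.mem_Icc.1 i.2; simp only; omega⟩
        invFun := fun i => ⟨i.1, by
          have := Finset.mem_Icc.1 i.1.2; have := i.2; exact Finset.mem_Icc.2 (by omega)⟩
        left_inv := fun _ => rfl
        right_inv := fun _ => rfl }
    rw [← Matrix.det_submatrix_equiv_self σ, idet]
    congr 1
    ext i j
    exact Matrix.updateCol_ne fun h => (σ j).2 (congrArg Subtype.val h)
  · intro i hi j hj
    have h5 : j = ⟨b, hb⟩ := Subtype.ext hj
    rw [h5, Matrix.updateCol_self, he]
    exact if_neg hi

/-- A banded matrix `B` whose entries above the diagonal lie in the ideal `𝔑`. -/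
structure UpperSmall (𝔑 : Ideal S) (m : ℕ) (B : Matrix ℤ ℤ S) : Prop where
  band : ∀ i j : ℤ, (m : ℤ) < j - i → B i j = 0
  upper : ∀ i j : ℤ, i < j → B i j ∈ 𝔑
  isUnit_diag : ∀ i, IsUnit (B i i)

/-- In row `i ≠ b` the diagonal term is minus the sum of the others. The terms right of the diagonal
carry a factor from `𝔑` and involve only `v j` with `j ≤ i + m`, which are already in `𝔑 ^ t`. The
terms left of it are handled by an inner induction that climbs from `a`. -/
theorem solution_mem_pow {𝔑 : Ideal S} {m : ℕ} {B : Matrix ℤ ℤ S} (hB : UpperSmall 𝔑 m B)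
    {a b : ℤ} {v : ℤ → S}
    (hv : ∀ i ∈ Finset.Icc a b, ∑ j ∈ Finset.Icc a b, B i j * v j = if i = b then 1 else 0)
    (t : ℕ) : ∀ j ∈ Finset.Icc a b, j + m * t < b + m → v j ∈ 𝔑 ^ t := by
  induction t with
  | zero => simp
  | succ t ih =>
    have key : ∀ k : ℕ, ∀ i ∈ Finset.Icc a b, i < a + k → i + m * (t + 1 : ℕ) < b + m →
        v i ∈ 𝔑 ^ (t + 1) := by
      intro k
      induction k with
      | zero =>
        intro i hi h
        have := Finset.mem_Icc.1 hi
        simp at h; omega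
      | succ k ihk =>
        intro i hi hik hit
        have h1 := hv i hi
        push_cast at hit
        have h0 : (0 : ℤ) ≤ m * t := by positivity
        have hib : i ≠ b := by rintro rfl; nlinarith
        rw [if_neg hib, ← Finset.add_sum_erase _ _ hi] at h1
        have h2 : B i i * v i ∈ 𝔑 ^ (t + 1) := by
          rw [eq_neg_of_add_eq_zero_left h1]
          refine neg_mem (Ideal.sum_mem _ fun j hj => ?_)
          obtain ⟨hji, hj⟩ := Finset.mem_erase.1 hj
          rcases lt_or_gt_of_ne hji with hlt | hgt
          · refine Ideal.mul_mem_left _ _ (ihk j hj ?_ ?_)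
            · push_cast at hik; omega
            · push_cast; linarith
          · by_cases hm : (m : ℤ) < j - i
            · rw [hB.band i j hm, zero_mul]; exact zero_mem _
            · rw [pow_succ']
              refine Ideal.mul_mem_mul (hB.upper i j hgt) (ih j hj ?_)
              linarith
        obtain ⟨u, hu⟩ := hB.isUnit_diag i
        have h3 : v i = (u⁻¹ : Sˣ).1 * (B i i * v i) := by
          rw [← mul_assoc, ← hu, Units.inv_mul, one_mul]
        rw [h3]
        exact Ideal.mul_mem_left _ _ h2
    intro j hj hjt
    have := Finset.mem_Icc.1 hj
    exact key (j - a + 1).toNat j hj (by omega) hjt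

/-- The solution for `[a, b]` also solves the system for `[a - 1, b]`, so its last coordinate is
both Cramer quotients at once. -/
theorem idet_local {𝔑 : Ideal S} {m K : ℕ} (h𝔑 : 𝔑 ^ K = ⊥) {B : Matrix ℤ ℤ S}
    (hB : UpperSmall 𝔑 m B) {a b : ℤ} (hu : IsUnit (idet B a b)) (hab : a ≤ b)
    (h : a + m * K ≤ b) :
    idet B (a - 1) b * idet B a (b - 1) = idet B a b * idet B (a - 1) (b - 1) := by
  obtain ⟨v, hv0, hv⟩ := exists_solution hu
  have h1 := idet_mul_solution hab hv
  have h2 : idet B (a - 1) b * v b = idet B (a - 1) (b - 1) := by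
    refine idet_mul_solution (by omega) fun i hi => ?_
    have hsub : Finset.Icc a b ⊆ Finset.Icc (a - 1) b := Finset.Icc_subset_Icc (by omega) le_rfl
    rw [← Finset.sum_subset hsub fun j _ hj => by rw [hv0 j hj, mul_zero]]
    by_cases hia : i ∈ Finset.Icc a b
    · exact hv i hia
    · rw [Finset.mem_Icc] at hi hia
      rw [if_neg (by omega)]
      refine Finset.sum_eq_zero fun j hj => ?_
      by_cases hm : (m : ℤ) < j - i
      · rw [hB.band i j hm, zero_mul]
      -- Here `j ≤ a - 1 + m`, which is far enough from `b` for `v j` to lie in `𝔑 ^ K = 0`.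
      · have := solution_mem_pow hB hv K j hj (by omega)
        rw [h𝔑, Ideal.mem_bot] at this
        rw [this, mul_zero]
  rw [← h1, ← h2]
  ring

/-- The local relation makes `D (a - 1) b / D a b` independent of `b`; multiplying such quotients
makes `D a b / D e b` independent of `b`. -/
theorem cross_of_local {G : Type*} [CommGroup G] (D : ℤ → ℤ → G) (c : ℤ)
    (hD : ∀ a b, a ≤ b → a + c ≤ b → D (a - 1) b * D a (b - 1) = D a b * D (a - 1) (b - 1))
    {e a a' b b' : ℤ} (hc : 0 ≤ c) (ha : a ≤ e) (ha' : a' ≤ e) (hb : e + c ≤ b + 1)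
    (hb' : e + c ≤ b' + 1) :
    D a b * D a' b' = D a' b * D a b' := by
  have step : ∀ a b, a ≤ e → e + c - 1 ≤ b →
      D (a - 1) b / D a b = D (a - 1) (e + c - 1) / D a (e + c - 1) := by
    intro a b ha hb
    induction b, hb using Int.leInduction with
    | base => rfl
    | succ b hb ih =>
      rw [← ih, div_eq_div_iff_mul_eq_mul]
      have := hD a (b + 1) (by omega) (by omega)
      rw [add_sub_cancel_right] at this
      rw [this, mul_comm]
  have all : ∀ a b, a ≤ e → e + c - 1 ≤ b →
      D a b / D e b = D a (e + c - 1) / D e (e + c - 1) := by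
    intro a b ha hb
    induction a, ha using Int.leInductionDown with
    | base => simp
    | pred a ha ih =>
      rw [← div_mul_div_cancel (D (a - 1) b) (D a b), step a b ha hb, ih, div_mul_div_cancel]
  have h1 := (all a b ha (by omega)).trans (all a b' ha (by omega)).symm
  have h2 := (all a' b ha' (by omega)).trans (all a' b' ha' (by omega)).symm
  have h3 : D a b / D a' b = D a b' / D a' b' := by
    rw [← div_div_div_cancel_right (D a b) (D a' b) (D e b), h1, h2, div_div_div_cancel_right]
  rw [div_eq_div_iff_mul_eq_mul] at h3
  rw [h3, mul_comm]

end IntervalDeterminants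

/-! ### Translation invariant band matrices. -/

section Banded

variable {A : Type*} [CommRing A] {𝔫 : Ideal A} {m n K : ℕ} {l : Fin n → ℤ}
  {B : Matrix ℤ ℤ A[X]}

/-- Translation invariant banded matrices of polynomials that are lower triangular modulo `𝔫` with
prescribed diagonal. -/
structure Banded (𝔫 : Ideal A) (m : ℕ) (l : Fin n → ℤ) (B : Matrix ℤ ℤ A[X]) : Prop where
  band : ∀ i j : ℤ, (m : ℤ) < j - i → B i j = 0
  upper : ∀ i j : ℤ, i < j → B i j ∈ 𝔫.map C
  diag : ∀ i : ℤ, B i i - ∏ s, (X + C ((i - l s : ℤ) : A)) ∈ 𝔫.map C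
  shift : ∀ i j k : ℤ, B (i + k) (j + k) = (B i j).comp (X + C (k : A))

theorem IsAdmissible.banded {I : Ideal A} {q : ℤ → A[X]} (hB : IsAdmissible I m l q B) :
    Banded I m l B where
  band := hB.band
  upper i j hij := by
    by_cases h : (m : ℤ) < j - i
    · rw [hB.band i j h]; exact zero_mem _
    · rw [hB.entry i j (not_lt.1 h)]
      have h1 : q (j - i) ∈ I.map C :=
        Ideal.mem_map_C_iff.2 (hB.upper (j - i) (by omega) (not_lt.1 h))
      have h2 := Ideal.mem_map_of_mem (compRingHom (X + C (j : A))) h1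
      rw [Ideal.map_map] at h2
      have h3 : (compRingHom (X + C (j : A))).comp C = (C : A →+* A[X]) := by ext; simp
      rw [h3] at h2
      exact h2
  diag i := Ideal.mem_map_C_iff.2 (hB.diag i)
  shift i j k := by
    by_cases h : (m : ℤ) < j - i
    · rw [hB.band i j h, hB.band _ _ (by omega), zero_comp]
    · rw [hB.entry i j (not_lt.1 h), hB.entry _ _ (by omega), comp_assoc]
      congr 2
      · ring
      · simp [add_assoc, add_comm]

theorem Banded.map {A' : Type*} [CommRing A'] (f : A →+* A') {𝔫' : Ideal A'}
    (h : 𝔫 ≤ 𝔫'.comap f) (hB : Banded 𝔫 m l B) :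
    Banded 𝔫' m l (B.map (mapRingHom f)) := by
  have hle : ∀ x ∈ 𝔫.map C, mapRingHom f x ∈ 𝔫'.map C := by
    intro x hx
    rw [Ideal.mem_map_C_iff] at hx ⊢
    intro i
    rw [coe_mapRingHom, coeff_map]
    exact h (hx i)
  refine ⟨fun i j hij => ?_, fun i j hij => hle _ (hB.upper i j hij), fun i => ?_,
    fun i j k => ?_⟩
  · rw [Matrix.map_apply, hB.band i j hij, map_zero]
  · have := hle _ (hB.diag i)
    rw [map_sub, map_prod] at this
    simpa using this
  · rw [Matrix.map_apply, Matrix.map_apply, hB.shift]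
    simp [Polynomial.map_comp]

variable (A) in
/-- The product of the diagonal entries of the section over `{a, …, b}` modulo `𝔫`. -/
def diagProd (l : Fin n → ℤ) (a b : ℤ) : A[X] :=
  ∏ i ∈ Finset.Icc a b, ∏ s, (X + C ((i - l s : ℤ) : A))

theorem X_add_mem (c : ℤ) : (X + C (c : A) : A[X]) ∈ linearFactors A := by
  have := X_sub_mem (A := A) (-c)
  simpa using this

theorem diagProd_mem (l : Fin n → ℤ) (a b : ℤ) : diagProd A l a b ∈ linearFactors A :=
  prod_mem fun _ _ => prod_mem fun _ _ => X_add_mem _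

theorem linearFactors_le : linearFactors A ≤ nonZeroDivisors A[X] := by
  rw [linearFactors, Submonoid.closure_le]
  rintro _ ⟨c, rfl⟩
  exact (monic_X_sub_C _).mem_nonZeroDivisors

theorem algebraMap_partialFractions_injective :
    Function.Injective (algebraMap A[X] (PartialFractions A)) :=
  IsLocalization.injective _ linearFactors_le

theorem isNilpotent_of_mem {I : Ideal A} (hI : I ^ K = ⊥) {x : A} (hx : x ∈ I) :
    IsNilpotent x := by
  refine ⟨K, ?_⟩
  have := Ideal.pow_mem_pow hx K
  rwa [hI, Ideal.mem_bot] at this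

theorem map_pow_eq_bot {A' : Type*} [CommRing A'] (f : A →+* A') {I : Ideal A}
    (hI : I ^ K = ⊥) : (I.map f) ^ K = ⊥ := by
  rw [← Ideal.map_pow, hI, Ideal.map_bot]

theorem Banded.idet_sub_diagProd_mem (hB : Banded 𝔫 m l B) (a b : ℤ) :
    idet B a b - diagProd A l a b ∈ 𝔫.map C := by
  rw [← Ideal.Quotient.mk_eq_mk_iff_sub_mem, map_idet, idet, diagProd, map_prod]
  rw [Matrix.det_of_isLowerTriangular]
  · rw [← Finset.prod_coe_sort (Finset.Icc a b)]
    refine Finset.prod_congr rfl fun i _ => ?_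
    exact (Ideal.Quotient.mk_eq_mk_iff_sub_mem _ _).2 (hB.diag i)
  · intro i j hij
    exact Ideal.Quotient.eq_zero_iff_mem.2 (hB.upper i j hij)

/-- The diagonal product is a product of linear factors, hence a unit among partial fractions; the
determinant differs from it by a nilpotent element. -/
theorem Banded.isUnit_idet (hB : Banded 𝔫 m l B) (h𝔫 : 𝔫 ^ K = ⊥) (a b : ℤ) :
    IsUnit (algebraMap A[X] (PartialFractions A) (idet B a b)) := by
  have hnil := map_pow_eq_bot (algebraMap A[X] (PartialFractions A))
    (map_pow_eq_bot (C (R := A)) h𝔫)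
  refine isUnit_of_map_mk (fun x hx => isNilpotent_of_mem hnil hx)
    (IsLocalization.map_units (M := linearFactors A) (PartialFractions A)
      ⟨_, diagProd_mem l a b⟩) ?_
  rw [← map_sub]
  exact Ideal.mem_map_of_mem _ (hB.idet_sub_diagProd_mem a b)

/-- The ratio `det B_{a,b} / det B_{a',b}` does not depend on `b` if `b` is large. -/
theorem Banded.cross (hB : Banded 𝔫 m l B) (h𝔫 : 𝔫 ^ K = ⊥) (e : ℤ) {a a' b b' : ℤ}
    (ha : a ≤ e) (ha' : a' ≤ e) (hb : e + m * K ≤ b + 1) (hb' : e + m * K ≤ b' + 1) :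
    idet B a b * idet B a' b' = idet B a' b * idet B a b' := by
  -- Linear factors are monic, so nothing is lost by passing to partial fractions, where all
  -- determinants form a family in the unit group.
  apply algebraMap_partialFractions_injective
  set ι := algebraMap A[X] (PartialFractions A)
  have hu := hB.isUnit_idet h𝔫
  choose D hD using hu
  have hnil := map_pow_eq_bot ι (map_pow_eq_bot (C (R := A)) h𝔫)
  have hsmall : UpperSmall ((𝔫.map C).map ι) m (B.map ι) := by
    refine ⟨fun i j h => ?_, fun i j h => Ideal.mem_map_of_mem _ (hB.upper i j h), fun i => ?_⟩
    · rw [Matrix.map_apply, hB.band i j h, map_zero]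
    · refine isUnit_of_map_mk (fun x hx => isNilpotent_of_mem hnil hx)
        (IsLocalization.map_units (M := linearFactors A) _ ⟨∏ s, (X + C ((i - l s : ℤ) : A)),
          prod_mem fun s _ => X_add_mem _⟩) ?_
      rw [Matrix.map_apply, ← map_sub]
      exact Ideal.mem_map_of_mem _ (hB.diag i)
  have := cross_of_local D (m * K) (fun a b hab h => ?_) (by positivity) ha ha' hb hb'
  · simpa [hD] using congrArg Units.val this
  · have h1 := idet_local hnil hsmall (a := a) (b := b)
      (by rw [← map_idet]; exact hB.isUnit_idet h𝔫 a b) hab h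
    simp only [← map_idet] at h1
    ext
    simpa [hD] using h1

theorem Banded.idet_shift (hB : Banded 𝔫 m l B) (a b k : ℤ) :
    idet B (a + k) (b + k) = (idet B a b).comp (X + C (k : A)) := by
  rw [← coe_compRingHom_apply, map_idet, idet, idet]
  let σ : Finset.Icc a b ≃ Finset.Icc (a + k) (b + k) :=
    (Equiv.addRight k).subtypeEquiv fun i => by simp
  rw [← Matrix.det_submatrix_equiv_self σ]
  congr 1
  ext1 i j
  exact hB.shift i j k

theorem diagProd_shift (l : Fin n → ℤ) (a b k : ℤ) :
    diagProd A l (a + k) (b + k) = (diagProd A l a b).comp (X + C (k : A)) := by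
  rw [diagProd, diagProd, ← coe_compRingHom_apply, map_prod,
    ← Finset.map_add_right_Icc, Finset.prod_map]
  refine Finset.prod_congr rfl fun i _ => ?_
  rw [map_prod]
  refine Finset.prod_congr rfl fun s _ => ?_
  simp
  ring

theorem coeff_zero_diagProd (l : Fin n → ℤ) (a b : ℤ) :
    (diagProd A l a b).coeff 0 = ∏ i ∈ Finset.Icc a b, ∏ s, ((i - l s : ℤ) : A) := by
  simp [diagProd, coeff_zero_eq_eval_zero, eval_prod]

theorem Banded.isUnit_coeff_zero (hB : Banded 𝔫 m l B) (h𝔫 : 𝔫 ^ K = ⊥) {a b : ℤ}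
    (h : ∀ i ∈ Finset.Icc a b, ∀ s, IsUnit ((i - l s : ℤ) : A)) :
    IsUnit ((idet B a b : A[X]) : PowerSeries A) := by
  rw [PowerSeries.isUnit_iff_constantCoeff, Polynomial.constantCoeff_coe]
  refine isUnit_of_map_mk (fun x hx => isNilpotent_of_mem h𝔫 hx) (y := (diagProd A l a b).coeff 0)
    ?_ ?_
  · rw [coeff_zero_diagProd]
    exact IsUnit.prod_iff.2 fun i hi => IsUnit.prod_iff.2 fun s _ => h i hi s
  · rw [← coeff_sub]
    exact Ideal.mem_map_C_iff.1 (hB.idet_sub_diagProd_mem a b) 0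

end Banded

/-! ### Characteristic `p`: translations by `𝔽_p`, norms and `X ^ p - X`. -/

section ArtinSchreier

variable {A : Type*} [CommRing A] (p : ℕ) [Fact p.Prime]

theorem monic_artinSchreier [Nontrivial A] : (X ^ p - X : A[X]).Monic :=
  monic_X_pow_sub (by rw [degree_X]; exact_mod_cast (Fact.out : p.Prime).one_lt)

theorem natDegree_artinSchreier [Nontrivial A] : (X ^ p - X : A[X]).natDegree = p := by
  rw [natDegree_sub_eq_left_of_natDegree_lt] <;> simp [(Fact.out : p.Prime).one_lt]

theorem coeff_mul_eq_zero_of_le {f g : A[X]} {a b : ℕ} (hf : ∀ t, a < t → f.coeff t = 0)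
    (hg : ∀ t, b ≤ t → g.coeff t = 0) (t : ℕ) (ht : a + b ≤ t) : (f * g).coeff t = 0 := by
  rw [coeff_mul]
  refine Finset.sum_eq_zero fun x hx => ?_
  have := Finset.HasAntidiagonal.mem_antidiagonal.1 hx
  by_cases h : a < x.1
  · rw [hf _ h, zero_mul]
  · rw [hg _ (by omega), mul_zero]

theorem monic_of_comp_artinSchreier [Nontrivial A] {V : A[X]} (hV : (V.comp (X ^ p - X)).Monic) :
    V.Monic ∧ (V.comp (X ^ p - X)).natDegree = V.natDegree * p := by
  have hm : (X ^ p - X : A[X]).Monic := monic_artinSchreier p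
  have hV0 : V ≠ 0 := by rintro rfl; rw [zero_comp] at hV; exact hV.ne_zero rfl
  have h1 : (V.comp (X ^ p - X)).natDegree = V.natDegree * p := by
    rw [natDegree_comp_eq_of_mul_ne_zero, natDegree_artinSchreier]
    rwa [hm.leadingCoeff, one_pow, mul_one, Ne, leadingCoeff_eq_zero]
  refine ⟨?_, h1⟩
  have h2 := coeff_comp_degree_mul_degree (p := V) (q := X ^ p - X)
    (by rw [natDegree_artinSchreier]; exact (Fact.out : p.Prime).ne_zero)
  rw [hm.leadingCoeff, one_pow, mul_one, natDegree_artinSchreier, ← h1, coeff_natDegree,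
    hV.leadingCoeff] at h2
  exact h2.symm

theorem artinSchreier_eq : (X ^ p - X : A[X]) = X * (X ^ (p - 1) - 1) := by
  rw [mul_sub, ← pow_succ', Nat.sub_add_cancel (Fact.out : p.Prime).one_le, mul_one]

/-- `X ^ p - X` is `X` times a polynomial with constant term `-1`, so the lowest coefficient
survives the substitution up to sign. -/
theorem coeff_eq_zero_of_comp_artinSchreier {H : A[X]} {k : ℕ}
    (h : ∀ t < k, (H.comp (X ^ p - X)).coeff t = 0) : ∀ i < k, H.coeff i = 0 := by
  intro i
  induction i using Nat.strong_induction_on with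
  | _ i ih =>
  intro hi
  obtain ⟨H', rfl⟩ := X_pow_dvd_iff.2 fun j hj => ih j hj (hj.trans hi)
  have h1 := h i hi
  rw [mul_comp, pow_comp, X_comp, artinSchreier_eq, mul_pow, mul_assoc, coeff_X_pow_mul', if_pos le_rfl,
    Nat.sub_self, mul_coeff_zero, coeff_zero_eq_eval_zero, coeff_zero_eq_eval_zero] at h1
  have hp : p - 1 ≠ 0 := by have := (Fact.out : p.Prime).two_le; omega
  simp only [eval_pow, eval_sub, eval_X, eval_one, eval_comp, eval_mul, zero_mul, zero_pow hp,
    zero_sub] at h1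
  rw [coeff_X_pow_mul', if_pos le_rfl, Nat.sub_self, coeff_zero_eq_eval_zero]
  have hu : IsUnit ((-1 : A) ^ i) := isUnit_one.neg.pow i
  exact (hu.mul_right_eq_zero).1 h1

theorem artinSchreier_mul_cancel {φ ψ : PowerSeries A} (k : ℕ)
    (h : (((X ^ p - X) ^ k : A[X]) : PowerSeries A) * φ =
      (((X ^ p - X) ^ k : A[X]) : PowerSeries A) * ψ) : φ = ψ := by
  have hp : p - 1 ≠ 0 := by have := (Fact.out : p.Prime).two_le; omega
  have hu : IsUnit (((X ^ (p - 1) - 1) ^ k : A[X]) : PowerSeries A) := by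
    rw [PowerSeries.isUnit_iff_constantCoeff, Polynomial.constantCoeff_coe,
      coeff_zero_eq_eval_zero]
    simpa [zero_pow hp] using isUnit_one.neg.pow k
  rw [artinSchreier_eq, mul_pow, Polynomial.coe_mul, mul_assoc, mul_assoc, Polynomial.coe_pow,
    Polynomial.coe_X] at h
  have h1 := congrArg (dropCoeffs k) h
  rw [dropCoeffs_X_pow_mul, dropCoeffs_X_pow_mul] at h1
  exact hu.mul_left_cancel h1

variable [CharP A p]

/-- The translation `ε ↦ ε + j` for `j ∈ 𝔽_p`. -/
def fpShift (j : ZMod p) : A[X] →+* A[X] :=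
  compRingHom (X + C (ZMod.castHom (dvd_refl p) A j))

theorem fpShift_apply (j : ZMod p) (f : A[X]) :
    fpShift p j f = f.comp (X + C (ZMod.castHom (dvd_refl p) A j)) := rfl

theorem fpShift_fpShift (i j : ZMod p) (f : A[X]) :
    fpShift p i (fpShift p j f) = fpShift p (i + j) f := by
  simp only [fpShift_apply, comp_assoc, map_add]
  simp [add_assoc]

/-- The product of all translates of `f` by elements of `𝔽_p`. -/
def fpNorm (f : A[X]) : A[X] := ∏ j : ZMod p, fpShift p j f

theorem fpNorm_mul (f g : A[X]) : fpNorm p (f * g) = fpNorm p f * fpNorm p g := by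
  simp [fpNorm, Finset.prod_mul_distrib]

theorem fpNorm_prod {ι : Type*} (s : Finset ι) (f : ι → A[X]) :
    fpNorm p (∏ i ∈ s, f i) = ∏ i ∈ s, fpNorm p (f i) := by
  simp only [fpNorm, map_prod]
  exact Finset.prod_comm

theorem fpShift_fpNorm (i : ZMod p) (f : A[X]) : fpShift p i (fpNorm p f) = fpNorm p f := by
  rw [fpNorm, map_prod]
  simp only [fpShift_fpShift]
  exact Fintype.prod_equiv (Equiv.addLeft i) _ _ fun _ => rfl

theorem monic_fpShift {f : A[X]} (hf : f.Monic) (j : ZMod p) : (fpShift p j f).Monic :=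
  hf.comp_X_add_C _

theorem natDegree_fpShift [Nontrivial A] {f : A[X]} (hf : f.Monic) (j : ZMod p) :
    (fpShift p j f).natDegree = f.natDegree := by
  rw [fpShift_apply, natDegree_comp_eq_of_mul_ne_zero] <;> simp [hf.leadingCoeff]

theorem monic_fpNorm {f : A[X]} (hf : f.Monic) : (fpNorm p f).Monic :=
  monic_prod_of_monic _ _ fun j _ => monic_fpShift p hf j

theorem natDegree_fpNorm [Nontrivial A] {f : A[X]} (hf : f.Monic) :
    (fpNorm p f).natDegree = p * f.natDegree := by
  rw [fpNorm, natDegree_prod_of_monic _ _ fun j _ => monic_fpShift p hf j,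
    Finset.sum_congr rfl fun j _ => natDegree_fpShift p hf j]
  simp [ZMod.card]

theorem fpShift_artinSchreier (j : ZMod p) :
    fpShift p j (X ^ p - X : A[X]) = X ^ p - X := by
  rw [fpShift_apply, sub_comp, pow_comp, X_comp, add_pow_char, ← C_pow, ← map_pow,
    ZMod.pow_card]
  ring

theorem fpNorm_linear (c : ℤ) : fpNorm p (X + C (c : A) : A[X]) = X ^ p - X := by
  have h1 : (∏ j : ZMod p, (X - C j) : (ZMod p)[X]) = X ^ p - X := by
    have h2 : (X ^ p - X : (ZMod p)[X]).roots = Finset.univ.val := by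
      have := FiniteField.roots_X_pow_card_sub_X (ZMod p)
      rwa [ZMod.card] at this
    have h3 := prod_multiset_X_sub_C_of_monic_of_roots_card_eq
      (monic_artinSchreier (A := ZMod p) p) (by
        rw [h2, natDegree_artinSchreier]; simp [ZMod.card])
    rw [h2] at h3
    exact h3
  have h4 := congrArg (Polynomial.map (ZMod.castHom (dvd_refl p) A)) h1
  rw [Polynomial.map_prod] at h4
  simp only [Polynomial.map_sub, map_X, map_C, Polynomial.map_pow] at h4
  rw [← h4, fpNorm]
  refine Fintype.prod_equiv ((Equiv.addRight (c : ZMod p)).trans (Equiv.neg _)) _ _ fun j => ?_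
  simp only [fpShift_apply, Equiv.trans_apply, Equiv.coe_addRight, Equiv.neg_apply, map_neg,
    map_add, map_intCast, X_comp]
  ring

/-- The coefficient is a sum over `𝔽_p` of values of a Hasse derivative of degree less than `p - 1`,
and power sums over `𝔽_p` with exponent less than `p - 1` vanish. Summing over translates thus
lowers the degree by `p - 1`. -/
theorem coeff_fpSum_eq_zero {f : A[X]} {i : ℕ}
    (h : f.natDegree < i + (p - 1)) : (∑ j : ZMod p, fpShift p j f).coeff i = 0 := by
  rw [finsetSum_coeff]
  have h1 : ∀ j : ZMod p, (fpShift p j f).coeff i =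
      (hasseDeriv i f).eval (ZMod.castHom (dvd_refl p) A j) := fun j => taylor_coeff _ _ _
  simp only [h1]
  set g := hasseDeriv i f
  have hg : g.natDegree < p - 1 := by
    refine (natDegree_hasseDeriv_le f i).trans_lt ?_
    have := (Fact.out : p.Prime).two_le
    omega
  simp only [eval_eq_sum_range]
  rw [Finset.sum_comm]
  refine Finset.sum_eq_zero fun k hk => ?_
  rw [← Finset.mul_sum]
  simp only [← map_pow, ← map_sum]
  rw [FiniteField.sum_pow_lt_card_sub_one, map_zero, mul_zero]
  rw [ZMod.card]
  have := Finset.mem_range.1 hk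
  omega

/-- The elementary symmetric functions of the translates of `f`. -/
def fpEsymm (f : A[X]) (k : ℕ) : A[X] :=
  MvPolynomial.aeval (fun j : ZMod p => fpShift p j f) (MvPolynomial.esymm (ZMod p) ℤ k)

theorem fpEsymm_mem {I : Ideal A[X]} (hI : ∀ j, ∀ f ∈ I, fpShift p j f ∈ I) {f : A[X]}
    (hf : f ∈ I) (k : ℕ) : fpEsymm p f k ∈ I ^ k := by
  rw [fpEsymm, MvPolynomial.esymm, map_sum]
  refine Ideal.sum_mem _ fun s hs => ?_
  rw [map_prod, ← (Finset.mem_powersetCard.1 hs).2, ← Finset.prod_const]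
  refine Ideal.prod_mem_prod fun j _ => ?_
  rw [MvPolynomial.aeval_X]
  exact hI j f hf

theorem fpNorm_add_eq_sum (g f : A[X]) (hg : ∀ j, fpShift p j g = g) :
    fpNorm p (g + f) = ∑ k ∈ Finset.range (p + 1), fpEsymm p f k * g ^ (p - k) := by
  have h1 := Multiset.prod_X_add_C_eq_sum_esymm
    (Finset.univ.val.map fun j : ZMod p => fpShift p j f)
  have h2 := congrArg (Polynomial.eval g) h1
  rw [Multiset.map_map] at h2
  have h3 : (Multiset.map ((fun r => X + C r) ∘ fun j : ZMod p => fpShift p j f)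
      Finset.univ.val).prod = ∏ j : ZMod p, (X + C (fpShift p j f)) := rfl
  have h3' : Polynomial.eval g (∏ j : ZMod p, (X + C (fpShift p j f))) =
      ∏ j : ZMod p, (g + fpShift p j f) := by simp [eval_prod]
  rw [h3, h3', eval_finsetSum] at h2
  simp only [eval_X, eval_C, eval_mul, eval_pow, Multiset.card_map] at h2
  have h4 : (Finset.univ : Finset (ZMod p)).val.card = p := by
    rw [← Finset.card_def, Finset.card_univ, ZMod.card]
  rw [h4] at h2
  rw [fpNorm]
  simp only [map_add, hg]
  rw [h2]
  refine Finset.sum_congr rfl fun k _ => ?_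
  rw [fpEsymm, MvPolynomial.aeval_esymm_eq_multiset_esymm]

/-- Newton's identities; the power sums of the translates are sums of translates of powers of `f`.
-/
theorem natCast_mul_fpEsymm (f : A[X]) (k : ℕ) :
    (k : A[X]) * fpEsymm p f k = (-1) ^ (k + 1) *
      ∑ a ∈ Finset.HasAntidiagonal.antidiagonal k with a.1 < k,
        (-1) ^ a.1 * fpEsymm p f a.1 * ∑ j : ZMod p, fpShift p j (f ^ a.2) := by
  have h1 := congrArg (MvPolynomial.aeval (fun j : ZMod p => fpShift p j f))
    (MvPolynomial.mul_esymm_eq_sum (ZMod p) ℤ k)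
  simpa [fpEsymm, MvPolynomial.psum, map_sum] using h1

theorem isUnit_natCast_of_lt {k : ℕ} (hk : k ≠ 0) (hkp : k < p) : IsUnit (k : A) := by
  have h : IsUnit (k : ZMod p) := by
    refine IsUnit.mk0 _ fun h => ?_
    rw [ZMod.natCast_eq_zero_iff] at h
    exact absurd (Nat.le_of_dvd (Nat.pos_of_ne_zero hk) h) (not_le.2 hkp)
  simpa using h.map (ZMod.castHom (dvd_refl p) A)

theorem isUnit_intCast_of_not_dvd {c : ℤ} (hc : ¬ (p : ℤ) ∣ c) : IsUnit (c : A) := by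
  have h : IsUnit (c : ZMod p) := by
    refine IsUnit.mk0 _ fun h => hc ?_
    rwa [ZMod.intCast_zmod_eq_zero_iff_dvd] at h
  simpa using h.map (ZMod.castHom (dvd_refl p) A)

theorem fpShift_mem_map_C {𝔫 : Ideal A} (j : ZMod p) {f : A[X]} (hf : f ∈ 𝔫.map C) :
    fpShift p j f ∈ 𝔫.map C := by
  have h2 := Ideal.mem_map_of_mem (fpShift p j) hf
  rw [Ideal.map_map] at h2
  have h3 : (fpShift p j).comp C = (C : A →+* A[X]) := by ext; simp [fpShift_apply]
  rwa [h3] at h2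

/-- The loss of `p - 1` degrees in each power sum compensates the excess allowed by `hdeg`, and
Newton's identities carry this to the symmetric functions. Division by `k` is possible for `k < K ≤
p`; for `k ≥ K` the function lies in `𝔫 ^ k = 0`. -/
theorem coeff_fpEsymm_eq_zero {𝔫 : Ideal A} {K : ℕ} (h𝔫 : 𝔫 ^ K = ⊥) (hK : K ≤ p) {f : A[X]}
    (hf : f ∈ 𝔫.map C) {D : ℕ} (hdeg : ∀ i, 1 ≤ i → (f ^ i).natDegree < i * D + (p - 1))
    (k : ℕ) (hk : 1 ≤ k) : ∀ t, k * D ≤ t → (fpEsymm p f k).coeff t = 0 := by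
  induction k using Nat.strong_induction_on with
  | _ k ih =>
  by_cases hkK : K ≤ k
  · have h1 := fpEsymm_mem p (fun j f hf => fpShift_mem_map_C p j hf) hf k
    have h2 : (𝔫.map (C : A →+* A[X])) ^ k = ⊥ := by
      rw [eq_bot_iff, ← map_pow_eq_bot (C : A →+* A[X]) h𝔫]
      exact Ideal.pow_le_pow_right hkK
    rw [h2, Ideal.mem_bot] at h1
    simp [h1]
  · intro t ht
    have hu : IsUnit (k : A) := isUnit_natCast_of_lt p (by omega) (by omega)
    have h1 := congrArg (fun g => coeff g t) (natCast_mul_fpEsymm p f k)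
    simp only [← C_eq_natCast, coeff_C_mul] at h1
    refine (hu.mul_right_eq_zero).1 (h1.trans ?_)
    have h3 : ((-1 : A[X]) ^ (k + 1)) = C ((-1) ^ (k + 1)) := by simp
    rw [h3, coeff_C_mul, finsetSum_coeff, Finset.sum_eq_zero, mul_zero]
    intro a ha
    obtain ⟨ha1, ha2⟩ := Finset.mem_filter.1 ha
    have ha1 := Finset.HasAntidiagonal.mem_antidiagonal.1 ha1
    have h4 : ((-1 : A[X]) ^ a.1) = C ((-1) ^ a.1) := by simp
    rw [h4, mul_assoc, coeff_C_mul]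
    have h5 : ∀ t, a.1 * D < t → (fpEsymm p f a.1).coeff t = 0 := by
      intro t ht
      rcases Nat.eq_zero_or_pos a.1 with h0 | h0
      · rw [h0, fpEsymm, MvPolynomial.esymm_zero, map_one, coeff_one, if_neg (by omega)]
      · exact ih a.1 ha2 h0 t ht.le
    have h6 : ∀ t, a.2 * D ≤ t → (∑ j : ZMod p, fpShift p j (f ^ a.2)).coeff t = 0 := fun t ht =>
      coeff_fpSum_eq_zero p ((hdeg a.2 (by omega)).trans_le (by omega))
    rw [coeff_mul_eq_zero_of_le h5 h6 t (by rw [← add_mul, ha1]; exact ht), mul_zero]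

/-- If `f` is a small perturbation of `(X ^ p - X) ^ T` then so is its norm. -/
theorem monic_fpNorm_add [Nontrivial A] {𝔫 : Ideal A} {K : ℕ} (h𝔫 : 𝔫 ^ K = ⊥) (hK : K ≤ p)
    {f : A[X]} (hf : f ∈ 𝔫.map C) {T : ℕ}
    (hdeg : ∀ i, 1 ≤ i → (f ^ i).natDegree < i * (p * T) + (p - 1)) :
    (fpNorm p ((X ^ p - X) ^ T + f)).Monic ∧
      (fpNorm p ((X ^ p - X) ^ T + f)).natDegree = p * (p * T) := by
  rw [fpNorm_add_eq_sum p _ f (fun j => by rw [map_pow, fpShift_artinSchreier]),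
    Finset.sum_range_succ', Nat.sub_zero]
  have h0 : fpEsymm p f 0 = 1 := by rw [fpEsymm, MvPolynomial.esymm_zero, map_one]
  rw [h0, one_mul, ← pow_mul]
  set R := ∑ k ∈ Finset.range p, fpEsymm p f (k + 1) * ((X ^ p - X : A[X]) ^ T) ^ (p - (k + 1))
    with hR
  -- The term with the `k`-th symmetric function has degree less than `k p T` plus `(p - k) p T`.
  have hRdeg : ∀ t, p * (p * T) ≤ t → R.coeff t = 0 := by
    intro t ht
    rw [hR, finsetSum_coeff]
    refine Finset.sum_eq_zero fun k hk => ?_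
    have hk := Finset.mem_range.1 hk
    rw [mul_comm]
    refine coeff_mul_eq_zero_of_le (a := (p * T) * (p - (k + 1))) (fun t ht => ?_)
      (coeff_fpEsymm_eq_zero p h𝔫 hK hf hdeg (k + 1) (by omega)) t ?_
    · refine coeff_eq_zero_of_natDegree_lt (natDegree_pow_le.trans_lt ?_)
      rw [((monic_artinSchreier p).natDegree_pow T), natDegree_artinSchreier]
      calc _ = p * T * (p - (k + 1)) := by ring
        _ < t := ht
    · calc p * T * (p - (k + 1)) + (k + 1) * (p * T) = (p - (k + 1) + (k + 1)) * (p * T) := by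
            ring
        _ = p * (p * T) := by rw [Nat.sub_add_cancel hk]
        _ ≤ t := ht
  have hm : ((X ^ p - X : A[X]) ^ (T * p)).Monic := (monic_artinSchreier p).pow _
  have hd : ((X ^ p - X : A[X]) ^ (T * p)).natDegree = p * (p * T) := by
    rw [(monic_artinSchreier p).natDegree_pow, natDegree_artinSchreier]; ring
  have hlt : R.degree < ((X ^ p - X : A[X]) ^ (T * p)).degree := by
    rw [degree_eq_natDegree hm.ne_zero, hd, degree_lt_iff_coeff_zero]
    exact hRdeg
  exact ⟨hm.add_of_right hlt, by rw [natDegree_add_eq_right_of_degree_lt hlt, hd]⟩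

/-- In degree `d - 1`, invariance says that `d` times the leading coefficient is zero, and `d` is
invertible for `0 < d < p`. -/
theorem eq_C_of_fpShift_eq {r : A[X]} (hr : r.natDegree < p) (h : fpShift p 1 r = r) :
    r = C (r.coeff 0) := by
  refine eq_C_of_natDegree_le_zero (not_lt.1 fun hd => ?_)
  set d := r.natDegree with hd'
  have h1 : (fpShift p 1 r).coeff (d - 1) = r.coeff (d - 1) := by rw [h]
  have h2 : (fpShift p 1 r).coeff (d - 1) =
      (hasseDeriv (d - 1) r).eval (ZMod.castHom (dvd_refl p) A 1) := taylor_coeff _ _ _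
  have h3 : (hasseDeriv (d - 1) r).natDegree < 2 :=
    (natDegree_hasseDeriv_le r (d - 1)).trans_lt (by omega)
  rw [h2, map_one, eval_eq_sum_range' h3, Finset.sum_range_succ, Finset.sum_range_one,
    hasseDeriv_coeff, hasseDeriv_coeff, zero_add, Nat.choose_self, Nat.cast_one, one_mul, pow_zero,
    mul_one, one_pow, mul_one, add_eq_left, Nat.add_sub_cancel' hd, Nat.choose_symm hd,
    Nat.choose_one_right] at h1
  have hu : IsUnit (d : A) := isUnit_natCast_of_lt p hd.ne' hr
  have h4 : r.coeff d = 0 := (hu.mul_right_eq_zero).1 h1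
  rw [hd', coeff_natDegree, leadingCoeff_eq_zero] at h4
  rw [hd', h4, natDegree_zero] at hd
  exact lt_irrefl _ hd

/-- Translation invariant polynomials are polynomials in `X ^ p - X`. -/
theorem exists_comp_eq_of_fpShift_eq {f : A[X]} (h : fpShift p 1 f = f) :
    ∃ V : A[X], f = V.comp (X ^ p - X) := by
  nontriviality A
  induction hd : f.natDegree using Nat.strong_induction_on generalizing f with
  | _ d ih =>
  by_cases hdp : d < p
  · exact ⟨C (f.coeff 0), by rw [C_comp]; exact eq_C_of_fpShift_eq p (hd ▸ hdp) h⟩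
  set y : A[X] := X ^ p - X with hy
  have hm : y.Monic := monic_artinSchreier p
  have hyd : y.natDegree = p := natDegree_artinSchreier p
  have hp := (Fact.out : p.Prime).pos
  have hdiv := modByMonic_add_div f y
  have hrdeg : (f %ₘ y).degree < y.degree := degree_modByMonic_lt f hm
  have h1 := congrArg (fpShift p 1) hdiv
  rw [h, map_add, map_mul, hy, fpShift_artinSchreier, ← hy] at h1
  have hrdeg' : (fpShift p 1 (f %ₘ y)).degree < y.degree := by
    have : (fpShift p 1 (f %ₘ y)).degree = (f %ₘ y).degree := degree_taylor _ _
    rwa [this]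
  -- Division by the invariant polynomial `y` is unique, so quotient and remainder are invariant
  -- too.
  obtain ⟨h2, h3⟩ := div_modByMonic_unique _ _ hm ⟨h1, hrdeg'⟩
  have hqd : (f /ₘ y).natDegree < d := by
    rw [natDegree_divByMonic f hm, hyd, hd]; omega
  obtain ⟨V, hV⟩ := ih _ hqd h2.symm rfl
  have hr : (f %ₘ y).natDegree < p := by
    rw [← hyd]
    exact natDegree_modByMonic_lt f hm (fun h => by rw [h, natDegree_one] at hyd; omega)
  refine ⟨C ((f %ₘ y).coeff 0) + X * V, ?_⟩
  rw [add_comp, C_comp, mul_comp, X_comp, ← hV, ← eq_C_of_fpShift_eq p hr h3.symm, hdiv]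

end ArtinSchreier

/-! ### Degrees of determinants, up to terms with nilpotent coefficients. -/

section DegreeFiltration

variable {A : Type*} [CommRing A] {𝔫 : Ideal A} {δ K : ℕ}

/-- Polynomials of degree at most `T`, up to terms of degree at most `T + i * δ` with coefficients
in `𝔫 ^ i`. -/
def DegFilt (𝔫 : Ideal A) (δ : ℕ) (T : ℤ) (f : A[X]) : Prop :=
  ∀ t i : ℕ, T + i * δ < t → f.coeff t ∈ 𝔫 ^ (i + 1)

theorem DegFilt.of_natDegree_le {T : ℤ} {f : A[X]} (h : (f.natDegree : ℤ) ≤ T) :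
    DegFilt 𝔫 δ T f := by
  intro t i hti
  have : (0 : ℤ) ≤ i * δ := by positivity
  rw [coeff_eq_zero_of_natDegree_lt (by omega)]
  exact zero_mem _

theorem DegFilt.of_mem {T : ℤ} {f : A[X]} (hf : f ∈ 𝔫.map C) (h : (f.natDegree : ℤ) ≤ T + δ) :
    DegFilt 𝔫 δ T f := by
  intro t i hti
  rcases Nat.eq_zero_or_pos i with rfl | hi
  · rw [zero_add, pow_one]
    exact Ideal.mem_map_C_iff.1 hf t
  · have h1 : (δ : ℤ) ≤ i * δ := by
      have : (1 : ℤ) ≤ i := by exact_mod_cast hi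
      nlinarith
    rw [coeff_eq_zero_of_natDegree_lt (by omega)]
    exact zero_mem _

theorem DegFilt.add {T : ℤ} {f g : A[X]} (hf : DegFilt 𝔫 δ T f) (hg : DegFilt 𝔫 δ T g) :
    DegFilt 𝔫 δ T (f + g) := fun t i h => by
  rw [coeff_add]; exact add_mem (hf t i h) (hg t i h)

theorem DegFilt.sum {ι : Type*} {s : Finset ι} {T : ℤ} {f : ι → A[X]}
    (hf : ∀ i ∈ s, DegFilt 𝔫 δ T (f i)) : DegFilt 𝔫 δ T (∑ i ∈ s, f i) := fun t i h => by
  rw [finsetSum_coeff]; exact sum_mem fun j hj => hf j hj t i h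

theorem DegFilt.mul {S T : ℤ} {f g : A[X]} (hf : DegFilt 𝔫 δ S f) (hg : DegFilt 𝔫 δ T g) :
    DegFilt 𝔫 δ (S + T) (f * g) := by
  intro u i hu
  rw [coeff_mul]
  refine sum_mem fun x hx => ?_
  have hx := Finset.HasAntidiagonal.mem_antidiagonal.1 hx
  have hxz : (x.1 : ℤ) + x.2 = u := by exact_mod_cast hx
  by_cases h : S + i * δ < x.1
  · exact Ideal.mul_mem_right _ _ (hf _ _ h)
  · have hex : ∃ j : ℕ, (x.1 : ℤ) ≤ S + j * δ := ⟨i, not_lt.1 h⟩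
    classical
    -- The least step `j` reaching `x.1`: the coefficient of `f` supplies `𝔫 ^ j`, that of `g` the
    -- remaining `i - j + 1` factors.
    set j := Nat.find hex with hj
    have hj1 : (x.1 : ℤ) ≤ S + j * δ := Nat.find_spec hex
    have hji : j ≤ i := Nat.find_min' hex (not_lt.1 h)
    have h1 : f.coeff x.1 ∈ 𝔫 ^ j := by
      rcases Nat.eq_zero_or_pos j with h0 | h0
      · rw [h0, pow_zero, Ideal.one_eq_top]; exact Submodule.mem_top
      · have h2 := Nat.find_min hex (m := j - 1) (by omega)
        have := hf x.1 (j - 1) (not_le.1 h2)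
        rwa [Nat.sub_add_cancel h0] at this
    have h2 : g.coeff x.2 ∈ 𝔫 ^ (i - j + 1) := by
      refine hg _ _ ?_
      rw [Nat.cast_sub hji, sub_mul]
      linarith
    have h3 := Ideal.mul_mem_mul h1 h2
    rwa [← pow_add, ← add_assoc, Nat.add_sub_cancel' hji] at h3

theorem DegFilt.prod {ι : Type*} (s : Finset ι) {T : ι → ℤ} {f : ι → A[X]}
    (hf : ∀ i ∈ s, DegFilt 𝔫 δ (T i) (f i)) : DegFilt 𝔫 δ (∑ i ∈ s, T i) (∏ i ∈ s, f i) := by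
  classical
  induction s using Finset.induction_on with
  | empty => simpa using DegFilt.of_natDegree_le (𝔫 := 𝔫) (δ := δ) (f := (1 : A[X])) (T := 0) (by simp)
  | insert a s ha ih =>
    rw [Finset.sum_insert ha, Finset.prod_insert ha]
    exact (hf a (Finset.mem_insert_self a s)).mul
      (ih fun i hi => hf i (Finset.mem_insert_of_mem hi))

theorem DegFilt.pow {T : ℤ} {f : A[X]} (hf : DegFilt 𝔫 δ T f) (i : ℕ) :
    DegFilt 𝔫 δ (i * T) (f ^ i) := by
  have := DegFilt.prod (Finset.range i) (T := fun _ => T) (f := fun _ => f) fun _ _ => hf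
  simpa using this

theorem DegFilt.natDegree_le (h𝔫 : 𝔫 ^ K = ⊥) {T : ℕ} {f : A[X]} (hf : DegFilt 𝔫 δ T f) :
    f.natDegree ≤ T + K * δ := by
  rw [natDegree_le_iff_coeff_eq_zero]
  intro t ht
  have h1 := hf t K (by exact_mod_cast ht)
  have h2 : 𝔫 ^ (K + 1) = ⊥ := by rw [pow_succ, h𝔫, Ideal.bot_mul]
  rwa [h2, Ideal.mem_bot] at h1

variable {m n d : ℕ} {l : Fin n → ℤ} {B : Matrix ℤ ℤ A[X]}

theorem natDegree_prod_X_add_C_le (c : Fin n → A) : (∏ s, (X + C (c s))).natDegree ≤ n := by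
  refine (natDegree_prod_le Finset.univ fun s => X + C (c s)).trans ?_
  refine (Finset.sum_le_card_nsmul _ _ 1 fun s _ => ?_).trans (by simp)
  rw [natDegree_add_C]
  exact natDegree_X_le

/-- The weight `2 d (i - j)` cancels in every term of a determinant. Below the diagonal it dominates
`d (1 + (i - j))` because `i - j ≥ 1`. Above the diagonal it is negative, and the slack `d (1 + 3
m)` covers `d (1 + (j - i)) + 2 d (j - i)` for `j - i ≤ m`. -/
theorem Banded.degFilt_entry (hB : Banded 𝔫 m l B)
    (hd : ∀ i j : ℤ, j - i ≤ m → (B i j).natDegree ≤ d * (1 + (j - i).natAbs)) (i j : ℤ) :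
    DegFilt 𝔫 (d * (1 + 3 * m)) (n + 2 * d * (i - j)) (B i j) := by
  have hd0 : (0 : ℤ) ≤ d := by positivity
  rcases lt_trichotomy i j with hij | rfl | hij
  · by_cases hm : (m : ℤ) < j - i
    · rw [hB.band i j hm]
      intro t i _
      rw [coeff_zero]; exact zero_mem _
    · refine DegFilt.of_mem (hB.upper i j hij) ?_
      have h1 : ((B i j).natDegree : ℤ) ≤ d * (1 + (j - i)) := by
        have := hd i j (not_lt.1 hm)
        zify at this
        rwa [abs_of_pos (by omega)] at this
      push_cast
      nlinarith
  · rw [sub_self, mul_zero, add_zero]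
    have h1 := hB.diag i
    rw [← sub_add_cancel (B i i) (∏ s, (X + C ((i - l s : ℤ) : A)))]
    refine DegFilt.add (DegFilt.of_mem h1 ?_) (DegFilt.of_natDegree_le ?_)
    · have h2 : (B i i).natDegree ≤ d := by
        have := hd i i (by simp)
        simpa using this
      have h3 := natDegree_sub_le (B i i) (∏ s, (X + C ((i - l s : ℤ) : A)))
      have h4 := natDegree_prod_X_add_C_le fun s => ((i - l s : ℤ) : A)
      have h5 : d ≤ d * (1 + 3 * m) := Nat.le_mul_of_pos_right _ (by omega)
      have h6 : (B i i - ∏ s, (X + C ((i - l s : ℤ) : A))).natDegree ≤ n + d * (1 + 3 * m) := by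
        omega
      exact_mod_cast h6
    · exact_mod_cast natDegree_prod_X_add_C_le fun s => ((i - l s : ℤ) : A)
  · refine DegFilt.of_natDegree_le ?_
    have h1 : ((B i j).natDegree : ℤ) ≤ d * (1 + (i - j)) := by
      have := hd i j (by omega)
      zify at this
      rwa [abs_of_neg (by omega), neg_sub] at this
    have : (0 : ℤ) ≤ n := by positivity
    nlinarith

theorem Banded.degFilt_idet (hB : Banded 𝔫 m l B)
    (hd : ∀ i j : ℤ, j - i ≤ m → (B i j).natDegree ≤ d * (1 + (j - i).natAbs)) (a b : ℤ) :
    DegFilt 𝔫 (d * (1 + 3 * m)) ((n * (Finset.Icc a b).card : ℕ) : ℤ) (idet B a b) := by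
  rw [idet, Matrix.det_apply']
  refine DegFilt.sum fun σ _ => ?_
  have h1 := DegFilt.prod Finset.univ fun i _ =>
    hB.degFilt_entry hd ((σ i : Finset.Icc a b) : ℤ) (i : Finset.Icc a b)
  -- The displacements of a permutation sum to zero.
  have h2 : ∑ i : Finset.Icc a b, ((n : ℤ) + 2 * d * ((σ i : ℤ) - (i : ℤ))) =
      ((n * (Finset.Icc a b).card : ℕ) : ℤ) := by
    rw [Finset.sum_add_distrib, ← Finset.mul_sum, Finset.sum_sub_distrib,
      Equiv.sum_comp σ (fun i : Finset.Icc a b => (i : ℤ)), sub_self, mul_zero, add_zero]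
    simp [mul_comm]
  rw [h2] at h1
  have h3 : DegFilt 𝔫 (d * (1 + 3 * m)) 0 (((Equiv.Perm.sign σ : ℤ) : A[X])) :=
    DegFilt.of_natDegree_le (by simp)
  have h4 := h3.mul h1
  rwa [zero_add] at h4

end DegreeFiltration

/-! ### Norms of determinants as monic polynomials in `X ^ p - X`. -/

section NormOfDeterminant

variable {A : Type*} [CommRing A] {𝔫 : Ideal A} {p m n d K : ℕ} [Fact p.Prime] [CharP A p]

theorem comp_artinSchreier_mem {V : A[X]}
    (h : V.comp (X ^ p - X) ∈ 𝔫.map C) : V ∈ 𝔫.map C := by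
  have hker : ∀ f : A[X], f ∈ 𝔫.map C ↔ f.map (Ideal.Quotient.mk 𝔫) = 0 := fun f => by
    rw [← coe_mapRingHom, ← RingHom.mem_ker, ker_mapRingHom, Ideal.mk_ker]
  rw [hker] at h ⊢
  rw [Polynomial.map_comp] at h
  ext i
  refine coeff_eq_zero_of_comp_artinSchreier p (k := i + 1) (fun t _ => ?_) i (Nat.lt_succ_self i)
  simp only [Polynomial.map_sub, Polynomial.map_pow, map_X] at h
  rw [h, coeff_zero]

/-- If `f` is, modulo `𝔫`, a product `g` of `T` linear factors and its degree is controlled, then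
its norm is `V (X ^ p - X)` for a distinguished polynomial `V` of degree `T`. -/
theorem exists_fpNorm_eq [Nontrivial A] (h𝔫 : 𝔫 ^ K = ⊥) (hK : K ≤ p) {δ T : ℕ}
    (hδ : K * δ < p - 1) {f g g' : A[X]} (hf : DegFilt 𝔫 δ T f) (hfg : f - g ∈ 𝔫.map C)
    (hg : g.Monic) (hgdeg : g.natDegree = T) (hgg : g * g' = (X ^ p - X) ^ T)
    (hgnorm : fpNorm p g = (X ^ p - X) ^ T) :
    ∃ V : A[X], fpNorm p f = V.comp (X ^ p - X) ∧ V.Monic ∧ V.natDegree = T ∧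
      V - X ^ T ∈ 𝔫.map C := by
  have hp := (Fact.out : p.Prime).pos
  have hym : (X ^ p - X : A[X]).Monic := monic_artinSchreier p
  have hyTd : ((X ^ p - X : A[X]) ^ T).natDegree = p * T := by
    rw [hym.natDegree_pow, natDegree_artinSchreier, mul_comm]
  have hg' : g'.Monic := hg.of_mul_monic_left (by rw [hgg]; exact hym.pow T)
  have hg'd : T + g'.natDegree = p * T := by
    rw [← hgdeg, ← hg.natDegree_mul hg', hgg, hyTd, hgdeg]
  -- Multiplication by the complementary factors `g'` makes `f` a perturbation of the translation
  -- invariant `(X ^ p - X) ^ T`; the norm of `g'` is monic and can be divided out afterwards.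
  set x := f * g' - (X ^ p - X) ^ T with hx
  have hx1 : x ∈ 𝔫.map C := by
    rw [hx, ← hgg, ← sub_mul]
    exact Ideal.mul_mem_right _ _ hfg
  have hx2 : DegFilt 𝔫 δ ((p * T : ℕ) : ℤ) x := by
    have h1 := hf.mul (DegFilt.of_natDegree_le (𝔫 := 𝔫) (δ := δ) (f := g') (T := g'.natDegree)
      le_rfl)
    have h2 : ((T : ℤ) + g'.natDegree) = ((p * T : ℕ) : ℤ) := by exact_mod_cast hg'd
    rw [h2] at h1
    have h3 : DegFilt 𝔫 δ ((p * T : ℕ) : ℤ) (-(X ^ p - X : A[X]) ^ T) :=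
      DegFilt.of_natDegree_le (by rw [natDegree_neg, hyTd])
    rw [hx, sub_eq_add_neg]
    exact h1.add h3
  -- The degree excess of every power is at most `K * δ`, whatever `i` is.
  have hx3 : ∀ i, 1 ≤ i → (x ^ i).natDegree < i * (p * T) + (p - 1) := by
    intro i _
    have h1 := hx2.pow i
    have h2 := DegFilt.natDegree_le h𝔫 (T := i * (p * T)) (by exact_mod_cast h1)
    omega
  obtain ⟨hm, hdeg⟩ := monic_fpNorm_add p h𝔫 hK hx1 hx3
  have hxe : (X ^ p - X) ^ T + x = f * g' := by rw [hx]; ring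
  rw [hxe, fpNorm_mul] at hm hdeg
  have hgm := monic_fpNorm p hg'
  have hfm : (fpNorm p f).Monic := hgm.of_mul_monic_right hm
  rw [hfm.natDegree_mul hgm, natDegree_fpNorm p hg'] at hdeg
  have hfd : (fpNorm p f).natDegree = T * p := by
    have h1 : p * (T + g'.natDegree) = p * (p * T) := by rw [hg'd]
    rw [mul_add] at h1
    rw [mul_comm T p]
    omega
  obtain ⟨V, hV⟩ := exists_comp_eq_of_fpShift_eq p (fpShift_fpNorm p 1 f)
  rw [hV] at hfm hfd
  obtain ⟨hVm, hVd⟩ := monic_of_comp_artinSchreier p hfm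
  refine ⟨V, hV, hVm, ?_, ?_⟩
  · rw [hVd] at hfd
    exact Nat.eq_of_mul_eq_mul_right hp hfd
  · refine comp_artinSchreier_mem (p := p) ?_
    rw [sub_comp, pow_comp, X_comp, ← hV, ← hgnorm]
    rw [← Ideal.Quotient.mk_eq_mk_iff_sub_mem, fpNorm, fpNorm, map_prod, map_prod]
    refine Finset.prod_congr rfl fun j _ => ?_
    rw [Ideal.Quotient.mk_eq_mk_iff_sub_mem, ← map_sub]
    exact fpShift_mem_map_C p j hfg

variable {l : Fin n → ℤ} {B : Matrix ℤ ℤ A[X]}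

theorem exists_linear_mul_eq (c : ℤ) : ∃ g : A[X], (X + C (c : A)) * g = X ^ p - X := by
  rw [← fpNorm_linear p c, fpNorm, ← Finset.mul_prod_erase _ _ (Finset.mem_univ (0 : ZMod p))]
  refine ⟨∏ j ∈ Finset.univ.erase (0 : ZMod p), fpShift p j (X + C (c : A)), ?_⟩
  congr 1
  simp [fpShift_apply]

theorem Banded.exists_fpNorm_idet [Nontrivial A] (hB : Banded 𝔫 m l B) (h𝔫 : 𝔫 ^ K = ⊥)
    (hd : ∀ i j : ℤ, j - i ≤ m → (B i j).natDegree ≤ d * (1 + (j - i).natAbs)) (hK : K ≤ p)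
    (hδ : K * (d * (1 + 3 * m)) < p - 1) (a b : ℤ) :
    ∃ V : A[X], fpNorm p (idet B a b) = V.comp (X ^ p - X) ∧ V.Monic ∧
      V.natDegree = n * (Finset.Icc a b).card ∧
      V - X ^ (n * (Finset.Icc a b).card) ∈ 𝔫.map C := by
  choose g hg using exists_linear_mul_eq (A := A) (p := p)
  refine exists_fpNorm_eq h𝔫 hK hδ (hB.degFilt_idet hd a b) (hB.idet_sub_diagProd_mem a b)
    (g' := ∏ i ∈ Finset.Icc a b, ∏ s, g (i - l s)) ?_ ?_ ?_ ?_
  · exact monic_prod_of_monic _ _ fun i _ => monic_prod_of_monic _ _ fun s _ => monic_X_add_C _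
  · rw [diagProd, natDegree_prod_of_monic _ _ fun i _ => monic_prod_of_monic _ _ fun s _ =>
      monic_X_add_C _]
    rw [Finset.sum_congr rfl fun i _ => natDegree_prod_of_monic _ _ fun s _ => monic_X_add_C _]
    simp only [natDegree_X_add_C, Finset.sum_const, Finset.card_univ, Fintype.card_fin,
      smul_eq_mul, mul_one, mul_comm]
  · rw [diagProd, ← Finset.prod_mul_distrib]
    rw [Finset.prod_congr rfl fun i _ => (Finset.prod_mul_distrib (s := Finset.univ)
      (f := fun s => X + C ((i - l s : ℤ) : A)) (g := fun s => g (i - l s))).symm]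
    simp only [hg, Finset.prod_const, Finset.card_univ, Fintype.card_fin, pow_mul]
  · rw [diagProd, fpNorm_prod]
    simp only [fpNorm_prod, fpNorm_linear, Finset.prod_const, Finset.card_univ, Fintype.card_fin,
      pow_mul]

end NormOfDeterminant

/-! ### The congruence in characteristic `p`. -/

section CharP

variable {A : Type*} [CommRing A] {𝔫 : Ideal A} {p m n d K : ℕ}
  {l : Fin n → ℤ} {B : Matrix ℤ ℤ A[X]}

/-- By the cross relation `det B_{a,j} / det B_{a,j-1}` does not change if `a` is replaced by the
left end of the window `[j - (m K + 1), j]`. Over `p` consecutive `j` these windows are all the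
translates of one. -/
theorem Banded.telescope (hB : Banded 𝔫 m l B) (h𝔫 : 𝔫 ^ K = ⊥) {a u : ℤ}
    (h : a + m * K ≤ u + 1) (k : ℕ) :
    idet B a (u + k) * ∏ i ∈ Finset.range k,
        idet B (u + 1 + i - (m * K + 1)) (u + 1 + i - 1) =
      idet B a u * ∏ i ∈ Finset.range k, idet B (u + 1 + i - (m * K + 1)) (u + 1 + i) := by
  induction k with
  | zero => simp
  | succ k ih =>
    rw [Finset.prod_range_succ, Finset.prod_range_succ, ← mul_assoc (idet B a u), ← ih]
    have h1 := hB.cross h𝔫 (max a (u + 1 + k - (m * K + 1))) (a := a)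
      (a' := u + 1 + k - (m * K + 1)) (b := u + 1 + k) (b' := u + 1 + k - 1)
      (le_max_left _ _) (le_max_right _ _) (by rcases max_cases a (u + 1 + k - (m * K + 1)) with h | h <;> omega)
      (by rcases max_cases a (u + 1 + k - (m * K + 1)) with h | h <;> omega)
    have h2 : u + ((k + 1 : ℕ) : ℤ) = u + 1 + k := by push_cast; ring
    have h3 : u + 1 + k - 1 = u + (k : ℤ) := by ring
    rw [h3] at h1 ⊢
    rw [h2]
    linear_combination (∏ i ∈ Finset.range k,
        idet B (u + 1 + i - (m * K + 1)) (u + 1 + i - 1)) * h1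

variable [Fact p.Prime] [CharP A p]

theorem prod_range_fpShift (f : A[X]) (u : ℤ) :
    ∏ i ∈ Finset.range p, f.comp (X + C ((u + i : ℤ) : A)) = fpNorm p f := by
  rw [fpNorm]
  refine Finset.prod_bij' (fun i _ => ((u + i : ℤ) : ZMod p)) (fun x _ => (x - u).val) ?_ ?_ ?_ ?_ ?_
  · simp
  · intro x _; exact Finset.mem_range.2 (ZMod.val_lt _)
  · intro i hi
    have : (((u + i : ℤ) : ZMod p) - u) = (i : ZMod p) := by push_cast; ring
    rw [this, ZMod.val_cast_of_lt (Finset.mem_range.1 hi)]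
  · intro x _
    push_cast
    rw [ZMod.natCast_val, ZMod.cast_id]
    ring
  · intro i _
    rw [fpShift_apply, map_intCast (ZMod.castHom (dvd_refl p) A)]

theorem Banded.prod_range_idet (hB : Banded 𝔫 m l B) (a b u : ℤ) :
    ∏ i ∈ Finset.range p, idet B (u + i + a) (u + i + b) = fpNorm p (idet B a b) := by
  rw [← prod_range_fpShift (idet B a b) u]
  refine Finset.prod_congr rfl fun i _ => ?_
  rw [← hB.idet_shift, add_comm a, add_comm b]

theorem isUnit_one_add_X_pow_mul {k : ℕ} (hk : k ≠ 0) (s : PowerSeries A) :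
    IsUnit (1 + PowerSeries.X ^ k * s) := by
  rw [PowerSeries.isUnit_iff_constantCoeff]
  simp [hk]

/-- If `W * η`, with `η` a unit, is a polynomial in `X ^ p - X` then `η` is constant up to high
order. -/
theorem Distinguished.eq_of_comp_artinSchreier [Nontrivial A] (h𝔫 : 𝔫 ^ K = ⊥) (hnK : n * K < p)
    {W U : A[X]} {η : PowerSeries A} (hW : Distinguished 𝔫 n W)
    (hU : U.Monic) (hUd : U.natDegree = n)
    (h : ((U.comp (X ^ p - X) : A[X]) : PowerSeries A) = W * η) :
    ∃ s : PowerSeries A, η = (-1) ^ n * (1 + PowerSeries.X ^ (p - n * K) * s) := by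
  have hmem : ∀ i < n, U.coeff i ∈ 𝔫 := by
    intro i hi
    rw [← Ideal.Quotient.eq_zero_iff_mem, ← coeff_map]
    refine coeff_eq_zero_of_comp_artinSchreier p (k := n) (fun t ht => ?_) i hi
    have h1 : (U.map (Ideal.Quotient.mk 𝔫)).comp (X ^ p - X) =
        (U.comp (X ^ p - X)).map (Ideal.Quotient.mk 𝔫) := by simp [Polynomial.map_comp]
    rw [h1, coeff_map, ← Polynomial.coeff_coe, h, Ideal.Quotient.eq_zero_iff_mem,
      PowerSeries.coeff_mul]
    refine Ideal.sum_mem _ fun x hx => Ideal.mul_mem_right _ _ ?_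
    rw [Polynomial.coeff_coe]
    have := Finset.HasAntidiagonal.mem_antidiagonal.1 hx
    exact hW.coeff_mem _ (by omega)
  -- The sign twist makes the argument `X - X ^ p ≡ X`, while keeping the polynomial monic.
  set W' : A[X] := C ((-1) ^ n) * U.comp (-X) with hW'
  have hcoeff : ∀ i, W'.coeff i = (-1) ^ n * ((-1) ^ i * U.coeff i) := fun i => by
    have h1 : (-X : A[X]) = C (-1) * X := by simp
    rw [hW', coeff_C_mul, h1, comp_C_mul_X_coeff, mul_comm (U.coeff i)]
  have hdist : Distinguished 𝔫 n W' := by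
    refine ⟨?_, ?_, fun i hi => ?_⟩
    · rw [natDegree_le_iff_coeff_eq_zero]
      intro i hi
      rw [hcoeff, coeff_eq_zero_of_natDegree_lt (hUd ▸ hi), mul_zero, mul_zero]
    · rw [hcoeff, ← hUd, coeff_natDegree, hU.leadingCoeff, mul_one, ← mul_pow]; simp
    · rw [hcoeff]
      exact Ideal.mul_mem_left _ _ (Ideal.mul_mem_left _ _ (hmem i hi))
  have hcomp : W'.comp (X - X ^ p) = C ((-1) ^ n) * U.comp (X ^ p - X) := by
    rw [hW', mul_comp, C_comp, comp_assoc, neg_comp, X_comp, neg_sub]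
  clear_value W'
  have hdvd : (X ^ p : A[X]) ∣ W'.comp (X - X ^ p) - W' := by
    have h1 := sub_dvd_eval_sub (X - X ^ p) X (W'.map (C : A →+* A[X]))
    rw [eval_map, eval_map] at h1
    have h2 : eval₂ C X W' = W' := eval₂_C_X
    rw [h2, sub_sub_cancel_left, neg_dvd] at h1
    exact h1
  obtain ⟨g, hg⟩ := hdvd
  obtain ⟨w, hw⟩ := hdist.dvd_X_pow h𝔫
  -- `W'` divides `X ^ (n K)`, so the error, a multiple of `X ^ p`, is `W'` times a multiple of `X ^
  -- (p - n K)`.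
  have hpow : (X ^ p : A[X]) = X ^ (p - n * K) * X ^ (n * K) := by
    rw [← pow_add, Nat.sub_add_cancel hnK.le]
  have h1 : W'.comp (X - X ^ p) = W' * (1 + X ^ (p - n * K) * (w * g)) := by
    rw [eq_add_of_sub_eq hg, hpow, hw]; ring
  have h2 : (W : PowerSeries A) * (((-1) ^ n) * η) =
      (W' : PowerSeries A) * (1 + PowerSeries.X ^ (p - n * K) * ((w * g : A[X]) : PowerSeries A)) := by
    have h3 := congrArg (fun f : A[X] => (f : PowerSeries A)) (hcomp.symm.trans h1)
    simp only [Polynomial.coe_mul, h] at h3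
    rw [Polynomial.coe_mul w g]
    simp only [Polynomial.coe_add, Polynomial.coe_mul, Polynomial.coe_one, Polynomial.coe_pow,
      Polynomial.coe_X] at h3
    rw [← h3]
    simp
    ring
  obtain ⟨-, h4⟩ := hW.unique h𝔫 hdist
    (isUnit_one_add_X_pow_mul (Nat.sub_ne_zero_of_lt hnK) _) h2
  refine ⟨((w * g : A[X]) : PowerSeries A), ?_⟩
  rw [← h4, ← mul_assoc, ← mul_pow]
  simp

/-- Two telescopings over full periods are compared. One runs from the left end of `[μ, ν]` and
involves units apart from `W`; the other reaches `p - b`, with the lower end `μ` up to `ν` and the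
lower end `a` beyond it. Both produce the same quotient of norms `V1 / V0` in `X ^ p - X`. -/
theorem Banded.exists_eq_mul_of_charP [Nontrivial A] (hB : Banded 𝔫 m l B) (h𝔫 : 𝔫 ^ K = ⊥)
    (hd : ∀ i j : ℤ, j - i ≤ m → (B i j).natDegree ≤ d * (1 + (j - i).natAbs)) (hK : K ≤ p)
    (hδ : K * (d * (1 + 3 * m)) < p - 1) (hnK : n * K < p) {μ ν a b : ℤ}
    (hμb : μ + m * K ≤ -b + 1) (hbν : -b ≤ ν) (haν : a + m * K ≤ ν + 1) (hνp : ν ≤ p - b)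
    (hlμ : ∀ s, l s - μ < p) (hμl : ∀ s, μ + m * K ≤ l s) (hlν : ∀ s, l s < ν - m * K)
    (hμν : μ + m * K ≤ ν + 1) (hνμ : ν + 1 ≤ μ + m * K + p)
    {W : A[X]} {h : PowerSeries A} (hW : Distinguished 𝔫 n W)
    (hWh : ((idet B μ ν : A[X]) : PowerSeries A) = W * h) :
    ∃ s : PowerSeries A, h * ((idet B a (p - b) : A[X]) : PowerSeries A) =
      (-1) ^ n * (((idet B μ (-b) : A[X]) : PowerSeries A) *
        ((idet B a ν : A[X]) : PowerSeries A)) *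
        (1 + PowerSeries.X ^ (p - n * K) * s) := by
  set c : ℤ := m * K + 1 with hc
  have hc0 : 0 < c := by positivity
  set u : ℤ := μ + m * K - 1 with hu
  set P1 : ℤ → A[X] := fun j => idet B (j - c) j with hP1
  set P0 : ℤ → A[X] := fun j => idet B (j - c) (j - 1) with hP0
  have tel : ∀ {a u : ℤ}, a + m * K ≤ u + 1 → ∀ k : ℕ,
      idet B a (u + k) * ∏ i ∈ Finset.range k, P0 (u + 1 + i) =
        idet B a u * ∏ i ∈ Finset.range k, P1 (u + 1 + i) := fun h k => hB.telescope h𝔫 h k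
  have norm1 : ∀ v : ℤ, ∏ i ∈ Finset.range p, P1 (v + i) = fpNorm p (idet B (-c) 0) := by
    intro v
    rw [← hB.prod_range_idet (-c) 0 v]
    refine Finset.prod_congr rfl fun i _ => ?_
    simp only [hP1, add_zero, sub_eq_add_neg]
  have norm0 : ∀ v : ℤ, ∏ i ∈ Finset.range p, P0 (v + i) = fpNorm p (idet B (-c) (-1)) := by
    intro v
    rw [← hB.prod_range_idet (-c) (-1) v]
    refine Finset.prod_congr rfl fun i _ => ?_
    simp only [hP0, sub_eq_add_neg]
  obtain ⟨V1, hV1, hV1m, hV1d, -⟩ := hB.exists_fpNorm_idet h𝔫 hd hK hδ (-c) 0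
  obtain ⟨V0, hV0, hV0m, hV0d, hV0𝔫⟩ := hB.exists_fpNorm_idet h𝔫 hd hK hδ (-c) (-1)
  obtain ⟨c', hc'⟩ : ∃ c' : ℕ, c = c' := ⟨c.toNat, by omega⟩
  have card1 : (Finset.Icc (-c) 0).card = c' + 1 := by rw [Int.card_Icc]; omega
  have card0 : (Finset.Icc (-c) (-1)).card = c' := by rw [Int.card_Icc]; omega
  rw [card1] at hV1d
  rw [card0] at hV0d hV0𝔫
  -- the relation between `det B_{μ,ν}` and the norms
  have rel2 : ∃ η : PowerSeries A,
      ((V1.comp (X ^ p - X) : A[X]) : PowerSeries A) =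
        ((V0.comp (X ^ p - X) : A[X]) : PowerSeries A) * (W * η) := by
    obtain ⟨k, hk⟩ : ∃ k : ℕ, ν = u + k := ⟨(ν - u).toNat, by omega⟩
    obtain ⟨k', hk'⟩ : ∃ k' : ℕ, p = k + k' := ⟨p - k, by omega⟩
    have h1 := tel (a := μ) (u := u) (by omega) k
    rw [← hk] at h1
    set Q1 := ∏ i ∈ Finset.range k', P1 (u + 1 + (k + i : ℕ)) with hQ1
    set Q0 := ∏ i ∈ Finset.range k', P0 (u + 1 + (k + i : ℕ)) with hQ0
    have n1 := norm1 (u + 1)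
    have n0 := norm0 (u + 1)
    rw [hV1, hk', Finset.prod_range_add, ← hk'] at n1
    rw [hV0, hk', Finset.prod_range_add, ← hk'] at n0
    have h2 : V1.comp (X ^ p - X) * (idet B μ u * Q0) = V0.comp (X ^ p - X) * (idet B μ ν * Q1) := by
      rw [← n1, ← n0]
      linear_combination (-Q1 * Q0) * h1
    -- The windows ending in `(ν, u + p]` lie strictly between `l s` and `l s + p`, and `[μ, u]`
    -- strictly between `l s - p` and `l s`. All these determinants are therefore units.
    have unit_of : ∀ x y : ℤ, (∀ i ∈ Finset.Icc x y, ∀ s, ¬ (p : ℤ) ∣ i - l s) →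
        IsUnit ((idet B x y : A[X]) : PowerSeries A) := fun x y hxy =>
      hB.isUnit_coeff_zero h𝔫 fun i hi s => isUnit_intCast_of_not_dvd p (hxy i hi s)
    have hα : IsUnit ((Q1 : A[X]) : PowerSeries A) := by
      rw [hQ1, ← Polynomial.coeToPowerSeries.ringHom_apply, map_prod]
      refine IsUnit.prod_iff.2 fun i hi => unit_of _ _ fun j hj s hdvd => ?_
      have := Finset.mem_Icc.1 hj
      have := Finset.mem_range.1 hi
      have := hlν s
      have := hμl s
      have := Int.le_of_dvd (by push_cast at *; omega) hdvd
      push_cast at *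
      omega
    have hβ : IsUnit ((idet B μ u * Q0 : A[X]) : PowerSeries A) := by
      rw [Polynomial.coe_mul]
      refine IsUnit.mul (unit_of _ _ fun j hj s hdvd => ?_) ?_
      · have := Finset.mem_Icc.1 hj
        have := hlμ s
        have := hμl s
        have := Int.le_of_dvd (by omega) ((dvd_neg (α := ℤ)).2 hdvd)
        omega
      · rw [hQ0, ← Polynomial.coeToPowerSeries.ringHom_apply, map_prod]
        refine IsUnit.prod_iff.2 fun i hi => unit_of _ _ fun j hj s hdvd => ?_
        have := Finset.mem_Icc.1 hj
        have := Finset.mem_range.1 hi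
        have := hlν s
        have := hμl s
        have := Int.le_of_dvd (by push_cast at *; omega) hdvd
        push_cast at *
        omega
    obtain ⟨β, hβ⟩ := hβ
    refine ⟨h * (Q1 : PowerSeries A) * (β⁻¹ : (PowerSeries A)ˣ).1, ?_⟩
    have h3 := congrArg (fun f : A[X] => (f : PowerSeries A)) h2
    simp only [Polynomial.coe_mul] at h3
    rw [Polynomial.coe_mul] at hβ
    rw [← hβ, hWh] at h3
    have h4 := (Units.eq_mul_inv_iff_mul_eq β).2 h3
    rw [h4]
    ring
  -- the relation between `det B_{a,p-b}` and the norms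
  have rel1 : idet B μ ν * idet B a (p - b) * V0.comp (X ^ p - X) =
      idet B μ (-b) * idet B a ν * V1.comp (X ^ p - X) := by
    obtain ⟨k, hk⟩ : ∃ k : ℕ, ν = -b + k := ⟨(ν + b).toNat, by omega⟩
    obtain ⟨k', hk'⟩ : ∃ k' : ℕ, p = k + k' := ⟨p - k, by omega⟩
    have h1 := tel (a := μ) (u := -b) (by omega) k
    rw [← hk] at h1
    have h2 := tel (a := a) (u := ν) (by omega) k'
    have h3 : ν + (k' : ℤ) = p - b := by rw [hk, hk']; push_cast; ring
    rw [h3] at h2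
    have n1 := norm1 (-b + 1)
    have n0 := norm0 (-b + 1)
    have h4 : ∀ i : ℕ, -b + 1 + ((k + i : ℕ) : ℤ) = ν + 1 + i := fun i => by
      rw [hk]; push_cast; ring
    rw [hV1, hk', Finset.prod_range_add, ← hk'] at n1
    rw [hV0, hk', Finset.prod_range_add, ← hk'] at n0
    simp only [h4] at n1 n0
    rw [← n1, ← n0]
    calc _ = (idet B μ ν * ∏ i ∈ Finset.range k, P0 (-b + 1 + i)) *
          (idet B a (p - b) * ∏ i ∈ Finset.range k', P0 (ν + 1 + i)) := by ring
      _ = _ := by rw [h1, h2]; ring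
  obtain ⟨η, hVη⟩ := rel2
  have hV0dist : Distinguished 𝔫 (n * c') V0 := by
    refine ⟨hV0d.le, ?_, fun i hi => ?_⟩
    · rw [← hV0d, coeff_natDegree, hV0m.leadingCoeff]
    · have := Ideal.mem_map_C_iff.1 hV0𝔫 i
      rwa [coeff_sub, coeff_X_pow, if_neg hi.ne, sub_zero] at this
  -- To divide by `V0 (X ^ p - X)`, complete it by `G0` to a power of `X ^ p - X`, which can be
  -- cancelled among power series.
  obtain ⟨G0, hG0⟩ := hV0dist.dvd_X_pow h𝔫
  have hG0y : ((X ^ p - X : A[X]) ^ (n * c' * K)) =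
      V0.comp (X ^ p - X) * G0.comp (X ^ p - X) := by
    rw [← mul_comp, ← hG0, pow_comp, X_comp]
  have hG0yc := congrArg (fun f : A[X] => (f : PowerSeries A)) hG0y
  simp only [Polynomial.coe_mul] at hG0yc
  have hH : (((V1 * G0).comp (X ^ p - X) : A[X]) : PowerSeries A) =
      (((X ^ p - X) ^ (n * c' * K) : A[X]) : PowerSeries A) * (W * η) := by
    rw [mul_comp, Polynomial.coe_mul, hVη, hG0yc]
    ring
  obtain ⟨U, hU⟩ : X ^ (n * c' * K) ∣ V1 * G0 := by
    rw [X_pow_dvd_iff]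
    refine coeff_eq_zero_of_comp_artinSchreier p fun t ht => ?_
    rw [← Polynomial.coeff_coe, hH, artinSchreier_eq, mul_pow, Polynomial.coe_mul, mul_assoc,
      Polynomial.coe_pow, Polynomial.coe_X, PowerSeries.coeff_X_pow_mul', if_neg (not_le.2 ht)]
  have hG0m : G0.Monic := hV0m.of_mul_monic_left (by rw [← hG0]; exact monic_X_pow _)
  have hUm : U.Monic := (monic_X_pow (n * c' * K)).of_mul_monic_left
    (by rw [← hU]; exact hV1m.mul hG0m)
  have hUd : U.natDegree = n := by
    have d1 := congrArg natDegree hG0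
    have d2 := congrArg natDegree hU
    rw [hV0m.natDegree_mul hG0m, natDegree_X_pow, hV0d] at d1
    rw [hV1m.natDegree_mul hG0m, (monic_X_pow _).natDegree_mul hUm, natDegree_X_pow, hV1d,
      mul_add, mul_one] at d2
    omega
  have hUη : ((U.comp (X ^ p - X) : A[X]) : PowerSeries A) = W * η := by
    refine artinSchreier_mul_cancel p (n * c' * K) ?_
    rw [← hH, hU, mul_comp, pow_comp, X_comp, Polynomial.coe_mul]
  obtain ⟨s, hs⟩ := hW.eq_of_comp_artinSchreier h𝔫 hnK hUm hUd hUη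
  refine ⟨s, ?_⟩
  refine hW.mul_cancel h𝔫 (artinSchreier_mul_cancel p (n * c' * K) ?_)
  have h5 := congrArg (fun f : A[X] => (f : PowerSeries A)) rel1
  simp only [Polynomial.coe_mul] at h5
  rw [hVη, hWh, hs] at h5
  rw [hG0yc]
  linear_combination ((G0.comp (X ^ p - X) : A[X]) : PowerSeries A) * h5

end CharP

/-! ### Weierstrass polynomials and ratios of determinants. -/

section WeierstrassOfDeterminant

variable {A : Type*} [CommRing A] {𝔫 : Ideal A} {m n K : ℕ}
  {l : Fin n → ℤ} {B : Matrix ℤ ℤ A[X]}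

/-- `det B_{a,b}` as a power series. -/
def dser (B : Matrix ℤ ℤ A[X]) (a b : ℤ) : PowerSeries A := ((idet B a b : A[X]) : PowerSeries A)

theorem map_dser {A' : Type*} [CommRing A'] (f : A →+* A') (B : Matrix ℤ ℤ A[X]) (a b : ℤ) :
    (dser B a b).map f = dser (B.map (mapRingHom f)) a b := by
  rw [dser, dser, ← map_idet, coe_mapRingHom, Polynomial.polynomial_map_coe]

/-- A factorization of `det B_{μ,ν}` as a Weierstrass polynomial times a unit. -/
structure WFact (𝔫 : Ideal A) (n : ℕ) (f : PowerSeries A) (W : A[X]) (h : PowerSeries A) :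
    Prop where
  distinguished : Distinguished 𝔫 n W
  isUnit : IsUnit h
  eq : f = W * h

theorem WFact.map {A' : Type*} [CommRing A'] (g : A →+* A') {𝔫' : Ideal A'}
    (hle : 𝔫 ≤ 𝔫'.comap g) {f h : PowerSeries A} {W : A[X]} (H : WFact 𝔫 n f W h) :
    WFact 𝔫' n (f.map g) (W.map g) (h.map g) where
  distinguished := H.distinguished.map g hle
  isUnit := H.isUnit.map _
  eq := by rw [H.eq, map_mul, Polynomial.polynomial_map_coe]

theorem WFact.unique (h𝔫 : 𝔫 ^ K = ⊥) {f h h' : PowerSeries A} {W W' : A[X]}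
    (H : WFact 𝔫 n f W h) (H' : WFact 𝔫 n f W' h') : W = W' ∧ h = h' := by
  have h1 := H'.distinguished.unique h𝔫 H.distinguished H.isUnit (H'.eq.symm.trans H.eq)
  exact ⟨h1.1, h1.2.symm⟩

theorem WFact.mul_unit {f h u : PowerSeries A} {W : A[X]} (H : WFact 𝔫 n f W h) (hu : IsUnit u) :
    WFact 𝔫 n (f * u) W (h * u) where
  distinguished := H.distinguished
  isUnit := H.isUnit.mul hu
  eq := by rw [H.eq, mul_assoc]

theorem exists_diagProd_eq (l : Fin n → ℤ) {μ ν : ℤ} (hl : ∀ s, l s ∈ Finset.Icc μ ν) :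
    ∃ E : A[X], diagProd A l μ ν = X ^ n * E ∧
      E.coeff 0 = ∏ s, ∏ i ∈ (Finset.Icc μ ν).erase (l s), ((i - l s : ℤ) : A) := by
  refine ⟨∏ s, ∏ i ∈ (Finset.Icc μ ν).erase (l s), (X + C ((i - l s : ℤ) : A)), ?_, ?_⟩
  · rw [diagProd, Finset.prod_comm]
    have h1 : (X ^ n : A[X]) = ∏ _s : Fin n, X := by simp
    rw [h1, ← Finset.prod_mul_distrib]
    refine Finset.prod_congr rfl fun s _ => ?_
    rw [← Finset.mul_prod_erase _ _ (hl s)]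
    simp
  · simp [coeff_zero_eq_eval_zero, eval_prod]

theorem Banded.exists_wFact (hB : Banded 𝔫 m l B) (h𝔫 : 𝔫 ^ K = ⊥) {μ ν : ℤ}
    (hl : ∀ s, l s ∈ Finset.Icc μ ν)
    (hu : ∀ i ∈ Finset.Icc μ ν, ∀ s, i ≠ l s → IsUnit ((i - l s : ℤ) : A)) :
    ∃ W h, WFact 𝔫 n (dser B μ ν) W h := by
  obtain ⟨E, hE, hE0⟩ := exists_diagProd_eq (A := A) l hl
  have hmem := Ideal.mem_map_C_iff.1 (hB.idet_sub_diagProd_mem μ ν)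
  have h1 : ∀ i < n, PowerSeries.coeff i (dser B μ ν) ∈ 𝔫 := by
    intro i hi
    rw [dser, Polynomial.coeff_coe]
    have := hmem i
    rwa [coeff_sub, hE, coeff_X_pow_mul', if_neg (not_le.2 hi), sub_zero] at this
  have h2 : IsUnit (PowerSeries.coeff n (dser B μ ν)) := by
    rw [dser, Polynomial.coeff_coe]
    refine isUnit_of_map_mk (fun x hx => isNilpotent_of_mem h𝔫 hx) (y := E.coeff 0) ?_ ?_
    · rw [hE0]
      refine IsUnit.prod_iff.2 fun s _ => IsUnit.prod_iff.2 fun i hi => ?_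
      exact hu i (Finset.mem_of_mem_erase hi) s (Finset.ne_of_mem_erase hi)
    · have := hmem n
      rwa [coeff_sub, hE, coeff_X_pow_mul', if_pos le_rfl, Nat.sub_self] at this
  obtain ⟨P, h, hP, hh, he⟩ := exists_distinguished_factorization h𝔫 h1 h2
  exact ⟨P, h, hP, hh, he⟩

theorem dser_cross (hB : Banded 𝔫 m l B) (h𝔫 : 𝔫 ^ K = ⊥) (e : ℤ) {a a' b b' : ℤ}
    (ha : a ≤ e) (ha' : a' ≤ e) (hb : e + m * K ≤ b + 1) (hb' : e + m * K ≤ b' + 1) :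
    dser B a b * dser B a' b' = dser B a' b * dser B a b' := by
  have := congrArg (fun f : A[X] => (f : PowerSeries A)) (hB.cross h𝔫 e ha ha' hb hb')
  simpa only [dser, Polynomial.coe_mul] using this

/-- The ratio `det B_{μ,b} det B_{a,ν} / det B_{μ,ν}` does not depend on `μ` and `ν`. -/
theorem Banded.ratio_eq (hB : Banded 𝔫 m l B) (h𝔫 : 𝔫 ^ K = ⊥) {μ μ' ν ν' a b : ℤ}
    (h1 : μ + m * K ≤ b + 1) (h1' : μ' + m * K ≤ b + 1)
    (h2 : a + m * K ≤ ν + 1) (h2' : a + m * K ≤ ν' + 1)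
    (h3 : μ ≤ a) (h4 : b ≤ ν') :
    dser B μ b * dser B a ν * dser B μ' ν' = dser B μ' b * dser B a ν' * dser B μ ν := by
  have e1 := dser_cross hB h𝔫 (max μ μ') (a := μ) (a' := μ') (b := b) (b' := ν')
    (le_max_left _ _) (le_max_right _ _)
    (by rcases max_cases μ μ' with h | h <;> omega) (by rcases max_cases μ μ' with h | h <;> omega)
  have e2 := dser_cross hB h𝔫 a (a := a) (a' := μ) (b := ν) (b' := ν') le_rfl h3 h2 h2'
  calc _ = dser B a ν * (dser B μ b * dser B μ' ν') := by ring
    _ = dser B μ' b * (dser B a ν * dser B μ ν') := by rw [e1]; ring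
    _ = _ := by rw [e2]; ring

variable [Algebra ℚ A]

theorem Banded.isUnit_dser (hB : Banded 𝔫 m l B) (h𝔫 : 𝔫 ^ K = ⊥) {a b : ℤ}
    (h : ∀ i ∈ Finset.Icc a b, ∀ s, i ≠ l s) : IsUnit (dser B a b) :=
  hB.isUnit_coeff_zero h𝔫 fun i hi s => isUnit_intCast (sub_ne_zero.2 (h i hi s))

/-- The Weierstrass polynomial of `det B_{μ,ν}` does not depend on `μ` and `ν`. -/
theorem Banded.wFact_eq (hB : Banded 𝔫 m l B) (h𝔫 : 𝔫 ^ K = ⊥) {L : ℤ} (hL0 : 0 ≤ L)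
    (hL : ∀ s, -L < l s ∧ l s < L) {μ μ' ν ν' : ℤ} (hμ : μ ≤ -(m * K + L))
    (hμ' : μ' ≤ -(m * K + L)) (hν : m * K + L ≤ ν) (hν' : m * K + L ≤ ν')
    {W W' : A[X]} {h h' : PowerSeries A} (H : WFact 𝔫 n (dser B μ ν) W h)
    (H' : WFact 𝔫 n (dser B μ' ν') W' h') : W = W' := by
  have hmK : (0 : ℤ) ≤ m * K := by positivity
  -- `e1` moves the lower end and `e2` the upper end. The auxiliary sections lie in `(-∞, -L]` or
  -- `[L, ∞)`, avoid all `l s`, and so contribute units.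
  have e1 := dser_cross hB h𝔫 (-(m * K + L)) (a := μ) (a' := μ') (b := ν) (b' := -L) hμ hμ'
    (by omega) (by omega)
  have e2 := dser_cross hB h𝔫 L (a := μ') (a' := L) (b := ν) (b' := ν')
    (by omega) le_rfl (by omega) (by omega)
  have lowU : ∀ x : ℤ, IsUnit (dser B x (-L)) := fun x =>
    hB.isUnit_dser h𝔫 fun i hi s => by
      have := Finset.mem_Icc.1 hi; have := hL s; omega
  have highU : ∀ x : ℤ, IsUnit (dser B L x) := fun x =>
    hB.isUnit_dser h𝔫 fun i hi s => by
      have := Finset.mem_Icc.1 hi; have := hL s; omega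
  have H1 := H.mul_unit ((lowU μ').mul (highU ν'))
  have H2 := H'.mul_unit ((lowU μ).mul (highU ν))
  have heq : dser B μ ν * (dser B μ' (-L) * dser B L ν') =
      dser B μ' ν' * (dser B μ (-L) * dser B L ν) := by
    calc _ = (dser B μ ν * dser B μ' (-L)) * dser B L ν' := by ring
      _ = dser B μ (-L) * (dser B μ' ν * dser B L ν') := by rw [e1]; ring
      _ = _ := by rw [e2]; ring
  rw [heq] at H1
  exact (H1.unique h𝔫 H2).1

end WeierstrassOfDeterminant

/-! ### Determinants as invertible Laurent series. -/

section LaurentOfDeterminant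

variable {A : Type*} [CommRing A] {𝔫 : Ideal A} {m n K : ℕ}
  {l : Fin n → ℤ} {B : Matrix ℤ ℤ A[X]} [Algebra ℚ A]

theorem expandAt_zero_algebraMap (f : A[X]) :
    expandAt 0 (algebraMap A[X] (PartialFractions A) f) = polyToLaurent A f := by
  rw [expandAt_algebraMap, polyExpandAt]
  simp

theorem Banded.isUnit_polyToLaurent_idet (hB : Banded 𝔫 m l B) (h𝔫 : 𝔫 ^ K = ⊥) (a b : ℤ) :
    IsUnit (polyToLaurent A (idet B a b)) := by
  rw [← expandAt_zero_algebraMap]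
  exact (hB.isUnit_idet h𝔫 a b).map _

end LaurentOfDeterminant

/-! ### The completion as a limit of its levels. -/

section Levels

variable {R : Type*} [CommRing R] (I : Ideal R)

theorem toLevel_comp (K : ℕ) : (evalLevel I K).comp (toCompletion I) = toLevel I K := by
  ext r
  simp only [evalLevel, toCompletion, toLevel]
  exact (AdicCompletion.evalₐ (ratIdeal I) K).commutes _

/-- The projection `ℚ ⊗ R → ℚ ⊗ (R / I ^ K)`. -/
def levelMk (K : ℕ) : ℚ ⊗[ℤ] R →+* Level I K := Ideal.Quotient.mk (ratIdeal I ^ K)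

theorem levelMk_surjective (K : ℕ) : Function.Surjective (levelMk I K) :=
  Ideal.Quotient.mk_surjective (I := ratIdeal I ^ K)

theorem levelMk_eq_iff {K : ℕ} {x y : ℚ ⊗[ℤ] R} :
    levelMk I K x = levelMk I K y ↔ x - y ∈ ratIdeal I ^ K :=
  Ideal.Quotient.mk_eq_mk_iff_sub_mem (I := ratIdeal I ^ K) x y

theorem levelMk_eq_zero_iff {K : ℕ} {x : ℚ ⊗[ℤ] R} :
    levelMk I K x = 0 ↔ x ∈ ratIdeal I ^ K := by
  rw [← map_zero (levelMk I K), levelMk_eq_iff, sub_zero]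

theorem map_toLevel (K : ℕ) : I.map (toLevel I K) = (ratIdeal I).map (levelMk I K) :=
  (Ideal.map_map (Algebra.TensorProduct.includeRight : R →ₐ[ℤ] ℚ ⊗[ℤ] R).toRingHom
    (levelMk I K)).symm

theorem map_toLevel_pow (K : ℕ) : (I.map (toLevel I K)) ^ K = ⊥ := by
  rw [map_toLevel, ← Ideal.map_pow, Ideal.map_eq_bot_iff_le_ker]
  exact fun x hx => (levelMk_eq_zero_iff I).2 hx

/-- The transition maps between the levels. -/
def levelMap {K K' : ℕ} (h : K ≤ K') : Level I K' →+* Level I K :=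
  Ideal.Quotient.factor (Ideal.pow_le_pow_right h)

theorem levelMap_levelMk {K K' : ℕ} (h : K ≤ K') (x : ℚ ⊗[ℤ] R) :
    levelMap I h (levelMk I K' x) = levelMk I K x := rfl

theorem evalLevel_mk (K : ℕ) (x : AdicCompletion.AdicCauchySequence (ratIdeal I) (ℚ ⊗[ℤ] R)) :
    evalLevel I K (AdicCompletion.mk _ _ x) = levelMk I K (x.val K) :=
  AdicCompletion.evalₐ_mk _ K x

theorem levelMap_evalLevel {K K' : ℕ} (h : K ≤ K') (x : Completion I) :
    levelMap I h (evalLevel I K' x) = evalLevel I K x := by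
  induction x using AdicCompletion.induction_on with
  | _ x =>
  rw [evalLevel_mk, evalLevel_mk, levelMap_levelMk]
  have h2 := x.2 h
  rw [SModEq.sub_mem, smul_eq_mul, Ideal.mul_top] at h2
  exact ((levelMk_eq_iff I).2 h2).symm

theorem levelMap_toLevel {K K' : ℕ} (h : K ≤ K') :
    (levelMap I h).comp (toLevel I K') = toLevel I K := by
  rw [← toLevel_comp, ← toLevel_comp, ← RingHom.comp_assoc]
  congr 1
  ext x
  exact levelMap_evalLevel I h x

theorem completion_ext {x y : Completion I} (h : ∀ K, evalLevel I K x = evalLevel I K y) :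
    x = y := AdicCompletion.ext_evalₐ h

theorem exists_of_compatible (c : ∀ K, Level I K)
    (hc : ∀ K, levelMap I (Nat.le_succ K) (c (K + 1)) = c K) :
    ∃ x : Completion I, ∀ K, evalLevel I K x = c K := by
  choose r hr using fun K => levelMk_surjective I K (c K)
  refine ⟨AdicCompletion.mk _ _ (AdicCompletion.AdicCauchySequence.mk _ _ r fun K => ?_),
    fun K => ?_⟩
  · rw [SModEq.sub_mem, smul_eq_mul, Ideal.mul_top, ← levelMk_eq_iff, hr, ← hc K, ← hr (K + 1),
      levelMap_levelMk]
  · rw [evalLevel_mk]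
    exact hr K

theorem exists_powerSeries_of_compatible (c : ∀ K, PowerSeries (Level I K))
    (hc : ∀ K, (c (K + 1)).map (levelMap I (Nat.le_succ K)) = c K) :
    ∃ x : PowerSeries (Completion I), ∀ K, x.map (evalLevel I K) = c K := by
  choose x hx using fun i => exists_of_compatible I (fun K => PowerSeries.coeff i (c K))
    fun K => by rw [← PowerSeries.coeff_map, hc]
  refine ⟨PowerSeries.mk x, fun K => PowerSeries.ext fun i => ?_⟩
  rw [PowerSeries.coeff_map, PowerSeries.coeff_mk, hx]

theorem powerSeries_completion_ext {x y : PowerSeries (Completion I)}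
    (h : ∀ K, x.map (evalLevel I K) = y.map (evalLevel I K)) : x = y := by
  refine PowerSeries.ext fun i => completion_ext I fun K => ?_
  rw [← PowerSeries.coeff_map, h, PowerSeries.coeff_map]

theorem polynomial_completion_ext {x y : (Completion I)[X]}
    (h : ∀ K, x.map (evalLevel I K) = y.map (evalLevel I K)) : x = y := by
  refine Polynomial.ext fun i => completion_ext I fun K => ?_
  rw [← coeff_map, h, coeff_map]

/-- Inverses are unique, so those at the levels are compatible and glue. -/
theorem isUnit_of_isUnit_map {x : PowerSeries (Completion I)}
    (h : ∀ K, IsUnit (x.map (evalLevel I K))) : IsUnit x := by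
  choose u hu using h
  obtain ⟨y, hy⟩ := exists_powerSeries_of_compatible I
    (fun K => ((u K)⁻¹ : (PowerSeries (Level I K))ˣ).1) fun K => by
      refine (Units.eq_inv_of_mul_eq_one_right (u := u K) ?_)
      rw [hu]
      have h1 : x.map (evalLevel I K) =
          (x.map (evalLevel I (K + 1))).map (levelMap I (Nat.le_succ K)) := by
        ext i; simp [levelMap_evalLevel]
      rw [h1, ← map_mul, ← hu, Units.inv_mul, map_one]
  refine IsUnit.of_mul_eq_one y (powerSeries_completion_ext I fun K => ?_)
  rw [map_mul, hy, ← hu, Units.mul_inv, map_one]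

theorem mem_map_toLevel_iff {K : ℕ} (hK : 1 ≤ K) (x : Completion I) :
    evalLevel I K x ∈ I.map (toLevel I K) ↔ x ∈ augIdeal I := by
  rw [augIdeal, RingHom.mem_ker, ← levelMap_evalLevel I hK]
  obtain ⟨r, hr⟩ := levelMk_surjective I K (evalLevel I K x)
  have h1 : levelMk I 1 r = 0 ↔ r ∈ ratIdeal I := 
    (levelMk_eq_zero_iff I).trans (iff_of_eq (congrArg (r ∈ ·) (pow_one (ratIdeal I))))
  rw [map_toLevel, ← hr, levelMap_levelMk, h1]
  exact Ideal.mem_quotient_iff_mem (Ideal.pow_le_self (by omega))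

theorem augIdeal_le (K : ℕ) : augIdeal I ≤ (I.map (toLevel I K)).comap (evalLevel I K) := by
  intro x hx
  rcases Nat.eq_zero_or_pos K with rfl | hK
  · have : (I.map (toLevel I 0)) = ⊤ := by
      have := map_toLevel_pow I 0
      rw [pow_zero, Ideal.one_eq_top] at this
      rw [eq_top_iff, this]; exact bot_le
    rw [this]; trivial
  · exact (mem_map_toLevel_iff I hK x).2 hx

/-- Otherwise `1` would die in `ℚ ⊗ (R / I)`, and injectivity of `R / I → ℚ ⊗ (R / I)` would give `1
= 0` in `R / I`. Without nontriviality the degrees of Weierstrass polynomials would be meaningless.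
-/
theorem nontrivial_level_one (hI : I ≠ ⊤) (hR : ResidueAssumption I) :
    Nontrivial (Level I 1) := by
  refine Ideal.Quotient.nontrivial_iff.2 fun h1 => ?_
  have h : ratIdeal I = ⊤ := (pow_one (ratIdeal I)).symm.trans h1
  have : Nontrivial (R ⧸ I) := Ideal.Quotient.nontrivial_iff.2 hI
  let f : ℚ ⊗[ℤ] R →ₐ[ℤ] ℚ ⊗[ℤ] (R ⧸ I) :=
    Algebra.TensorProduct.map (AlgHom.id ℤ ℚ) (Ideal.Quotient.mkₐ ℤ I)
  have hker : ratIdeal I ≤ RingHom.ker f.toRingHom := by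
    rw [ratIdeal, Ideal.map_le_iff_le_comap]
    intro x hx
    rw [Ideal.mem_comap, RingHom.mem_ker]
    change f (1 ⊗ₜ x) = 0
    have hx0 : (Ideal.Quotient.mkₐ ℤ I) x = 0 := Ideal.Quotient.eq_zero_iff_mem.2 hx
    rw [Algebra.TensorProduct.map_tmul, hx0, TensorProduct.tmul_zero]
  have h1 : (1 : ℚ ⊗[ℤ] R) ∈ RingHom.ker f.toRingHom := hker (h ▸ Submodule.mem_top)
  rw [RingHom.mem_ker, map_one] at h1
  have h2 := hR.injective_rat (a₁ := 1) (a₂ := 0) (by rw [map_one, map_zero, h1])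
  exact one_ne_zero h2

end Levels

/-! ### The series `F` over a ring with a nilpotent ideal. -/

section Ratio

variable {A : Type*} [CommRing A] {𝔫 : Ideal A} {m n K : ℕ}
  {l : Fin n → ℤ} {B : Matrix ℤ ℤ A[X]}

/-- The power series `x` is `(-1)ⁿ det B_{μ,b} det B_{a,ν} / h`, where `h` is the unit in the
Weierstrass factorization of `det B_{μ,ν}`. -/
def IsRatio (𝔫 : Ideal A) (n : ℕ) (B : Matrix ℤ ℤ A[X]) (a b μ ν : ℤ) (x : PowerSeries A) :
    Prop :=
  ∃ W h, WFact 𝔫 n (dser B μ ν) W h ∧ h * x = (-1) ^ n * (dser B μ b * dser B a ν)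

theorem WFact.exists_isRatio {μ ν : ℤ} {W : A[X]} {h : PowerSeries A}
    (H : WFact 𝔫 n (dser B μ ν) W h) (a b : ℤ) : ∃ x, IsRatio 𝔫 n B a b μ ν x := by
  obtain ⟨u, rfl⟩ := H.isUnit
  exact ⟨(u⁻¹ : (PowerSeries A)ˣ).1 * ((-1) ^ n * (dser B μ b * dser B a ν)), W, u, H, by
    rw [← mul_assoc, Units.mul_inv, one_mul]⟩

theorem IsRatio.map {A' : Type*} [CommRing A'] (g : A →+* A') {𝔫' : Ideal A'}
    (hle : 𝔫 ≤ 𝔫'.comap g) {a b μ ν : ℤ} {x : PowerSeries A} (H : IsRatio 𝔫 n B a b μ ν x) :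
    IsRatio 𝔫' n (B.map (mapRingHom g)) a b μ ν (x.map g) := by
  obtain ⟨W, h, hW, hx⟩ := H
  refine ⟨W.map g, h.map g, map_dser g B μ ν ▸ hW.map g hle, ?_⟩
  rw [← map_mul, hx, ← map_dser, ← map_dser]
  simp

/-- Both factorizations have the same `W`, which cancels from `Banded.ratio_eq` because it is
distinguished. The units `h` and `h'` then cancel as well. -/
theorem IsRatio.unique [Algebra ℚ A] (hB : Banded 𝔫 m l B) (h𝔫 : 𝔫 ^ K = ⊥) {L : ℤ} (hL0 : 0 ≤ L)
    (hL : ∀ s, -L < l s ∧ l s < L) {a b μ μ' ν ν' : ℤ}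
    (hμ : μ ≤ -(m * K + L + |a| + |b|)) (hμ' : μ' ≤ -(m * K + L + |a| + |b|))
    (hν : m * K + L + |a| + |b| ≤ ν) (hν' : m * K + L + |a| + |b| ≤ ν')
    {x x' : PowerSeries A} (H : IsRatio 𝔫 n B a b μ ν x) (H' : IsRatio 𝔫 n B a b μ' ν' x') :
    x = x' := by
  obtain ⟨W, h, hW, hx⟩ := H
  obtain ⟨W', h', hW', hx'⟩ := H'
  have ha := abs_nonneg a
  have hb := abs_nonneg b
  have ha' := neg_abs_le a
  have hb' := neg_abs_le b
  have ha'' := le_abs_self a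
  have hb'' := le_abs_self b
  have hmK : (0 : ℤ) ≤ m * K := by positivity
  obtain rfl := hB.wFact_eq h𝔫 hL0 hL (by omega) (by omega) (by omega) (by omega) hW hW'
  have h1 := hB.ratio_eq h𝔫 (μ := μ) (μ' := μ') (ν := ν) (ν' := ν') (a := a) (b := b)
    (by omega) (by omega) (by omega) (by omega) (by omega) (by omega)
  rw [hW.eq, hW'.eq] at h1
  have h2 : (W : PowerSeries A) * (h' * (dser B μ b * dser B a ν)) =
      W * (h * (dser B μ' b * dser B a ν')) := by linear_combination h1
  have h3 := hW.distinguished.mul_cancel h𝔫 h2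
  refine (hW.isUnit.mul hW'.isUnit).mul_left_cancel ?_
  linear_combination h' * hx - h * hx' + (-1) ^ n * h3

end Ratio

/-! ### Gluing Weierstrass factorizations and ratios over the levels. -/

section Levels

variable {R : Type*} [CommRing R] (I : Ideal R) {n m : ℕ} {l : Fin n → ℤ} {q : ℤ → R[X]}
  {B : Matrix ℤ ℤ R[X]}

/-- The matrix `B` modulo `I ^ K`. -/
def levelMat (B : Matrix ℤ ℤ R[X]) (K : ℕ) : Matrix ℤ ℤ (Level I K)[X] :=
  B.map (mapRingHom (toLevel I K))

variable {I} in
theorem IsAdmissible.banded_levelMat (hB : IsAdmissible I m l q B) (K : ℕ) :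
    Banded (I.map (toLevel I K)) m l (levelMat I B K) :=
  hB.banded.map _ Ideal.le_comap_map

theorem map_detSeries (B : Matrix ℤ ℤ R[X]) (a b : ℤ) (K : ℕ) :
    (detSeries I B a b).map (evalLevel I K) = dser (levelMat I B K) a b := by
  rw [levelMat, ← map_dser, ← toLevel_comp, detSeries]
  ext i
  simp only [PowerSeries.coeff_map, Polynomial.coeff_coe, coeff_map, dser, RingHom.comp_apply]
  rfl

theorem levelMat_map_levelMap {K K' : ℕ} (h : K ≤ K') :
    (levelMat I B K').map (mapRingHom (levelMap I h)) = levelMat I B K := by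
  ext1 i j
  simp only [levelMat, Matrix.map_apply, coe_mapRingHom, Polynomial.map_map, levelMap_toLevel]

theorem map_levelMap_le {K K' : ℕ} (h : K ≤ K') :
    I.map (toLevel I K') ≤ (I.map (toLevel I K)).comap (levelMap I h) := by
  rw [Ideal.map_le_iff_le_comap, Ideal.comap_comap, levelMap_toLevel]
  exact Ideal.le_comap_map

theorem detLaurent_eq (B : Matrix ℤ ℤ R[X]) (a b : ℤ) (K : ℕ) :
    detLaurent I B a b K = HahnSeries.ofPowerSeries ℤ _ (dser (levelMat I B K) a b) := by
  rw [dser, levelMat, ← map_idet]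
  rfl

variable {I} in
theorem IsAdmissible.isUnit_detLaurent (hB : IsAdmissible I m l q B) (a b : ℤ) (K : ℕ) :
    IsUnit (detLaurent I B a b K) := by
  rw [detLaurent_eq]
  exact (hB.banded_levelMat K).isUnit_polyToLaurent_idet (map_toLevel_pow I K) a b

variable {I} in
theorem IsAdmissible.exists_wFact (hB : IsAdmissible I m l q B) {μ ν : ℤ}
    (hl : ∀ s, l s ∈ Finset.Icc μ ν) (K : ℕ) :
    ∃ W h, WFact (I.map (toLevel I K)) n (dser (levelMat I B K) μ ν) W h :=
  (hB.banded_levelMat K).exists_wFact (map_toLevel_pow I K) hl fun _ _ _ hi =>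
    isUnit_intCast (sub_ne_zero.2 hi)

theorem map_levelMap_map_evalLevel {K K' : ℕ} (h : K ≤ K') (f : PowerSeries (Completion I)) :
    (f.map (evalLevel I K')).map (levelMap I h) = f.map (evalLevel I K) := by
  ext i
  simp only [PowerSeries.coeff_map, levelMap_evalLevel]

theorem exists_polynomial_of_compatible (c : ∀ K, (Level I K)[X])
    (hn : ∀ K, (c K).natDegree ≤ n)
    (hc : ∀ K, (c (K + 1)).map (levelMap I (Nat.le_succ K)) = c K) :
    ∃ P : (Completion I)[X], ∀ K, P.map (evalLevel I K) = c K := by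
  choose x hx using fun i => exists_of_compatible I (fun K => (c K).coeff i)
    fun K => by rw [← coeff_map, hc]
  refine ⟨∑ i ∈ Finset.range (n + 1), C (x i) * X ^ i, fun K => ?_⟩
  rw [(c K).as_sum_range' (n + 1) (Nat.lt_succ_of_le (hn K)), Polynomial.map_sum]
  refine Finset.sum_congr rfl fun i _ => ?_
  rw [Polynomial.map_mul, map_C, hx, Polynomial.map_pow, map_X, C_mul_X_pow_eq_monomial]

/-- Uniqueness at each level makes the factorizations compatible. -/
theorem exists_wFact_completion (f : PowerSeries (Completion I))
    (hf : ∀ K, ∃ W h, WFact (I.map (toLevel I K)) n (f.map (evalLevel I K)) W h) :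
    ∃ (W : (Completion I)[X]) (h : PowerSeries (Completion I)), ∀ K, WFact (I.map (toLevel I K)) n (f.map (evalLevel I K))
      (W.map (evalLevel I K)) (h.map (evalLevel I K)) := by
  choose W h H using hf
  have key : ∀ K, (W (K + 1)).map (levelMap I (Nat.le_succ K)) = W K ∧
      (h (K + 1)).map (levelMap I (Nat.le_succ K)) = h K := fun K => by
    have h1 := (H (K + 1)).map (levelMap I (Nat.le_succ K)) (map_levelMap_le I _)
    rw [map_levelMap_map_evalLevel] at h1
    exact h1.unique (map_toLevel_pow I K) (H K)
  obtain ⟨W', hW'⟩ := exists_polynomial_of_compatible I W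
    (fun K => (H K).distinguished.natDegree_le) fun K => (key K).1
  obtain ⟨h', hh'⟩ := exists_powerSeries_of_compatible I h fun K => (key K).2
  refine ⟨W', h', fun K => ?_⟩
  rw [hW', hh']
  exact H K

variable {I} in
theorem distinguished_of_levels [Nontrivial (Level I 1)] {P : (Completion I)[X]}
    (h : ∀ K, Distinguished (I.map (toLevel I K)) n (P.map (evalLevel I K))) :
    P.IsDistinguishedAt (augIdeal I) ∧ P.natDegree = n := by
  have hle : P.natDegree ≤ n := natDegree_le_iff_coeff_eq_zero.2 fun i hi =>
    completion_ext I fun K => by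
      rw [← coeff_map, map_zero]
      exact coeff_eq_zero_of_natDegree_lt ((h K).natDegree_le.trans_lt hi)
  have h1 : P.coeff n = 1 := completion_ext I fun K => by
    rw [← coeff_map, map_one]
    exact (h K).coeff_top
  have : Nontrivial (Completion I) := (evalLevel I 1).domain_nontrivial
  have hdeg : P.natDegree = n := natDegree_eq_of_le_of_coeff_ne_zero hle (h1 ▸ one_ne_zero)
  refine ⟨⟨⟨fun {i} hi => ?_⟩, monic_of_natDegree_le_of_coeff_eq_one n hle h1⟩, hdeg⟩
  rw [← mem_map_toLevel_iff I le_rfl, ← coeff_map]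
  exact (h 1).coeff_mem i (hdeg ▸ hi)

variable {I} in
theorem isWeierstrassPolynomial_iff [Nontrivial (Level I 1)] {f h : PowerSeries (Completion I)}
    {W : (Completion I)[X]} (H : ∀ K, WFact (I.map (toLevel I K)) n (f.map (evalLevel I K))
      (W.map (evalLevel I K)) (h.map (evalLevel I K))) (P : (Completion I)[X]) :
    IsWeierstrassPolynomial I f P ↔ P = W := by
  constructor
  · rintro ⟨u, hP⟩
    have hmem : ∀ i < P.natDegree, ∀ K, evalLevel I K (P.coeff i) ∈ I.map (toLevel I K) :=
      fun i hi K => augIdeal_le I K (hP.isDistinguishedAt.mem hi)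
    have hD : ∀ K, WFact (I.map (toLevel I K)) P.natDegree (f.map (evalLevel I K))
        (P.map (evalLevel I K)) (u.map (evalLevel I K)) := fun K =>
      { distinguished :=
          { natDegree_le := natDegree_map_le
            coeff_top := by
              rw [coeff_map, coeff_natDegree, hP.isDistinguishedAt.monic.leadingCoeff, map_one]
            coeff_mem := fun i hi => by rw [coeff_map]; exact hmem i hi K }
        isUnit := hP.isUnit.map _
        eq := by rw [hP.eq_mul, map_mul, Polynomial.polynomial_map_coe] }
    -- The degree of `P` is not prescribed. At level one the ideal is zero, a distinguished
    -- polynomial is a power of `X`, and its degree is the order of the series.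
    have hbot : I.map (toLevel I 1) = ⊥ := (pow_one _).symm.trans (map_toLevel_pow I 1)
    have hX : ∀ {d : ℕ} {g v : PowerSeries (Level I 1)} {Q : (Level I 1)[X]},
        WFact (I.map (toLevel I 1)) d g Q v → g.order = d := by
      intro d g v Q hQ
      have hQX : Q = X ^ d := by
        ext i
        rw [coeff_X_pow]
        rcases lt_trichotomy i d with hi | rfl | hi
        · rw [if_neg hi.ne]
          have := hQ.distinguished.coeff_mem i hi
          rwa [hbot, Ideal.mem_bot] at this
        · rw [if_pos rfl, hQ.distinguished.coeff_top]
        · rw [if_neg hi.ne']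
          exact coeff_eq_zero_of_natDegree_lt (hQ.distinguished.natDegree_le.trans_lt hi)
      rw [PowerSeries.order_eq_nat, hQ.eq, hQX, Polynomial.coe_pow, Polynomial.coe_X]
      constructor
      · rw [PowerSeries.coeff_X_pow_mul', if_pos le_rfl, Nat.sub_self,
          PowerSeries.coeff_zero_eq_constantCoeff_apply]
        exact (hQ.isUnit.map (PowerSeries.constantCoeff (R := Level I 1))).ne_zero
      · intro i hi
        rw [PowerSeries.coeff_X_pow_mul', if_neg (not_le.2 hi)]
    have hn : P.natDegree = n := by exact_mod_cast (hX (hD 1)).symm.trans (hX (H 1))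
    rw [hn] at hD
    exact polynomial_completion_ext I fun K => ((hD K).unique (map_toLevel_pow I K) (H K)).1
  · rintro rfl
    exact ⟨h, (distinguished_of_levels fun K => (H K).distinguished).1,
      isUnit_of_isUnit_map I fun K => (H K).isUnit, powerSeries_completion_ext I fun K => by
        rw [(H K).eq, map_mul, Polynomial.polynomial_map_coe]⟩

variable {I} in
/-- The stable values of the Weierstrass polynomials of `det B_{μ,ν}`. -/
theorem IsAdmissible.exists_limit_wFact (hB : IsAdmissible I m l q B) {L : ℤ} (hL0 : 0 ≤ L)
    (hL : ∀ s, -L < l s ∧ l s < L) :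
    ∃ w : (Completion I)[X], ∀ K : ℕ, ∀ μ ν : ℤ, μ ≤ -(m * K + L) → m * K + L ≤ ν →
      ∃ h, WFact (I.map (toLevel I K)) n (dser (levelMat I B K) μ ν)
        (w.map (evalLevel I K)) h := by
  have hl : ∀ (K : ℕ) s, l s ∈ Finset.Icc (-(m * K + L)) (m * K + L) := fun K s => by
    have := hL s
    have hmK : (0 : ℤ) ≤ m * K := by positivity
    rw [Finset.mem_Icc]; omega
  choose W h H using fun K => hB.exists_wFact (hl K) K
  have hst : ∀ K : ℕ, ∀ μ ν : ℤ, μ ≤ -(m * K + L) → m * K + L ≤ ν →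
      ∃ h, WFact (I.map (toLevel I K)) n (dser (levelMat I B K) μ ν) (W K) h := by
    intro K μ ν hμ hν
    obtain ⟨W', h', H'⟩ := hB.exists_wFact (μ := μ) (ν := ν) (fun s => by
      have := Finset.mem_Icc.1 (hl K s)
      rw [Finset.mem_Icc]; omega) K
    obtain rfl := (hB.banded_levelMat K).wFact_eq (map_toLevel_pow I K) hL0 hL hμ le_rfl hν le_rfl
      H' (H K)
    exact ⟨h', H'⟩
  obtain ⟨w, hw⟩ := exists_polynomial_of_compatible I W
    (fun K => (H K).distinguished.natDegree_le) fun K => by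
      have h1 := (H (K + 1)).map (levelMap I (Nat.le_succ K)) (map_levelMap_le I _)
      rw [map_dser, levelMat_map_levelMap] at h1
      have hle : (m * K + L : ℤ) ≤ m * (K + 1 : ℕ) + L := by push_cast; nlinarith
      obtain ⟨h', H'⟩ := hst K _ _ (neg_le_neg hle) hle
      exact (h1.unique (map_toLevel_pow I K) H').1
  refine ⟨w, fun K μ ν hμ hν => ?_⟩
  rw [hw]
  exact hst K μ ν hμ hν

variable {I} in
theorem IsAdmissible.exists_limit_isRatio (hB : IsAdmissible I m l q B) {L : ℤ} (hL0 : 0 ≤ L)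
    (hL : ∀ s, -L < l s ∧ l s < L) (a b : ℤ) :
    ∃ F : PowerSeries (Completion I), ∀ K : ℕ, ∀ μ ν : ℤ,
      μ ≤ -(m * K + L + |a| + |b|) → m * K + L + |a| + |b| ≤ ν →
      IsRatio (I.map (toLevel I K)) n (levelMat I B K) a b μ ν (F.map (evalLevel I K)) := by
  have ha := abs_nonneg a
  have hb := abs_nonneg b
  have hl : ∀ (K : ℕ) (μ ν : ℤ), μ ≤ -(m * K + L + |a| + |b|) → m * K + L + |a| + |b| ≤ ν →
      ∀ s, l s ∈ Finset.Icc μ ν := fun K μ ν hμ hν s => by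
    have := hL s
    have hmK : (0 : ℤ) ≤ m * K := by positivity
    rw [Finset.mem_Icc]; omega
  have hex : ∀ (K : ℕ) (μ ν : ℤ), μ ≤ -(m * K + L + |a| + |b|) → m * K + L + |a| + |b| ≤ ν →
      ∃ x, IsRatio (I.map (toLevel I K)) n (levelMat I B K) a b μ ν x := fun K μ ν hμ hν => by
    obtain ⟨W, h, H⟩ := hB.exists_wFact (hl K μ ν hμ hν) K
    exact H.exists_isRatio a b
  choose x hx using fun K => hex K _ _ le_rfl le_rfl
  have hst : ∀ K : ℕ, ∀ μ ν : ℤ, μ ≤ -(m * K + L + |a| + |b|) → m * K + L + |a| + |b| ≤ ν →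
      IsRatio (I.map (toLevel I K)) n (levelMat I B K) a b μ ν (x K) := by
    intro K μ ν hμ hν
    obtain ⟨x', hx'⟩ := hex K μ ν hμ hν
    rwa [(hx K).unique (hB.banded_levelMat K) (map_toLevel_pow I K) hL0 hL le_rfl hμ le_rfl hν hx']
  obtain ⟨F, hF⟩ := exists_powerSeries_of_compatible I x fun K => by
    have h1 := (hx (K + 1)).map (levelMap I (Nat.le_succ K)) (map_levelMap_le I _)
    rw [levelMat_map_levelMap] at h1
    have hle : (m * K + L + |a| + |b| : ℤ) ≤ m * (K + 1 : ℕ) + L + |a| + |b| := by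
      push_cast; nlinarith
    exact h1.unique (hB.banded_levelMat K) (map_toLevel_pow I K) hL0 hL (neg_le_neg hle) le_rfl
      hle le_rfl (hx K)
  refine ⟨F, fun K μ ν hμ hν => ?_⟩
  rw [hF]
  exact hst K μ ν hμ hν

variable {I} in
-- Dividing by the unit `h` is the same as multiplying by `W` and dividing by `det B_{μ,ν} = W h`,
-- which is legitimate among Laurent series.
theorem IsRatio.ofPowerSeries_eq (hB : IsAdmissible I m l q B) {K : ℕ} {a b μ ν : ℤ}
    {W : (Level I K)[X]} {h : PowerSeries (Level I K)}
    (hW : WFact (I.map (toLevel I K)) n (dser (levelMat I B K) μ ν) W h)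
    {x : PowerSeries (Level I K)} (hx : IsRatio (I.map (toLevel I K)) n (levelMat I B K) a b μ ν x) :
    HahnSeries.ofPowerSeries ℤ (Level I K) x = (-1) ^ n * polyToLaurent (Level I K) W *
      (detLaurent I B μ b K * detLaurent I B a ν K * Ring.inverse (detLaurent I B μ ν K)) := by
  obtain ⟨W', h', hW', hx⟩ := hx
  obtain ⟨rfl, rfl⟩ := hW.unique (map_toLevel_pow I K) hW'
  have hu := hB.isUnit_detLaurent μ ν K
  refine hu.mul_left_cancel ?_
  have h2 : detLaurent I B μ ν K * Ring.inverse (detLaurent I B μ ν K) = 1 :=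
    Ring.mul_inverse_cancel _ hu
  have h1 : detLaurent I B μ ν K =
      polyToLaurent _ W * HahnSeries.ofPowerSeries ℤ _ h := by
    rw [detLaurent_eq, hW.eq, map_mul]; rfl
  have h3 := congrArg (HahnSeries.ofPowerSeries ℤ (Level I K)) hx
  simp only [map_mul, map_pow, map_neg, map_one, ← detLaurent_eq] at h3
  linear_combination HahnSeries.ofPowerSeries ℤ _ x * h1 + polyToLaurent _ W * h3 -
    (-1) ^ n * polyToLaurent (Level I K) W * detLaurent I B μ b K * detLaurent I B a ν K * h2

end Levels

theorem map_eq_zero_of_map_exp {P Q : Type*} [CommRing P] [CommRing Q] [Algebra ℚ P] [Algebra ℚ Q]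
    (g : P →+* Q) {x : P} (hx : IsNilpotent x) (h : g (IsNilpotent.exp x) = 1) : g x = 0 :=
  eq_zero_of_exp_eq_one (hx.map g) ((IsNilpotent.map_exp hx g).symm.trans h)

theorem mem_of_exp_sub_one_mem {P : Type*} [CommRing P] [Algebra ℚ P] {J : Ideal P} {x : P}
    (hx : IsNilpotent x) (h : IsNilpotent.exp x - 1 ∈ J) : x ∈ J := by
  rw [← Ideal.Quotient.eq_zero_iff_mem]
  refine map_eq_zero_of_map_exp (Ideal.Quotient.mk J) hx ?_
  rwa [← map_one (Ideal.Quotient.mk J), Ideal.Quotient.mk_eq_mk_iff_sub_mem]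

/-! ### Nilpotency of the matrices under the logarithm. -/

section NilpotentMatrices

variable {S : Type*} [CommRing S] {ι : Type*} [Fintype ι] [DecidableEq ι]

theorem matrix_pow_mem {J : Ideal S} {Y : Matrix ι ι S} (h : ∀ i j, Y i j ∈ J) (k : ℕ) (i j : ι) :
    (Y ^ k) i j ∈ J ^ k := by
  induction k generalizing i j with
  | zero => rw [pow_zero, Ideal.one_eq_top]; trivial
  | succ k ih =>
    rw [pow_succ Y, pow_succ J, Matrix.mul_apply]
    exact sum_mem fun x _ => Ideal.mul_mem_mul (ih i x) (h x j)

theorem isNilpotent_of_strictlyLower [LinearOrder ι] {J : Ideal S} {K : ℕ} (hJ : J ^ K = ⊥)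
    {Y : Matrix ι ι S} (h : ∀ i j, i ≤ j → Y i j ∈ J) : IsNilpotent Y := by
  -- Modulo `J` the transpose is strictly upper triangular, so its characteristic polynomial is a
  -- power of `X` and Cayley–Hamilton applies.
  set Z := (Y.map (Ideal.Quotient.mk J)).transpose with hZ
  have h0 : ∀ i j, i ≤ j → Z j i = 0 := fun i j hij => Ideal.Quotient.eq_zero_iff_mem.2 (h i j hij)
  have h1 : Z ^ Fintype.card ι = 0 := by
    have h2 := Z.aeval_self_charpoly
    rw [Matrix.charpoly_of_isUpperTriangular Z fun i j hij => h0 j i (le_of_lt hij)] at h2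
    simpa [h0] using h2
  have h3 : ∀ i j, (Y ^ Fintype.card ι) i j ∈ J := fun i j => by
    rw [← Ideal.Quotient.eq_zero_iff_mem]
    have h4 : ((Ideal.Quotient.mk J).mapMatrix Y) ^ Fintype.card ι = 0 := by
      rw [hZ, ← Matrix.transpose_pow, Matrix.transpose_eq_zero] at h1
      exact h1
    rw [← map_pow] at h4
    exact congrFun (congrFun h4 i) j
  refine ⟨Fintype.card ι * K, ?_⟩
  ext i j
  rw [pow_mul]
  have := matrix_pow_mem h3 K i j
  rwa [hJ, Ideal.mem_bot] at this

end NilpotentMatrices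

/-! ### Traces of logarithms of finite sections. -/

section Logarithm

variable {A : Type*} [CommRing A] {𝔫 : Ideal A} {m n K : ℕ}
  {l : Fin n → ℤ} {B : Matrix ℤ ℤ A[X]}

/-- The matrix obtained from `B` on dividing the `j`-th column by `∏ₛ (ε + j - lₛ)`. -/
def normMat (l : Fin n → ℤ) (B : Matrix ℤ ℤ A[X]) : Matrix ℤ ℤ (PartialFractions A) := fun i j =>
  Localization.mk (B i j)
    ⟨∏ s, (X - C ((l s - j : ℤ) : A)), prod_mem fun s _ => X_sub_mem (l s - j)⟩

theorem normMat_mul (l : Fin n → ℤ) (B : Matrix ℤ ℤ A[X]) (i j : ℤ) :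
    normMat l B i j * algebraMap A[X] (PartialFractions A) (∏ s, (X + C ((j - l s : ℤ) : A))) =
      algebraMap A[X] (PartialFractions A) (B i j) := by
  have h1 : ∏ s, (X + C ((j - l s : ℤ) : A)) = ∏ s, (X - C ((l s - j : ℤ) : A)) :=
    Finset.prod_congr rfl fun s _ => by rw [← neg_sub j (l s), Int.cast_neg, C_neg, sub_neg_eq_add]
  rw [h1, normMat, Localization.mk_eq_mk']
  exact IsLocalization.mk'_spec (PartialFractions A) (B i j) ⟨_, _⟩

theorem isUnit_algebraMap_diag (l : Fin n → ℤ) (j : ℤ) :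
    IsUnit (algebraMap A[X] (PartialFractions A) (∏ s, (X + C ((j - l s : ℤ) : A)))) :=
  IsLocalization.map_units (M := linearFactors A) (PartialFractions A)
    ⟨∏ s, (X + C ((j - l s : ℤ) : A)), prod_mem fun _ _ => X_add_mem _⟩

theorem isUnit_algebraMap_diagProd (l : Fin n → ℤ) (a b : ℤ) :
    IsUnit (algebraMap A[X] (PartialFractions A) (diagProd A l a b)) :=
  IsLocalization.map_units (M := linearFactors A) _ ⟨_, diagProd_mem l a b⟩

theorem det_sect_normMat (l : Fin n → ℤ) (B : Matrix ℤ ℤ A[X]) (a b : ℤ) :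
    (sect (normMat l B) a b).det * algebraMap A[X] (PartialFractions A) (diagProd A l a b) =
      algebraMap A[X] (PartialFractions A) (idet B a b) := by
  rw [map_idet, diagProd, map_prod, ← Finset.prod_coe_sort, mul_comm, ← Matrix.det_mul_row, idet]
  congr 1
  ext1 i j
  rw [Matrix.of_apply, mul_comm]
  exact normMat_mul l B i j

theorem Banded.normMat_sub_one_mem (hB : Banded 𝔫 m l B) {i j : ℤ} (hij : i ≤ j) :
    (normMat l B - 1) i j ∈ (𝔫.map C).map (algebraMap A[X] (PartialFractions A)) := by
  obtain ⟨u, hu⟩ := isUnit_algebraMap_diag (A := A) l j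
  rw [← Ideal.mul_unit_mem_iff_mem _ u.isUnit, hu, Matrix.sub_apply, sub_mul, normMat_mul]
  rcases hij.lt_or_eq with h | rfl
  · rw [Matrix.one_apply_ne h.ne, zero_mul, sub_zero]
    exact Ideal.mem_map_of_mem _ (hB.upper i j h)
  · rw [Matrix.one_apply_eq, one_mul, ← map_sub]
    exact Ideal.mem_map_of_mem _ (hB.diag i)

theorem Banded.isNilpotent_sect (hB : Banded 𝔫 m l B) (h𝔫 : 𝔫 ^ K = ⊥) (a b : ℤ) :
    IsNilpotent (sect (normMat l B) a b - 1) := by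
  refine isNilpotent_of_strictlyLower
    (map_pow_eq_bot (algebraMap A[X] (PartialFractions A)) (map_pow_eq_bot (C (R := A)) h𝔫))
    fun i j hij => ?_
  have := hB.normMat_sub_one_mem (i := i) (j := j) hij
  convert this using 1
  simp only [Matrix.sub_apply, sect, Matrix.submatrix_apply, Matrix.one_apply, Subtype.ext_iff]

theorem diagProd_cross (l : Fin n → ℤ) (e : ℤ) {a a' b b' : ℤ}
    (ha : a ≤ e) (ha' : a' ≤ e) (hb : e ≤ b + 1) (hb' : e ≤ b' + 1) :
    diagProd A l a b * diagProd A l a' b' = diagProd A l a' b * diagProd A l a b' := by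
  have key : ∀ x y, x ≤ e → e ≤ y + 1 →
      diagProd A l x y = diagProd A l x (e - 1) * diagProd A l e y := by
    intro x y hx hy
    rw [diagProd, diagProd, diagProd, ← Finset.prod_union]
    · congr 1
      ext i
      simp only [Finset.mem_Icc, Finset.mem_union]
      omega
    · rw [Finset.disjoint_left]
      intro i hi
      simp only [Finset.mem_Icc] at hi ⊢
      omega
  rw [key a b ha hb, key a' b' ha' hb', key a' b ha' hb, key a b' ha hb']
  ring

variable [Algebra ℚ A]

/-- The trace of the logarithm of a finite section. -/
def trLog (l : Fin n → ℤ) (B : Matrix ℤ ℤ A[X]) (a b : ℤ) : PartialFractions A :=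
  (matLog (sect (normMat l B) a b)).trace

theorem Banded.isNilpotent_trLog (hB : Banded 𝔫 m l B) (h𝔫 : 𝔫 ^ K = ⊥) (a b : ℤ) :
    IsNilpotent (trLog l B a b) := isNilpotent_trace_matLog (hB.isNilpotent_sect h𝔫 a b)

theorem Banded.exp_trLog (hB : Banded 𝔫 m l B) (h𝔫 : 𝔫 ^ K = ⊥) (a b : ℤ) :
    IsNilpotent.exp (trLog l B a b) *
      algebraMap A[X] (PartialFractions A) (diagProd A l a b) =
        algebraMap A[X] (PartialFractions A) (idet B a b) := by
  rw [trLog, exp_trace_matLog (hB.isNilpotent_sect h𝔫 a b), det_sect_normMat]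

/-- The exponential is injective on nilpotent elements, and the exponentiated identity is the
quotient of the cross relations for determinants and for diagonal products. -/
theorem Banded.trLog_cross (hB : Banded 𝔫 m l B) (h𝔫 : 𝔫 ^ K = ⊥) (e : ℤ) {a a' b b' : ℤ}
    (ha : a ≤ e) (ha' : a' ≤ e) (hb : e + m * K ≤ b + 1) (hb' : e + m * K ≤ b' + 1) :
    trLog l B a b + trLog l B a' b' = trLog l B a' b + trLog l B a b' := by
  have hmK : (0 : ℤ) ≤ m * K := by positivity
  have hn := hB.isNilpotent_trLog h𝔫
  refine exp_injOn ((Commute.all _ _).isNilpotent_add (hn _ _) (hn _ _))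
    ((Commute.all _ _).isNilpotent_add (hn _ _) (hn _ _)) ?_
  rw [IsNilpotent.exp_add_of_commute (Commute.all _ _) (hn _ _) (hn _ _),
    IsNilpotent.exp_add_of_commute (Commute.all _ _) (hn _ _) (hn _ _)]
  refine ((isUnit_algebraMap_diagProd (A := A) l a b).mul
    (isUnit_algebraMap_diagProd (A := A) l a' b')).mul_right_cancel ?_
  have h1 := congrArg (algebraMap A[X] (PartialFractions A)) (hB.cross h𝔫 e ha ha' hb hb')
  have h2 := congrArg (algebraMap A[X] (PartialFractions A))
    (diagProd_cross (A := A) l e ha ha' (b := b) (b' := b') (by omega) (by omega))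
  rw [map_mul, map_mul] at h1 h2
  rw [← hB.exp_trLog h𝔫, ← hB.exp_trLog h𝔫, ← hB.exp_trLog h𝔫, ← hB.exp_trLog h𝔫] at h1
  linear_combination h1 - IsNilpotent.exp (trLog l B a' b) * IsNilpotent.exp (trLog l B a b') * h2

theorem Banded.trLog_mem (hB : Banded 𝔫 m l B) (h𝔫 : 𝔫 ^ K = ⊥) (a b : ℤ) :
    trLog l B a b ∈ (𝔫.map C).map (algebraMap A[X] (PartialFractions A)) := by
  set J := (𝔫.map C).map (algebraMap A[X] (PartialFractions A))
  refine mem_of_exp_sub_one_mem (hB.isNilpotent_trLog h𝔫 a b) ?_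
  rw [← Ideal.mul_unit_mem_iff_mem _ (isUnit_algebraMap_diagProd (A := A) l a b), sub_mul,
    hB.exp_trLog h𝔫, one_mul, ← map_sub]
  exact Ideal.mem_map_of_mem _ (hB.idet_sub_diagProd_mem a b)

end Logarithm

set_option linter.overlappingInstances false in
-- Laurent series carry a `ℚ`-module structure that need not be syntactically the one of the
-- algebra; any two agree.
theorem exp_injOn_of_module {P : Type*} [CommRing P] [Algebra ℚ P] [mod : Module ℚ P] {x y : P}
    (hx : IsNilpotent x) (hy : IsNilpotent y)
    (h : @IsNilpotent.exp P _ mod x = @IsNilpotent.exp P _ mod y) : x = y := by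
  obtain rfl : mod = Algebra.toModule := Subsingleton.elim _ _
  exact exp_injOn hx hy h

/-! ### Laurent series with coefficients in an ideal. -/

section LaurentIdeals

variable {A : Type*} [CommRing A] {𝔫 : Ideal A} {K : ℕ}

/-- The ideal of Laurent series with coefficients in `𝔫`. -/
def laurentIdeal (𝔫 : Ideal A) : Ideal (LaurentSeries A) where
  carrier := {x | ∀ k, x.coeff k ∈ 𝔫}
  add_mem' hx hy k := 𝔫.add_mem (hx k) (hy k)
  zero_mem' _ := 𝔫.zero_mem
  smul_mem' c x hx k := by
    rw [smul_eq_mul, HahnSeries.coeff_mul]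
    exact sum_mem fun _ _ => 𝔫.mul_mem_left _ (hx _)

theorem pow_mem_laurentIdeal {x : LaurentSeries A} (hx : x ∈ laurentIdeal 𝔫) (k : ℕ) :
    x ^ k ∈ laurentIdeal (𝔫 ^ k) := by
  induction k with
  | zero => rw [pow_zero, pow_zero, Ideal.one_eq_top]; exact fun _ => trivial
  | succ k ih =>
    intro i
    rw [pow_succ x, pow_succ 𝔫, HahnSeries.coeff_mul]
    exact sum_mem fun _ _ => Ideal.mul_mem_mul (ih _) (hx _)

theorem pow_eq_zero_of_mem_laurentIdeal (h𝔫 : 𝔫 ^ K = ⊥) {x : LaurentSeries A}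
    (hx : x ∈ laurentIdeal 𝔫) : x ^ K = 0 := by
  have := pow_mem_laurentIdeal hx K
  rw [h𝔫] at this
  ext k
  exact this k

theorem principalPart_coeff (x : LaurentSeries A) (k : ℤ) :
    (principalPart x).coeff k = if k < 0 then x.coeff k else 0 := by
  simp only [principalPart, HahnSeries.coe_truncLTLinearMap, HahnSeries.coeff_truncLT]

theorem principalPart_mem {x : LaurentSeries A} (hx : x ∈ laurentIdeal 𝔫) :
    principalPart x ∈ laurentIdeal 𝔫 := fun k => by
  rw [principalPart_coeff]
  split_ifs
  exacts [hx k, 𝔫.zero_mem]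

theorem exists_sub_principalPart_eq (x : LaurentSeries A) :
    ∃ f : PowerSeries A, x - principalPart x = HahnSeries.ofPowerSeries ℤ A f := by
  refine ⟨PowerSeries.mk fun i => x.coeff i, ?_⟩
  ext k
  rw [PowerSeries.coeff_coe, HahnSeries.coeff_sub, principalPart_coeff]
  split_ifs with h
  · exact sub_self _
  · rw [PowerSeries.coeff_mk, sub_zero, Int.natAbs_of_nonneg (not_lt.1 h)]

/-- The Laurent series with coefficients in `𝔫` and only negative exponents. -/
def polarPart (𝔫 : Ideal A) : AddSubmonoid (LaurentSeries A) where
  carrier := {x | x ∈ laurentIdeal 𝔫 ∧ ∀ k, 0 ≤ k → x.coeff k = 0}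
  add_mem' hx hy := ⟨add_mem hx.1 hy.1, fun k hk => by
    rw [HahnSeries.coeff_add, hx.2 k hk, hy.2 k hk, add_zero]⟩
  zero_mem' := ⟨zero_mem _, fun _ _ => rfl⟩

theorem principalPart_mem_polarPart {x : LaurentSeries A} (hx : x ∈ laurentIdeal 𝔫) :
    principalPart x ∈ polarPart 𝔫 :=
  ⟨principalPart_mem hx, fun k hk => by rw [principalPart_coeff, if_neg (not_lt.2 hk)]⟩

theorem mul_mem_polarPart {x y : LaurentSeries A} (hx : x ∈ polarPart 𝔫) (hy : y ∈ polarPart 𝔫) :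
    x * y ∈ polarPart 𝔫 := by
  refine ⟨Ideal.mul_mem_left _ _ hy.1, fun k hk => ?_⟩
  rw [HahnSeries.coeff_mul]
  refine Finset.sum_eq_zero fun ij hij => ?_
  have h := (Finset.mem_antidiagonal.1 hij).2.2
  rcases le_or_gt 0 ij.1 with h1 | h1
  · rw [hx.2 _ h1, zero_mul]
  · rw [hy.2 _ (by omega), mul_zero]

theorem pow_mem_polarPart {x : LaurentSeries A} (hx : x ∈ polarPart 𝔫) (k : ℕ) :
    x ^ (k + 1) ∈ polarPart 𝔫 := by
  induction k with
  | zero => simpa using hx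
  | succ k ih => rw [pow_succ]; exact mul_mem_polarPart ih hx

theorem exp_sub_one_mem_polarPart [Algebra ℚ A] (h𝔫 : 𝔫 ^ K = ⊥) {x : LaurentSeries A}
    (hx : x ∈ polarPart 𝔫) : IsNilpotent.exp x - 1 ∈ polarPart 𝔫 := by
  have h0 : x ^ (K + 1) = 0 := by
    rw [pow_succ, pow_eq_zero_of_mem_laurentIdeal h𝔫 hx.1, zero_mul]
  rw [IsNilpotent.exp_eq_sum h0, Finset.sum_range_succ']
  simp only [pow_zero, Nat.factorial_zero, Nat.cast_one, inv_one, one_smul, add_sub_cancel_right]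
  refine sum_mem fun i _ => ⟨fun k => ?_, fun k hk => ?_⟩
  · rw [HahnSeries.coeff_smul, Algebra.smul_def]
    exact 𝔫.mul_mem_left _ ((pow_mem_polarPart hx i).1 k)
  · rw [HahnSeries.coeff_smul, (pow_mem_polarPart hx i).2 k hk, smul_zero]

end LaurentIdeals

/-! ### Principal parts of `tr log` and the operator `T`. -/

section PrincipalParts

variable {A : Type*} [CommRing A] {𝔫 : Ideal A} {m n K : ℕ}
  {l : Fin n → ℤ} {B : Matrix ℤ ℤ A[X]} [Algebra ℚ A]

theorem expandAt_algebraMap_eq (j : ℤ) (f : A[X]) :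
    expandAt j (algebraMap A[X] (PartialFractions A) f) =
      polyToLaurent A (f.comp (X + C (j : A))) := by
  rw [expandAt_algebraMap]; rfl

theorem isUnit_polyToLaurent_diagProd (l : Fin n → ℤ) (a b : ℤ) :
    IsUnit (polyToLaurent A (diagProd A l a b)) := by
  rw [← expandAt_zero_algebraMap]
  exact (isUnit_algebraMap_diagProd l a b).map _

theorem Banded.exp_expandAt_trLog (hB : Banded 𝔫 m l B) (h𝔫 : 𝔫 ^ K = ⊥) (j a b : ℤ) :
    IsNilpotent.exp (expandAt j (trLog l B a b)) *
      polyToLaurent A (diagProd A l (a + j) (b + j)) =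
        polyToLaurent A (idet B (a + j) (b + j)) := by
  rw [← IsNilpotent.map_exp (hB.isNilpotent_trLog h𝔫 a b) (expandAt (A := A) j), diagProd_shift,
    hB.idet_shift, ← expandAt_algebraMap_eq, ← expandAt_algebraMap_eq, ← map_mul, hB.exp_trLog h𝔫]

/-- Translation invariance turns poles at `j` into poles at `0` of a shifted section; it is checked
on exponentials. -/
theorem Banded.expandAt_trLog (hB : Banded 𝔫 m l B) (h𝔫 : 𝔫 ^ K = ⊥) (j a b : ℤ) :
    expandAt j (trLog l B a b) = expandAt 0 (trLog l B (a + j) (b + j)) := by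
  refine exp_injOn_of_module ((hB.isNilpotent_trLog h𝔫 _ _).map _) ((hB.isNilpotent_trLog h𝔫 _ _).map _)
    ((isUnit_polyToLaurent_diagProd l (a + j) (b + j)).mul_right_cancel ?_)
  have := hB.exp_expandAt_trLog h𝔫 0 (a + j) (b + j)
  rw [add_zero, add_zero] at this
  exact (hB.exp_expandAt_trLog h𝔫 j a b).trans this.symm

/-- If `[a, b]` contains none of the `lₛ`, the logarithm of the section has no pole at `0`. -/
theorem Banded.principalPart_trLog_eq_zero (hB : Banded 𝔫 m l B) (h𝔫 : 𝔫 ^ K = ⊥) {a b : ℤ}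
    (h : ∀ i ∈ Finset.Icc a b, ∀ s, i ≠ l s) :
    principalPart (expandAt 0 (trLog l B a b)) = 0 := by
  have hw : ∀ j : Finset.Icc a b,
      IsUnit ((∏ s, (X + C (((j : ℤ) - l s : ℤ) : A)) : A[X]) : PowerSeries A) := fun j => by
    rw [PowerSeries.isUnit_iff_constantCoeff, Polynomial.constantCoeff_coe,
      coeff_zero_eq_eval_zero, eval_prod]
    refine IsUnit.prod_iff.2 fun s _ => ?_
    rw [eval_add, eval_X, eval_C, zero_add]
    exact isUnit_intCast (sub_ne_zero.2 (h j j.2 s))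
  choose w hw using hw
  set φ := HahnSeries.ofPowerSeries ℤ A
  set Y := sect (normMat l B) a b
  -- No diagonal product vanishes at `0`, so the normalized section already exists over power
  -- series, and so does its logarithm.
  let Y' : Matrix (Finset.Icc a b) (Finset.Icc a b) (PowerSeries A) := fun i j =>
    ((B i j : A[X]) : PowerSeries A) * ((w j)⁻¹ : (PowerSeries A)ˣ).1
  have hY : φ.mapMatrix Y' = (expandAt 0).mapMatrix Y := by
    ext1 i j
    have h1 := congrArg (expandAt 0) (normMat_mul l B i j)
    rw [map_mul, expandAt_zero_algebraMap, expandAt_zero_algebraMap] at h1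
    refine ((w j).isUnit.map φ).mul_right_cancel ?_
    rw [RingHom.mapMatrix_apply, Matrix.map_apply, ← map_mul, mul_assoc, Units.inv_mul, mul_one, hw]
    exact h1.symm
  have hn := hB.isNilpotent_sect h𝔫 a b
  have hn' : IsNilpotent (Y' - 1) := by
    have h1 : Function.Injective (φ.mapMatrix (m := Finset.Icc a b)) := fun M N hMN => by
      ext1 i j
      exact HahnSeries.ofPowerSeries_injective (congrFun (congrFun hMN i) j)
    rw [← IsNilpotent.map_iff h1, map_sub, map_one, hY,
      ← map_one ((expandAt (A := A) 0).mapMatrix (m := Finset.Icc a b)), ← map_sub]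
    exact hn.map _
  have h2 : φ (matLog Y').trace = expandAt 0 (trLog l B a b) := by
    refine exp_injOn_of_module ((isNilpotent_trace_matLog hn').map φ) ((hB.isNilpotent_trLog h𝔫 _ _).map _) ?_
    refine ((IsNilpotent.map_exp (isNilpotent_trace_matLog hn') φ).symm.trans ?_).trans
      (IsNilpotent.map_exp (hB.isNilpotent_trLog h𝔫 a b) (expandAt (A := A) 0))
    rw [exp_trace_matLog hn', trLog, exp_trace_matLog hn, RingHom.map_det, hY, ← RingHom.map_det]
  rw [← h2]
  exact principalPart_ofPowerSeries _

theorem sum_Ioc_sub_pred {M : Type*} [AddCommGroup M] (f : ℤ → M) {a b : ℤ} (hab : a ≤ b) :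
    ∑ j ∈ Finset.Ioc a b, (f j - f (j - 1)) = f b - f a := by
  induction b, hab using Int.leInduction with
  | base => simp
  | succ b hab ih =>
    have h1 : Finset.Ioc a (b + 1) = insert (b + 1) (Finset.Ioc a b) := by
      ext i
      simp only [Finset.mem_Ioc, Finset.mem_insert]
      omega
    rw [h1, Finset.sum_insert (by simp), ih, add_sub_cancel_right]
    abel

/-- By translation, `T` sums over all `x` the principal parts at `0` of differences between sections
ending at `x` and `x - 1`. The cross relation lets all of them start at the same point, and the sum
telescopes. -/
theorem Banded.T_trLog_sub (hB : Banded 𝔫 m l B) (h𝔫 : 𝔫 ^ K = ⊥) {L : ℤ} (hL0 : 0 ≤ L)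
    (hL : ∀ s, -L < l s ∧ l s < L) {a c : ℤ} (hac : a + m * K ≤ c) :
    T (trLog l B a c - trLog l B a (c - 1)) =
      principalPart (expandAt 0 (trLog l B (-(m * K + L)) (m * K + L))) := by
  have hmK : (0 : ℤ) ≤ m * K := by positivity
  set φ : ℤ → ℤ → LaurentSeries A := fun x y => principalPart (expandAt 0 (trLog l B x y)) with hφ
  have hcross : ∀ e x x' y y' : ℤ, x ≤ e → x' ≤ e → e + m * K ≤ y + 1 → e + m * K ≤ y' + 1 →
      φ x y + φ x' y' = φ x' y + φ x y' := fun e x x' y y' h1 h2 h3 h4 => by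
    simp only [hφ, ← map_add, hB.trLog_cross h𝔫 e h1 h2 h3 h4]
  have hneg : ∀ x y : ℤ, y ≤ -L → φ x y = 0 := fun x y hy =>
    hB.principalPart_trLog_eq_zero h𝔫 fun i hi s => by
      have := Finset.mem_Icc.1 hi; have := hL s; omega
  have hpos : ∀ x y : ℤ, L ≤ x → φ x y = 0 := fun x y hy =>
    hB.principalPart_trLog_eq_zero h𝔫 fun i hi s => by
      have := Finset.mem_Icc.1 hi; have := hL s; omega
  set μ : ℤ := -(m * K + L)
  set ν : ℤ := m * K + L
  set G : ℤ → LaurentSeries A := fun x => φ (a - c + x) x - φ (a - c + x) (x - 1) with hG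
  have h1 : T (trLog l B a c - trLog l B a (c - 1)) = ∑ᶠ x, G x := by
    rw [← finsum_comp_equiv (Equiv.addLeft c)]
    refine finsum_congr fun j => ?_
    have e1 : a - c + (c + j) = a + j := by ring
    have e2 : c + j - 1 = c - 1 + j := by ring
    rw [map_sub, map_sub, hB.expandAt_trLog h𝔫, hB.expandAt_trLog h𝔫 j a (c - 1)]
    simp only [hG, hφ, Equiv.coe_addLeft, e1, e2]
  -- Small `x` give sections below all `l s`; for large `x` the lower end may be moved to `L`,
  -- giving sections above all `l s`.
  have hG0 : ∀ x, x ∉ Finset.Ioc (-L) ν → G x = 0 := fun x hx => by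
    rw [Finset.mem_Ioc, not_and_or] at hx
    rcases hx with hx | hx
    · simp only [hG]
      rw [hneg _ _ (by omega), hneg _ _ (by omega), sub_zero]
    · have := hcross (x - m * K) (a - c + x) L x (x - 1) (by omega) (by omega) (by omega)
        (by omega)
      rw [hpos L _ le_rfl, hpos L _ le_rfl, add_zero, zero_add] at this
      simp only [hG, this, sub_self]
  have hG1 : ∀ x ∈ Finset.Ioc (-L) ν, G x = φ μ x - φ μ (x - 1) := fun x hx => by
    rw [Finset.mem_Ioc] at hx
    have := hcross (x - m * K) (a - c + x) μ x (x - 1) (by omega) (by omega) (by omega) (by omega)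
    simp only [hG]
    rw [sub_eq_sub_iff_add_eq_add, this]
  rw [h1, finsum_eq_sum_of_support_subset G (s := Finset.Ioc (-L) ν) fun x hx => by
    by_contra h
    exact hx (hG0 x h), Finset.sum_congr rfl hG1, sum_Ioc_sub_pred _ (by omega),
    hneg μ _ le_rfl, sub_zero]

theorem Banded.expandAt_trLog_mem (hB : Banded 𝔫 m l B) (h𝔫 : 𝔫 ^ K = ⊥) (a b : ℤ) :
    expandAt 0 (trLog l B a b) ∈ laurentIdeal 𝔫 := by
  have h1 : ((𝔫.map C).map (algebraMap A[X] (PartialFractions A))) ≤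
      (laurentIdeal 𝔫).comap (expandAt 0) := by
    rw [Ideal.map_le_iff_le_comap, Ideal.map_le_iff_le_comap]
    intro x hx
    rw [Ideal.mem_comap, Ideal.mem_comap, Ideal.mem_comap, expandAt_zero_algebraMap]
    intro k
    have h2 : polyToLaurent A (C x) = HahnSeries.ofPowerSeries ℤ A (PowerSeries.C x) := by
      simp [polyToLaurent]
    rw [h2, PowerSeries.coeff_coe]
    split_ifs
    · exact 𝔫.zero_mem
    · rw [PowerSeries.coeff_C]
      split_ifs
      exacts [hx, 𝔫.zero_mem]
  exact h1 (hB.trLog_mem h𝔫 a b)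

/-- The Weierstrass polynomial of `det B_{μ,ν}` is `εⁿ` times the exponential of the principal part
of the logarithm. -/
theorem Banded.single_mul_exp_principalPart (hB : Banded 𝔫 m l B) (h𝔫 : 𝔫 ^ K = ⊥) {μ ν : ℤ}
    (hl : ∀ s, l s ∈ Finset.Icc μ ν) {W : A[X]} {h : PowerSeries A}
    (hW : WFact 𝔫 n (dser B μ ν) W h) :
    HahnSeries.single (n : ℤ) (1 : A) *
      IsNilpotent.exp (principalPart (expandAt 0 (trLog l B μ ν))) = polyToLaurent A W := by
  set t := expandAt 0 (trLog l B μ ν) with ht_def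
  have ht : t ∈ laurentIdeal 𝔫 := hB.expandAt_trLog_mem h𝔫 μ ν
  have hpp := principalPart_mem_polarPart ht
  have hppn : IsNilpotent (principalPart t) := ⟨K, pow_eq_zero_of_mem_laurentIdeal h𝔫 hpp.1⟩
  obtain ⟨r, hr⟩ := exists_sub_principalPart_eq t
  set φ := HahnSeries.ofPowerSeries ℤ A with hφ
  have hrn : IsNilpotent r := by
    rw [← IsNilpotent.map_iff (f := φ) HahnSeries.ofPowerSeries_injective, ← hr]
    exact ⟨K, pow_eq_zero_of_mem_laurentIdeal h𝔫 (sub_mem ht hpp.1)⟩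
  -- The regular part `r` of the logarithm contributes only a unit power series.
  have hexp : IsNilpotent.exp t = IsNilpotent.exp (principalPart t) * φ (IsNilpotent.exp r) := by
    rw [IsNilpotent.map_exp hrn φ, ← hr, ← IsNilpotent.exp_add_of_commute (Commute.all _ _) hppn
      (by rw [hr]; exact hrn.map φ), add_sub_cancel]
  obtain ⟨E, hE, hE0⟩ := exists_diagProd_eq (A := A) l hl
  have hEu : IsUnit (E : PowerSeries A) := by
    rw [PowerSeries.isUnit_iff_constantCoeff, Polynomial.constantCoeff_coe, hE0]
    refine IsUnit.prod_iff.2 fun s _ => IsUnit.prod_iff.2 fun i hi => ?_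
    exact isUnit_intCast (sub_ne_zero.2 (Finset.ne_of_mem_erase hi))
  obtain ⟨u, hu⟩ := hEu.mul (IsNilpotent.isUnit_exp hrn)
  have h0 : IsNilpotent.exp t * polyToLaurent A (diagProd A l μ ν) =
      polyToLaurent A (idet B μ ν) := by
    have := hB.exp_expandAt_trLog h𝔫 0 μ ν
    rwa [add_zero, add_zero] at this
  have hX : polyToLaurent A (X ^ n) = HahnSeries.single (n : ℤ) (1 : A) := by
    rw [map_pow, polyToLaurent_X, HahnSeries.single_pow]; simp
  have h1 : φ u * (HahnSeries.single (n : ℤ) (1 : A) * IsNilpotent.exp (principalPart t)) =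
      φ (W * h) := by
    rw [← hW.eq]
    have h2 : φ (dser B μ ν) = polyToLaurent A (idet B μ ν) := rfl
    have h3 : φ (E : PowerSeries A) = polyToLaurent A E := rfl
    rw [h2, ← h0, hE, map_mul, hX, hexp, hu, map_mul, h3]
    ring
  have h2 : HahnSeries.single (n : ℤ) (1 : A) * IsNilpotent.exp (principalPart t) =
      φ (W * (h * (u⁻¹ : (PowerSeries A)ˣ).1)) := by
    refine (u.isUnit.map φ).mul_left_cancel ?_
    rw [h1, ← map_mul]
    congr 1
    calc (W : PowerSeries A) * h = W * h * (u * (u⁻¹ : (PowerSeries A)ˣ).1) := by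
          rw [Units.mul_inv, mul_one]
      _ = _ := by ring
  set v := h * (u⁻¹ : (PowerSeries A)ˣ).1
  have hN := exp_sub_one_mem_polarPart h𝔫 hpp
  have hcoeff : ∀ i : ℕ, PowerSeries.coeff i ((W : PowerSeries A) * v) =
      (IsNilpotent.exp (principalPart t) - 1).coeff ((i : ℤ) - n) + if i = n then 1 else 0 := by
    intro i
    have h3 := congrArg (fun x : LaurentSeries A => x.coeff (i : ℤ)) h2
    simp only [HahnSeries.coeff_single_mul, one_mul] at h3
    rw [PowerSeries.coeff_coe, if_neg (by omega), Int.natAbs_natCast] at h3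
    rw [← h3, HahnSeries.coeff_sub, HahnSeries.coeff_one]
    simp only [sub_eq_zero, Nat.cast_inj, sub_add_cancel]
  -- The exponential of the principal part is `1` plus negative powers with coefficients in `𝔫`, so
  -- the power series `W v` is a distinguished polynomial of degree `n`; hence `v = 1`.
  have hP : ((PowerSeries.trunc (n + 1) ((W : PowerSeries A) * v) : A[X]) : PowerSeries A) =
      W * v := by
    ext i
    rw [Polynomial.coeff_coe, PowerSeries.coeff_trunc]
    split_ifs with hi
    · rfl
    · rw [hcoeff, hN.2 _ (by omega), if_neg (by omega), add_zero]
  have hdist : Distinguished 𝔫 n (PowerSeries.trunc (n + 1) ((W : PowerSeries A) * v)) :=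
    { natDegree_le := Nat.lt_succ_iff.1 (PowerSeries.natDegree_trunc_lt _ _)
      coeff_top := by
        rw [PowerSeries.coeff_trunc, if_pos (Nat.lt_succ_self n), hcoeff, if_pos rfl,
          hN.2 _ (by omega), zero_add]
      coeff_mem := fun i hi => by
        rw [PowerSeries.coeff_trunc, if_pos (by omega), hcoeff, if_neg hi.ne, add_zero]
        exact hN.1 _ }
  have hv := (hW.distinguished.eq_of_mul_eq h𝔫 hdist hP).2
  rw [h2, hv, mul_one]
  rfl

end PrincipalParts

/-! ### An integral model in which one can reduce modulo `p`. -/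

section IntegralModel

universe u

variable {R : Type u} [CommRing R] (I : Ideal R)

/-- The image of the natural numbers prime to `p`. -/
def primeToSubmonoid (A : Type*) [CommRing A] (p : ℕ) (hp : p.Prime) : Submonoid A where
  carrier := {x | ∃ s : ℕ, ¬ p ∣ s ∧ (s : A) = x}
  mul_mem' := by
    rintro _ _ ⟨s, hs, rfl⟩ ⟨t, ht, rfl⟩
    exact ⟨s * t, fun h => (hp.dvd_mul.1 h).elim hs ht, by push_cast; rfl⟩
  one_mem' := ⟨1, fun h => hp.one_lt.ne' (Nat.dvd_one.1 h), by simp⟩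

/-- The localization of `R / I ^ K` at the integers prime to `p`. -/
theorem exists_integral_model {p : ℕ} (hp : p.Prime) (K : ℕ) :
    ∃ (O : Type u) (_ : CommRing O) (g : R →+* O) (ψ : O →+* Level I K),
      ψ.comp g = toLevel I K ∧ (I.map g) ^ K = ⊥ ∧
      (∀ s : ℕ, ¬ p ∣ s → IsUnit (s : O)) ∧
      ∀ x : O, ∃ (r : R) (s : ℕ), ¬ p ∣ s ∧ (s : O) * x = g r := by
  set M := primeToSubmonoid (R ⧸ I ^ K) p hp with hM
  let g0 : R ⧸ I ^ K →+* Level I K := Ideal.Quotient.lift (I ^ K) (toLevel I K) fun x hx => by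
    have h1 := Ideal.mem_map_of_mem (toLevel I K) hx
    rwa [Ideal.map_pow, map_toLevel_pow, Ideal.mem_bot] at h1
  have hg0 : ∀ y : M, IsUnit (g0 y) := by
    rintro ⟨_, s, hs, rfl⟩
    have h1 := isUnit_intCast (A := Level I K) (c := s) (by
      rintro h
      exact hs (by rw [Int.natCast_eq_zero.1 h]; exact dvd_zero p))
    simpa using h1
  refine ⟨Localization M, inferInstance,
    (algebraMap (R ⧸ I ^ K) (Localization M)).comp (Ideal.Quotient.mk (I ^ K)),
    IsLocalization.lift hg0, ?_, ?_, ?_, ?_⟩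
  · ext x
    simp only [RingHom.comp_apply, IsLocalization.lift_eq]
    rfl
  · rw [← Ideal.map_map]
    refine map_pow_eq_bot _ ?_
    rw [← Ideal.map_pow, Ideal.map_quotient_self]
  · intro s hs
    have h1 := IsLocalization.map_units (Localization M) (⟨(s : R ⧸ I ^ K), s, hs, rfl⟩ : M)
    simpa using h1
  · intro x
    obtain ⟨y, ⟨_, s, hs, rfl⟩, hx⟩ := IsLocalization.exists_mk'_eq M x
    obtain ⟨r, rfl⟩ := Ideal.Quotient.mk_surjective y
    refine ⟨r, s, hs, ?_⟩
    have h1 := IsLocalization.mk'_spec' (Localization M) (Ideal.Quotient.mk (I ^ K) r)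
      (⟨(s : R ⧸ I ^ K), s, hs, rfl⟩ : M)
    rw [hx] at h1
    simpa using h1

end IntegralModel

/-! ### From characteristic `p` back to the completion. -/

section Congruence

variable {R : Type*} [CommRing R] {I : Ideal R} {n m : ℕ} {l : Fin n → ℤ} {q : ℤ → R[X]}
  {B : Matrix ℤ ℤ R[X]}

theorem IsAdmissible.natDegree_le (hB : IsAdmissible I m l q B) {d : ℕ}
    (hd : ∀ i : ℤ, i ≤ m → (q i).natDegree ≤ d * (1 + i.natAbs)) {i j : ℤ} (hij : j - i ≤ m) :
    (B i j).natDegree ≤ d * (1 + (j - i).natAbs) := by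
  rw [hB.entry i j hij]
  have h1 : (X + C (j : R)).natDegree ≤ 1 := natDegree_add_C.le.trans natDegree_X_le
  exact natDegree_comp_le.trans ((Nat.mul_le_mul_left _ h1).trans (by simpa using hd _ hij))

theorem exists_linear_bound (c₀ c₁ : ℕ) :
    ∃ C : ℝ, 0 < C ∧ ∃ p₀ : ℕ, ∀ p : ℕ, p₀ ≤ p → c₀ * ⌈C * p⌉₊ + c₁ ≤ p := by
  -- Half of `p` pays for `c₀ C p`, the other half for the rounding `c₀` and the constant `c₁`.
  refine ⟨1 / (2 * (c₀ + 1)), by positivity, 2 * (c₀ + c₁), fun p hp => ?_⟩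
  have h1 := (Nat.ceil_lt_add_one (a := 1 / (2 * (c₀ + 1)) * (p : ℝ)) (by positivity)).le
  have h2 : (2 * (c₀ + c₁) : ℝ) ≤ p := by exact_mod_cast hp
  have h3 : (c₀ : ℝ) * (1 / (2 * (c₀ + 1)) * (p : ℝ)) ≤ p / 2 := by
    rw [one_div, ← mul_assoc, ← div_eq_mul_inv, mul_comm, mul_div_assoc', div_le_div_iff₀
      (by positivity) (by positivity)]
    nlinarith [Nat.cast_nonneg (α := ℝ) p]
  have h4 : (c₀ * ⌈1 / (2 * (c₀ + 1)) * (p : ℝ)⌉₊ + c₁ : ℝ) ≤ p := by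
    nlinarith [mul_le_mul_of_nonneg_left h1 (Nat.cast_nonneg (α := ℝ) c₀)]
  exact_mod_cast h4

theorem isUnit_intCast_of_natCast {A : Type*} [CommRing A] {p : ℕ}
    (h : ∀ s : ℕ, ¬ p ∣ s → IsUnit (s : A)) {c : ℤ} (hc : c ≠ 0) (hcp : |c| < p) :
    IsUnit (c : A) := by
  have h1 := h c.natAbs fun hd => by
    have h1 := Nat.le_of_dvd (Int.natAbs_pos.2 hc) hd
    have h2 := Int.natCast_natAbs c
    omega
  rcases Int.natAbs_eq c with h2 | h2
  · rw [h2]; simpa using h1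
  · rw [h2]; simpa using h1

/-- With `p` this large, every nonzero `i - l s` met in the section `[-H, H]` is invertible in the
integral model. The Weierstrass factorization and `F` modulo `I ^ K` thus come from that model,
where reduction modulo `p` applies. -/
theorem IsAdmissible.congrMod (hB : IsAdmissible I m l q B) {d : ℕ}
    (hd : ∀ i : ℤ, i ≤ m → (q i).natDegree ≤ d * (1 + i.natAbs)) {L : ℕ}
    (hL : ∀ s, -(L : ℤ) < l s ∧ l s < L) {a b : ℤ} {p K : ℕ} (hp : p.Prime)
    (hK : (m + n + d * (1 + 3 * m) + 2) * K + (2 * (L + a.natAbs + b.natAbs) + 2) ≤ p)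
    {F : PowerSeries (Completion I)} (hF : ∀ μ ν : ℤ,
      μ ≤ -(m * K + L + |a| + |b|) → m * K + L + |a| + |b| ≤ ν →
      IsRatio (I.map (toLevel I K)) n (levelMat I B K) a (-b) μ ν (F.map (evalLevel I K))) :
    CongrMod I p K (detSeries I B a (p - b)) F := by
  obtain ⟨O, _, g, ψ, hψ, hnil, hunit, hfrac⟩ := exists_integral_model I hp K
  have hKp : (m * K + n * K + d * (1 + 3 * m) * K + 2 * K + (2 * (L + |a| + |b|) + 2) : ℤ) ≤ p := by
    have := hK
    zify at this
    linarith
  have hmK : (0 : ℤ) ≤ m * K := by positivity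
  have hnK : (0 : ℤ) ≤ n * K := by positivity
  have hdK : (0 : ℤ) ≤ d * (1 + 3 * m) * K := by positivity
  have ha := le_abs_self a
  have ha' := neg_abs_le a
  have hb := le_abs_self b
  have hb' := neg_abs_le b
  set H : ℤ := m * K + L + |a| + |b| with hH
  have hBO : Banded (I.map g) m l (B.map (mapRingHom g)) := hB.banded.map g Ideal.le_comap_map
  have hBψ : (B.map (mapRingHom g)).map (mapRingHom ψ) = levelMat I B K := by
    ext1 i j
    simp only [levelMat, Matrix.map_apply, coe_mapRingHom, Polynomial.map_map, hψ]
  obtain ⟨W, h, hW⟩ := hBO.exists_wFact hnil (μ := -H) (ν := H)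
    (fun s => by have := hL s; rw [Finset.mem_Icc]; omega)
    fun i hi s his => isUnit_intCast_of_natCast hunit (sub_ne_zero.2 his) (by
      have := hL s
      rw [Finset.mem_Icc] at hi
      rw [abs_lt]
      omega)
  obtain ⟨u, rfl⟩ := hW.isUnit
  obtain ⟨x, hx⟩ : ∃ x : PowerSeries O, (u : PowerSeries O) * x = (-1) ^ n *
      (dser (B.map (mapRingHom g)) (-H) (-b) * dser (B.map (mapRingHom g)) a H) :=
    ⟨_, Units.mul_inv_cancel_left u _⟩
  have hxb : IsRatio (I.map g) n (B.map (mapRingHom g)) a (-b) (-H) H x := ⟨W, u, hW, hx⟩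
  have hFx : F.map (evalLevel I K) = x.map ψ := by
    have h1 := hxb.map ψ (𝔫' := I.map (toLevel I K)) (by
      rw [Ideal.map_le_iff_le_comap, Ideal.comap_comap, hψ]
      exact Ideal.le_comap_map)
    rw [hBψ] at h1
    exact (hF (-H) H le_rfl le_rfl).unique (hB.banded_levelMat K) (map_toLevel_pow I K)
      (Int.natCast_nonneg L) hL (by rw [abs_neg]) (by rw [abs_neg]) (by rw [abs_neg])
      (by rw [abs_neg]) h1
  have hdet : (detSeries I B a (p - b)).map (evalLevel I K) =
      (dser (B.map (mapRingHom g)) a (p - b)).map ψ := by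
    rw [map_detSeries, map_dser, hBψ]
  have key : ∀ e < K, PowerSeries.coeff e (dser (B.map (mapRingHom g)) a (p - b)) -
      PowerSeries.coeff e x ∈ Ideal.span {(p : O)} := by
    intro e he
    rcases subsingleton_or_nontrivial (O ⧸ Ideal.span {(p : O)}) with hsub | hnon
    · rw [Ideal.Quotient.subsingleton_iff.1 hsub]
      trivial
    have hp0 : ((p : ℕ) : O ⧸ Ideal.span {(p : O)}) = 0 := by
      rw [← map_natCast (Ideal.Quotient.mk (Ideal.span {(p : O)})), Ideal.Quotient.eq_zero_iff_mem]
      exact Ideal.mem_span_singleton_self _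
    have hchar : CharP (O ⧸ Ideal.span {(p : O)}) p := (CharP.charP_iff_prime_eq_zero hp).2 hp0
    have hfact : Fact p.Prime := ⟨hp⟩
    set π := Ideal.Quotient.mk (Ideal.span {(p : O)}) with hπ
    have hBπ := hBO.map π (𝔫' := (I.map g).map π) Ideal.le_comap_map
    have hWπ := hW.map π (𝔫' := (I.map g).map π) Ideal.le_comap_map
    rw [map_dser] at hWπ
    have hxπ := congrArg (PowerSeries.map π) hx
    rw [map_mul, map_mul, map_mul, map_pow, map_neg, map_one, map_dser, map_dser] at hxπ
    obtain ⟨s, hs⟩ := hBπ.exists_eq_mul_of_charP (p := p) (K := K) (d := d) (map_pow_eq_bot π hnil)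
      (fun i j hij => by
        rw [Matrix.map_apply, Matrix.map_apply, coe_mapRingHom, coe_mapRingHom]
        exact (natDegree_map_le.trans natDegree_map_le).trans (hB.natDegree_le hd hij))
      (by nlinarith) (by zify [hp.one_le]; nlinarith) (by zify; nlinarith)
      (μ := -H) (ν := H) (a := a) (b := b) (by omega) (by omega) (by omega) (by nlinarith)
      (fun s => by have := hL s; nlinarith) (fun s => by have := hL s; omega)
      (fun s => by have := hL s; omega) (by omega) (by nlinarith) hWπ.distinguished hWπ.eq
    have h1 : (dser (B.map (mapRingHom g)) a (p - b)).map π =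
        x.map π * (1 + PowerSeries.X ^ (p - n * K) * s) := by
      rw [map_dser]
      refine hWπ.isUnit.mul_left_cancel (hs.trans ?_)
      exact ((mul_assoc _ _ _).symm.trans
        (congrArg (· * (1 + PowerSeries.X ^ (p - n * K) * s)) hxπ)).symm
    -- The error starts at `X ^ (p - n K)`, and `e < K ≤ p - n K`.
    have h2 := congrArg (PowerSeries.coeff e) h1
    rw [mul_add, mul_one, map_add, mul_left_comm, PowerSeries.coeff_X_pow_mul', if_neg, add_zero,
      PowerSeries.coeff_map, PowerSeries.coeff_map] at h2
    · exact (Ideal.Quotient.mk_eq_mk_iff_sub_mem _ _).1 h2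
    · have : n * K + K ≤ p := by zify; nlinarith
      omega
  intro e he
  obtain ⟨y, hy⟩ := Ideal.mem_span_singleton'.1 (key e he)
  obtain ⟨r, s, hs, hr⟩ := hfrac y
  refine ⟨r, s, hs, ?_⟩
  rw [map_sub, ← PowerSeries.coeff_map, ← PowerSeries.coeff_map, hFx, hdet, PowerSeries.coeff_map,
    PowerSeries.coeff_map, ← map_sub, ← hy, ← hψ, RingHom.comp_apply, ← hr]
  simp only [map_mul, map_natCast]
  ring

end Congruence

/-! ### Existence of the limits. -/

section Limits

variable {R : Type*} [CommRing R] {I : Ideal R} {n m : ℕ} {l : Fin n → ℤ} {q : ℤ → R[X]}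
  {B : Matrix ℤ ℤ R[X]}

theorem exists_natCast_bound (l : Fin n → ℤ) : ∃ L : ℕ, ∀ s, -(L : ℤ) < l s ∧ l s < L := by
  refine ⟨1 + ∑ s, (l s).natAbs, fun s => ?_⟩
  have := Finset.single_le_sum (f := fun s => (l s).natAbs) (fun _ _ => Nat.zero_le _)
    (Finset.mem_univ s)
  omega

theorem eventually_ge_prod (N₀ : ℕ) {p : ℕ × ℕ → Prop}
    (h : ∀ M N : ℕ, N₀ ≤ M → N₀ ≤ N → p (M, N)) : ∀ᶠ MN : ℕ × ℕ in Filter.atTop, p MN :=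
  (Filter.eventually_ge_atTop ((N₀, N₀) : ℕ × ℕ)).mono fun MN hMN => h MN.1 MN.2 hMN.1 hMN.2

theorem IsAdmissible.exists_limit_trLog (hB : IsAdmissible I m l q B) {L : ℕ}
    (hL : ∀ s, -(L : ℤ) < l s ∧ l s < L) {w : (Completion I)[X]}
    (hw : ∀ K : ℕ, ∀ μ ν : ℤ, μ ≤ -(m * K + L) → m * K + L ≤ ν →
      ∃ h, WFact (I.map (toLevel I K)) n (dser (levelMat I B K) μ ν)
        (w.map (evalLevel I K)) h) (b : ℤ) :
    ∃ g : ∀ K, PartialFractions (Level I K),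
      IsAdicLimit Filter.atTop
        (fun (N : ℕ) K =>
          (matLog (sect (normalized I l B K) (-(N : ℤ)) (-b))).trace -
            (matLog (sect (normalized I l B K) (-(N : ℤ)) (-b - 1))).trace) g ∧
      ∀ K, IsNilpotent (T (g K)) ∧
        HahnSeries.single (n : ℤ) (1 : Level I K) * IsNilpotent.exp (T (g K)) =
          polyToLaurent (Level I K) (w.map (evalLevel I K)) := by
  have hb1 := neg_abs_le b
  have hb2 := le_abs_self b
  -- The value at `N = |b| + m K`, from which point on the cross relation makes the sequence
  -- constant modulo `I ^ K`.
  refine ⟨fun K => trLog l (levelMat I B K) (-(b.natAbs + m * K : ℕ)) (-b) -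
    trLog l (levelMat I B K) (-(b.natAbs + m * K : ℕ)) (-b - 1), fun K => ?_, fun K => ?_⟩
  · filter_upwards [Filter.eventually_ge_atTop (b.natAbs + m * K)] with N hN
    have h1 := (hB.banded_levelMat K).trLog_cross (map_toLevel_pow I K) (-b - m * K)
      (a := -(N : ℤ)) (a' := -(b.natAbs + m * K : ℕ)) (b := -b) (b' := -b - 1)
      (by zify at hN; omega) (by push_cast; omega) (by omega) (by omega)
    change trLog l (levelMat I B K) (-(N : ℤ)) (-b) - trLog l (levelMat I B K) (-(N : ℤ)) (-b - 1) =
      _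
    rw [sub_eq_sub_iff_add_eq_add, h1]
  · have hBK := hB.banded_levelMat K
    have h𝔫 := map_toLevel_pow I K
    rw [hBK.T_trLog_sub h𝔫 (Int.natCast_nonneg L) hL (by push_cast; omega)]
    obtain ⟨h, hW⟩ := hw K (-(m * K + L)) (m * K + L) le_rfl le_rfl
    refine ⟨⟨K, pow_eq_zero_of_mem_laurentIdeal h𝔫
      (principalPart_mem (hBK.expandAt_trLog_mem h𝔫 _ _))⟩,
      hBK.single_mul_exp_principalPart h𝔫 (fun s => ?_) hW⟩
    have := hL s
    have hmK : (0 : ℤ) ≤ m * K := by positivity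
    rw [Finset.mem_Icc]
    omega

theorem IsAdmissible.exists_limit_ratio (hB : IsAdmissible I m l q B) {L : ℕ}
    (hL : ∀ s, -(L : ℤ) < l s ∧ l s < L) {w : (Completion I)[X]}
    (hw : ∀ K : ℕ, ∀ μ ν : ℤ, μ ≤ -(m * K + L) → m * K + L ≤ ν →
      ∃ h, WFact (I.map (toLevel I K)) n (dser (levelMat I B K) μ ν)
        (w.map (evalLevel I K)) h) (a b : ℤ) :
    ∃ ρ : ∀ K, LaurentSeries (Level I K),
      IsAdicLimit Filter.atTop
        (fun (MN : ℕ × ℕ) K =>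
          detLaurent I B (-(MN.1 : ℤ)) (-b) K * detLaurent I B a MN.2 K *
            Ring.inverse (detLaurent I B (-(MN.1 : ℤ)) MN.2 K)) ρ ∧
      ∃ F : PowerSeries (Completion I),
        (∀ K, HahnSeries.ofPowerSeries ℤ (Level I K) (F.map (evalLevel I K)) =
          (-1) ^ n * polyToLaurent (Level I K) (w.map (evalLevel I K)) * ρ K) ∧
        ((∃ d : ℕ, ∀ i : ℤ, i ≤ m → (q i).natDegree ≤ d * (1 + i.natAbs)) →
          ∃ C : ℝ, 0 < C ∧ ∃ p₀ : ℕ, ∀ p : ℕ, p.Prime → p₀ ≤ p →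
            CongrMod I p ⌈C * p⌉₊ (detSeries I B a (p - b)) F) := by
  obtain ⟨F, hF⟩ := hB.exists_limit_isRatio (Int.natCast_nonneg L) hL a (-b)
  simp only [abs_neg] at hF
  have hr : ∀ (K : ℕ) (μ ν : ℤ), μ ≤ -(m * K + L + |a| + |b|) → m * K + L + |a| + |b| ≤ ν →
      HahnSeries.ofPowerSeries ℤ (Level I K) (F.map (evalLevel I K)) =
        (-1) ^ n * polyToLaurent (Level I K) (w.map (evalLevel I K)) *
          (detLaurent I B μ (-b) K * detLaurent I B a ν K *
            Ring.inverse (detLaurent I B μ ν K)) := fun K μ ν hμ hν => by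
    have ha := abs_nonneg a
    have hb := abs_nonneg b
    obtain ⟨h, hW⟩ := hw K μ ν (by omega) (by omega)
    exact IsRatio.ofPowerSeries_eq hB hW (hF K μ ν hμ hν)
  have hH : ∀ K : ℕ, ((m * K + L + a.natAbs + b.natAbs : ℕ) : ℤ) = m * K + L + |a| + |b| :=
    fun K => by push_cast [Int.natCast_natAbs]; rfl
  refine ⟨fun K => detLaurent I B (-(m * K + L + |a| + |b|)) (-b) K *
      detLaurent I B a (m * K + L + |a| + |b|) K *
        Ring.inverse (detLaurent I B (-(m * K + L + |a| + |b|)) (m * K + L + |a| + |b|) K),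
    fun K => eventually_ge_prod (m * K + L + a.natAbs + b.natAbs) fun M N hM hN => ?_, F,
    fun K => hr K _ _ le_rfl le_rfl, ?_⟩
  · zify at hM hN
    have h1 := hr K (-M) N (by omega) (by omega)
    rw [hr K _ _ le_rfl le_rfl] at h1
    -- As a Laurent series the Weierstrass polynomial divides an invertible determinant. Hence
    -- constancy of `F` gives constancy of the ratio.
    have hu : IsUnit ((-1) ^ n * polyToLaurent (Level I K) (w.map (evalLevel I K))) := by
      refine ((isUnit_one.neg).pow n).mul ?_
      obtain ⟨h, hW⟩ := hw K (-(m * K + L)) (m * K + L) le_rfl le_rfl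
      have h2 := hB.isUnit_detLaurent (-(m * K + L)) (m * K + L) K
      rw [detLaurent_eq, hW.eq, map_mul] at h2
      exact isUnit_of_mul_isUnit_left h2
    exact (hu.mul_left_cancel h1).symm
  · rintro ⟨d, hd⟩
    obtain ⟨C, hC, p₀, hp₀⟩ := exists_linear_bound (m + n + d * (1 + 3 * m) + 2)
      (2 * (L + a.natAbs + b.natAbs) + 2)
    exact ⟨C, hC, p₀, fun p hp hpp => hB.congrMod hd hL hp (hp₀ p hpp) (hF _)⟩

end Limits

end PDet

end

/-! ### Assembly of the theorem. -/

theorem theorem2 {R : Type*} [CommRing R] (I : Ideal R) (hI : I ≠ ⊤)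
    (hR : PDet.ResidueAssumption I) (n m : ℕ) (l : Fin n → ℤ) (q : ℤ → R[X])
    (B : Matrix ℤ ℤ R[X]) (hB : PDet.IsAdmissible I m l q B) :
    ∃ (W : ℕ × ℕ → (PDet.Completion I)[X]) (w : (PDet.Completion I)[X]),
      -- for large `M, N` the series `det B_{-M,N}` has the unique Weierstrass polynomial `W (M, N)`
      (∀ᶠ MN : ℕ × ℕ in Filter.atTop, (W MN).natDegree = n ∧
        ∀ P, PDet.IsWeierstrassPolynomial I (PDet.detSeries I B (-(MN.1 : ℤ)) MN.2) P ↔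
          P = W MN) ∧
      -- these polynomials converge to `w`
      w.IsDistinguishedAt (PDet.augIdeal I) ∧ w.natDegree = n ∧
      PDet.IsAdicLimit Filter.atTop (fun MN K => (W MN).map (PDet.evalLevel I K))
        (fun K => w.map (PDet.evalLevel I K)) ∧
      -- the logarithms of the finite sections of `A(ε)` are well defined modulo each `I ^ K`
      (∀ (K : ℕ) (c d : ℤ), IsNilpotent (PDet.sect (PDet.normalized I l B K) c d - 1)) ∧
      -- `ε ^ n * exp T (lim tr (log A_{-N,-b} - log A_{-N,-b-1})) = w`
      (∀ b : ℤ, ∃ g : ∀ K, PDet.PartialFractions (PDet.Level I K),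
        PDet.IsAdicLimit Filter.atTop
          (fun (N : ℕ) K =>
            (PDet.matLog (PDet.sect (PDet.normalized I l B K) (-(N : ℤ)) (-b))).trace -
              (PDet.matLog (PDet.sect (PDet.normalized I l B K) (-(N : ℤ)) (-b - 1))).trace) g ∧
        ∀ K, IsNilpotent (PDet.T (g K)) ∧
          HahnSeries.single (n : ℤ) (1 : PDet.Level I K) * IsNilpotent.exp (PDet.T (g K)) =
            PDet.polyToLaurent (PDet.Level I K) (w.map (PDet.evalLevel I K))) ∧
      (∀ a b : ℤ, 0 < a + b →
        -- `ρ = lim det B_{-M,-b} det B_{a,N} / det B_{-M,N}`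
        ∃ ρ : ∀ K, LaurentSeries (PDet.Level I K),
          (∀ K, ∀ᶠ MN : ℕ × ℕ in Filter.atTop,
            IsUnit (PDet.detLaurent I B (-(MN.1 : ℤ)) MN.2 K)) ∧
          PDet.IsAdicLimit Filter.atTop
            (fun (MN : ℕ × ℕ) K =>
              PDet.detLaurent I B (-(MN.1 : ℤ)) (-b) K * PDet.detLaurent I B a MN.2 K *
                Ring.inverse (PDet.detLaurent I B (-(MN.1 : ℤ)) MN.2 K)) ρ ∧
          -- `F = (-1) ^ n * w * ρ` is a power series in `ε`
          ∃ F : PowerSeries (PDet.Completion I),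
            (∀ K, HahnSeries.ofPowerSeries ℤ (PDet.Level I K) (F.map (PDet.evalLevel I K)) =
              (-1) ^ n * PDet.polyToLaurent (PDet.Level I K) (w.map (PDet.evalLevel I K)) * ρ K) ∧
            -- if the degrees of the `q i` grow at most linearly, then
            -- `det B_{a,p-b}` is congruent to `F` modulo `p`, `I ^ ⌈C p⌉`, `ε ^ ⌈C p⌉`
            ((∃ d : ℕ, ∀ i : ℤ, i ≤ m → (q i).natDegree ≤ d * (1 + i.natAbs)) →
              ∃ C : ℝ, 0 < C ∧ ∃ p₀ : ℕ, ∀ p : ℕ, p.Prime → p₀ ≤ p →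
                PDet.CongrMod I p ⌈C * p⌉₊ (PDet.detSeries I B a (p - b)) F)) := by
  have := PDet.nontrivial_level_one I hI hR
  obtain ⟨L, hL⟩ := PDet.exists_natCast_bound l
  obtain ⟨w, hw⟩ := hB.exists_limit_wFact (Int.natCast_nonneg L) hL
  -- The bound `L` is independent of `K`, so one pair `(M, N)` works at all levels at once. For
  -- smaller `M` or `N` the value is a default zero, which the limits ignore.
  have hW : ∀ MN : ℕ × ℕ, ∃ (W : (PDet.Completion I)[X]) (h : PowerSeries (PDet.Completion I)),
      L ≤ MN.1 → L ≤ MN.2 → ∀ K, PDet.WFact (I.map (PDet.toLevel I K)) n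
        ((PDet.detSeries I B (-(MN.1 : ℤ)) MN.2).map (PDet.evalLevel I K))
        (W.map (PDet.evalLevel I K)) (h.map (PDet.evalLevel I K)) := fun MN => by
    by_cases hMN : L ≤ MN.1 ∧ L ≤ MN.2
    · obtain ⟨W, h, H⟩ := PDet.exists_wFact_completion I
        (PDet.detSeries I B (-(MN.1 : ℤ)) MN.2) fun K => by
          rw [PDet.map_detSeries]
          refine hB.exists_wFact (fun s => ?_) K
          have := hL s
          rw [Finset.mem_Icc]
          omega
      exact ⟨W, h, fun _ _ => H⟩
    · exact ⟨0, 0, fun h1 h2 => absurd ⟨h1, h2⟩ hMN⟩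
  choose W h hWh using hW
  have hdist := PDet.distinguished_of_levels (I := I) (P := w) (n := n) fun K => by
    obtain ⟨h, H⟩ := hw K _ _ le_rfl le_rfl
    exact H.distinguished
  refine ⟨W, w, PDet.eventually_ge_prod L fun M N hM hN => ⟨?_, ?_⟩, hdist.1, hdist.2,
    fun K => PDet.eventually_ge_prod (m * K + L) fun M N hM hN => ?_,
    fun K c d => (hB.banded_levelMat K).isNilpotent_sect (PDet.map_toLevel_pow I K) c d,
    hB.exists_limit_trLog hL hw, fun a b _ => ?_⟩
  · exact (PDet.distinguished_of_levels fun K => (hWh (M, N) hM hN K).distinguished).2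
  · exact PDet.isWeierstrassPolynomial_iff (hWh (M, N) hM hN)
  · obtain ⟨h', H⟩ := hw K (-M) N (by zify at hM; omega) (by zify at hN; omega)
    have h1 := hWh (M, N) (le_of_add_le_right hM) (le_of_add_le_right hN) K
    rw [PDet.map_detSeries] at h1
    exact (h1.unique (PDet.map_toLevel_pow I K) H).1
  · obtain ⟨ρ, h1, h2⟩ := hB.exists_limit_ratio hL hw a b
    exact ⟨ρ, fun K => Filter.Eventually.of_forall fun MN => hB.isUnit_detLaurent _ _ K, h1, h2⟩
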